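/- **Graphs.** All graphs are finite subgraphs of the square lattice $\mathbb Z^2$; a cell is named by its lower-left corner, and row $y$ consists of the cells with lower-left ordinate $y$. A vertical edge $\{(x,y),(x,y+1)\}$, or a horizontal edge $\{(x,y),(x+1,y)\}$, is *even* if $x+y$ is even and *odd* otherwise. The *matching polynomial* of a graph $G$ is $M(G)=\sum_{K}\prod_{e\in K}e$, where $K$ runs over the perfect matchings of $G$ and the edges are commuting indeterminates (so $M(\emptyset)=1$). Intersections and unions of graphs are taken on vertices and on edges; $G\setminus H$ is obtained from $G$ by deleting the vertices of $H$. **Pinecones.** Let $a+b$ be even. A *pinecone of width $2k-1$ rooted at $(a,b)$* is a subgraph $P$ of the square lattice such that: (1) its horizontal edges form, for some $i\ge1$, $j\ge0$, exactly one segment of odd length $L_m$ at each ordinate $b+m$, $-j\le m\le i$, starting at abscissa $a+m-1$ if $m\ge1$ and $a-m$ if $m\le0$, with $L_{-j}<\dots<L_{-1}<L_0=2k-1=L_1>L_2>\dots>L_i$; (2) its vertices are the endpoints of these edges; (3) it contains every even vertical lattice edge joining two of its vertices (odd vertical edges may be present or absent). It is standard if $(a,b)=(0,0)$. It is *closed*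 if no vertex has degree $1$; the empty graph is also regarded as a closed pinecone. The *core*, with respect to $(a,b)$, of a graph $G$ is the union of all closed pinecones rooted at $(a,b)$ contained in $G$ (possibly empty). **Sub-pinecones.** Let $D(a,b,k)$ be the Aztec diamond graph of width $2k-1$ formed by the cells $(x,b+r)$ with $|r|<k$ and $a+|r|\le x\le a+2k-2-|r|$ (empty if $k\le0$). Let $P$ be a nonempty closed pinecone of width $2k-1$ rooted at $(a,b)$, and let $A=D(a,b,k)$, the smallest diamond graph containing $P$. Let $G$ be the spanning subgraph of $A$ whose edges are all edges of $P$, all horizontal edges of $A$ and all even vertical edges of $A$. Let $P^W,P^E,P^N,P^S,P^C$ be the cores of the intersections of $G$ with, respectively, $$D(a,b,k-1),\quad D(a+2,b,k-1),\quad D(a+1,b+1,k-1),\quad D(a+1,b-1,k-1),\quad D(a+2,b,k-2),$$ each core being taken with respect to the root of the diamond. **Horizontal factors.** For a pinecone $Q$ and a set of rows, the part of $Q$ formed of these rows consists of the vertices and edges of $Q$ on the boundary of the cells in these rows whose top and bottom sides both belong to $Q$. Let $P^C_\le$ and $P^C_\ge$ be the parts of $P^C$ formed of the rows $y\le b$ and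 $y\ge b$, let $P^N_<$ be the part of $P^N$ formed of the rows $y<b+1$, and $P^S_>$ the part of $P^S$ formed of the rows $y>b-1$. **Theorem.** Let $P$ be a nonempty closed pinecone of width $2k-1$ rooted at $(a,b)$. Each of the graphs $P^C_\le\setminus P^N_<$ and $P^C_\ge\setminus P^S_>$ has a unique perfect matching consisting of horizontal edges only. Let $H^-(P^C\setminus P^N)$ be the product of the edges at ordinate $\le b$ in that of $P^C_\le\setminus P^N_<$, and $H^+(P^C\setminus P^S)$ the product of the edges at ordinate $>b$ in that of $P^C_\ge\setminus P^S_>$. Then $$M(P)\,M(P^C)=\Big(\prod_{\alpha\in E_1}\alpha\Big)M(P^W)\,M(P^E)+\Big(\prod_{\alpha\in E_2}\alpha\Big)H^-(P^C\setminus P^N)\,H^+(P^C\setminus P^S)\,M(P^N)\,M(P^S),$$ where - $E_1$ is the set of left edges of $P$ (the leftmost edges of its horizontal segments) that do not belong to $P^W$; - $E_2=E_2^0\cup E_2^1\cup E_2^2$, where $E_2^0$ consists of the eastmost and the westmost vertical edges of $P$, $E_2^1$ of the even horizontal edges of $P$ at ordinate $b+1$ not belonging to $P^N$, and $E_2^2$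 of the odd horizontal edges of $P$ at ordinate $b$ not belonging to $P^S$. -/

import Mathlib

open scoped BigOperators

noncomputable section

namespace Pinecone

/-- The square lattice: vertex set `ℤ × ℤ`, edges joining points at distance one. -/
def squareLattice : SimpleGraph (ℤ × ℤ) where
  Adj u v := |u.1 - v.1| + |u.2 - v.2| = 1
  symm := ⟨fun u v h => by rw [abs_sub_comm v.1, abs_sub_comm v.2]; exact h⟩
  loopless := ⟨fun u h => by simp at h⟩

/-- Subgraphs of the square lattice. -/
abbrev LatticeGraph := squareLattice.Subgraph

/-- The horizontal edge whose leftmost vertex is `(x, y)`. -/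
def hEdge (x y : ℤ) : Sym2 (ℤ × ℤ) := s((x, y), (x + 1, y))

/-- The vertical edge whose lowest vertex is `(x, y)`. -/
def vEdge (x y : ℤ) : Sym2 (ℤ × ℤ) := s((x, y), (x, y + 1))

/-! ### Matching polynomials -/

/-- `K` is a perfect matching of `G`: a subgraph of `G` with the same vertices as `G`, every vertex
of which lies on exactly one edge of `K`. -/
def IsPerfectMatchingOf (G K : LatticeGraph) : Prop :=
  K ≤ G ∧ K.verts = G.verts ∧ K.IsMatching

/-- The product of the indeterminates attached to the edges in a (finite) edge set. -/
def edgeProd (E : Set (Sym2 (ℤ × ℤ))) : MvPolynomial (Sym2 (ℤ × ℤ)) ℤ :=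
  ∏ᶠ e ∈ E, MvPolynomial.X e

/-- The matching polynomial of a finite graph, one indeterminate per edge.
All graphs it is used for are finite, so that the sum and the products are finite. -/
def matchingPoly (G : LatticeGraph) : MvPolynomial (Sym2 (ℤ × ℤ)) ℤ :=
  ∑ᶠ K ∈ {K : LatticeGraph | IsPerfectMatchingOf G K}, edgeProd K.edgeSet

/-- `K` is a perfect matching of `G` that uses horizontal edges only. -/
def IsHorizontalMatchingOf (G K : LatticeGraph) : Prop :=
  IsPerfectMatchingOf G K ∧ ∀ e ∈ K.edgeSet, ∃ x y : ℤ, e = hEdge x y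

/-! ### Unions of cells, diamond graphs -/

/-- The four corners of the unit cell with lower left corner `c`. -/
def corners (c : ℤ × ℤ) : Set (ℤ × ℤ) :=
  {(c.1, c.2), (c.1 + 1, c.2), (c.1, c.2 + 1), (c.1 + 1, c.2 + 1)}

/-- The graph formed by the corners and the sides of the cells of a set `C`
(cells are named by their lower left corners). -/
def cellGraph (C : Set (ℤ × ℤ)) : LatticeGraph where
  verts := {v | ∃ c ∈ C, v ∈ corners c}
  Adj u v := squareLattice.Adj u v ∧ ∃ c ∈ C, u ∈ corners c ∧ v ∈ corners c
  adj_sub h := h.1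
  edge_vert h := by
    obtain ⟨_, c, hc, hu, _⟩ := h
    exact ⟨c, hc, hu⟩
  symm := ⟨fun u v h => by
    obtain ⟨h, c, hc, hu, hv⟩ := h
    exact ⟨h.symm, c, hc, hv, hu⟩⟩

/-- The diamond graph of width `2k - 1` whose longest row starts with the cell `(a, b)`:
for `|r| < k`, the cells of the row at height `b + r` are those with abscissas from
`a + |r|` to `a + 2k - 2 - |r|`. It is empty if `k ≤ 0`. -/
def diamond (a b k : ℤ) : LatticeGraph :=
  cellGraph {c | a + |c.2 - b| ≤ c.1 ∧ c.1 ≤ a + 2 * k - 2 - |c.2 - b|}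

/-! ### Pinecones -/

/-- Abscissa, relative to the root, of the left end of the horizontal segment at relative
ordinate `m`: the segments start at `(0,1), (1,2), …` and at `(0,0), (1,-1), …`. -/
def segStart (m : ℤ) : ℤ := if 1 ≤ m then m - 1 else -m

/-- `P` is a pinecone of width `2k - 1` with leftmost vertices `(a, b)` and `(a, b + 1)`,
where `a + b` is even. It is standard if `(a, b) = (0, 0)` and transplanted in general. -/
def IsPinecone (a b k : ℤ) (P : LatticeGraph) : Prop :=
  Even (a + b) ∧
  (∃ (i j : ℤ) (L : ℤ → ℤ), 1 ≤ i ∧ 0 ≤ j ∧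
    (∀ m ∈ Set.Icc (-j) i, 0 < L m ∧ Odd (L m)) ∧
    L 0 = 2 * k - 1 ∧ L 1 = 2 * k - 1 ∧
    StrictMonoOn L (Set.Icc (-j) 0) ∧ StrictAntiOn L (Set.Icc 1 i) ∧
    ∀ x m : ℤ, P.Adj (a + x, b + m) (a + x + 1, b + m) ↔
      m ∈ Set.Icc (-j) i ∧ segStart m ≤ x ∧ x < segStart m + L m) ∧
  (∀ x y : ℤ, (x, y) ∈ P.verts ↔ P.Adj (x, y) (x + 1, y) ∨ P.Adj (x - 1, y) (x, y)) ∧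
  (∀ x y : ℤ, (x, y) ∈ P.verts → (x, y + 1) ∈ P.verts → Even (x + y) →
    P.Adj (x, y) (x, y + 1))

/-- A nonempty closed pinecone: a pinecone without vertices of degree one. -/
def IsClosedPinecone (a b k : ℤ) (P : LatticeGraph) : Prop :=
  IsPinecone a b k P ∧ ∀ v ∈ P.verts, (P.neighborSet v).encard ≠ 1

/-- The core of a graph `G` with respect to the root `(a, b)`: the union of all closed pinecones
with leftmost vertices `(a, b)` and `(a, b + 1)` that are contained in `G`.
If there are none, it is the empty graph, which also counts as a closed pinecone. -/
def core (a b : ℤ) (G : LatticeGraph) : LatticeGraph :=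
  sSup {Q | Q ≤ G ∧ ∃ k : ℤ, IsClosedPinecone a b k Q}

/-! ### The five sub-pinecones -/

/-- The spanning subgraph of the diamond graph `A` formed of all its horizontal edges and all its
even vertical edges. -/
def skeleton (A : LatticeGraph) : LatticeGraph where
  verts := A.verts
  Adj u v := A.Adj u v ∧
    ((∃ x y : ℤ, s(u, v) = hEdge x y) ∨ ∃ x y : ℤ, Even (x + y) ∧ s(u, v) = vEdge x y)
  adj_sub h := h.1.adj_sub
  edge_vert h := A.edge_vert h.1
  symm := ⟨fun u v h => by rw [Sym2.eq_swap]; exact ⟨h.1.symm, h.2⟩⟩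

/-- The completion `G` of a pinecone `P` of width `2k - 1`: to `P` one adds all the vertices, all
the horizontal edges and all the even vertical edges of the smallest diamond graph containing `P`,
which is `diamond a b k`. -/
def completion (a b k : ℤ) (P : LatticeGraph) : LatticeGraph :=
  P ⊔ skeleton (diamond a b k)

/-- The core of the intersection of the completion of `P` with the West sub-diamond. -/
def subW (a b k : ℤ) (P : LatticeGraph) : LatticeGraph :=
  core a b (completion a b k P ⊓ diamond a b (k - 1))

/-- The core of the intersection of the completion of `P` with the East sub-diamond. -/
def subE (a b k : ℤ) (P : LatticeGraph) : LatticeGraph :=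
  core (a + 2) b (completion a b k P ⊓ diamond (a + 2) b (k - 1))

/-- The core of the intersection of the completion of `P` with the North sub-diamond. -/
def subN (a b k : ℤ) (P : LatticeGraph) : LatticeGraph :=
  core (a + 1) (b + 1) (completion a b k P ⊓ diamond (a + 1) (b + 1) (k - 1))

/-- The core of the intersection of the completion of `P` with the South sub-diamond. -/
def subS (a b k : ℤ) (P : LatticeGraph) : LatticeGraph :=
  core (a + 1) (b - 1) (completion a b k P ⊓ diamond (a + 1) (b - 1) (k - 1))

/-- The core of the intersection of the completion of `P` with the central sub-diamond. -/
def subC (a b k : ℤ) (P : LatticeGraph) : LatticeGraph :=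
  core (a + 2) b (completion a b k P ⊓ diamond (a + 2) b (k - 2))

/-! ### The edge sets and the horizontal factors -/

/-- The left edges of `P`: the leftmost edges of its horizontal segments. -/
def leftEdges (P : LatticeGraph) : Set (Sym2 (ℤ × ℤ)) :=
  {e | ∃ x y : ℤ, e = hEdge x y ∧ hEdge x y ∈ P.edgeSet ∧ hEdge (x - 1) y ∉ P.edgeSet}

/-- `E₁`: the left edges of `P` that do not belong to the West sub-pinecone. -/
def edgesE1 (a b k : ℤ) (P : LatticeGraph) : Set (Sym2 (ℤ × ℤ)) :=
  leftEdges P \ (subW a b k P).edgeSet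

/-- `E₂⁰`: the eastmost and westmost vertical edges of `P`. -/
def edgesE20 (P : LatticeGraph) : Set (Sym2 (ℤ × ℤ)) :=
  {e | ∃ x y : ℤ, e = vEdge x y ∧ vEdge x y ∈ P.edgeSet ∧
    ((∀ x' y' : ℤ, vEdge x' y' ∈ P.edgeSet → x' ≤ x) ∨
      (∀ x' y' : ℤ, vEdge x' y' ∈ P.edgeSet → x ≤ x'))}

/-- `E₂¹`: the even horizontal edges of `P` at relative ordinate `1` that do not belong to the
North sub-pinecone. -/
def edgesE21 (a b k : ℤ) (P : LatticeGraph) : Set (Sym2 (ℤ × ℤ)) :=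
  {e | e ∈ P.edgeSet ∧ ∃ x : ℤ, Even (x + (b + 1)) ∧ e = hEdge x (b + 1)} \
    (subN a b k P).edgeSet

/-- `E₂²`: the odd horizontal edges of `P` at relative ordinate `0` that do not belong to the
South sub-pinecone. -/
def edgesE22 (a b k : ℤ) (P : LatticeGraph) : Set (Sym2 (ℤ × ℤ)) :=
  {e | e ∈ P.edgeSet ∧ ∃ x : ℤ, Odd (x + b) ∧ e = hEdge x b} \ (subS a b k P).edgeSet

/-- `E₂ = E₂⁰ ∪ E₂¹ ∪ E₂²`. -/
def edgesE2 (a b k : ℤ) (P : LatticeGraph) : Set (Sym2 (ℤ × ℤ)) :=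
  edgesE20 P ∪ edgesE21 a b k P ∪ edgesE22 a b k P

/-- The part of a pinecone `Q` formed of its rows at heights `y ∈ R`. The row at height `y` lies
between the ordinates `y` and `y + 1`, and its cells are those whose bottom and top sides are
edges of `Q`. -/
def rowsPart (Q : LatticeGraph) (R : Set ℤ) : LatticeGraph :=
  Q ⊓ cellGraph {c | hEdge c.1 c.2 ∈ Q.edgeSet ∧ hEdge c.1 (c.2 + 1) ∈ Q.edgeSet ∧ c.2 ∈ R}

/-- The graph difference `G ∖ H`: the vertices of `G` that are not in `H`, and the edges of `G`
joining two of them (these cannot be edges of `H`). -/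
def graphDiff (G H : LatticeGraph) : LatticeGraph := G.deleteVerts H.verts

/-- `P^C_≤ ∖ P^N_<`, where the longest rows of `P^C` and `P^N` are at heights `b` and `b + 1`. -/
def diffCN (a b k : ℤ) (P : LatticeGraph) : LatticeGraph :=
  graphDiff (rowsPart (subC a b k P) (Set.Iic b)) (rowsPart (subN a b k P) (Set.Iio (b + 1)))

/-- `P^C_≥ ∖ P^S_>`, where the longest rows of `P^C` and `P^S` are at heights `b` and `b - 1`. -/
def diffCS (a b k : ℤ) (P : LatticeGraph) : LatticeGraph :=
  graphDiff (rowsPart (subC a b k P) (Set.Ici b)) (rowsPart (subS a b k P) (Set.Ioi (b - 1)))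

/-- The edges of `K` lying at relative ordinates in `R`, for the reference ordinate `b`. -/
def edgesAt (K : LatticeGraph) (b : ℤ) (R : Set ℤ) : Set (Sym2 (ℤ × ℤ)) :=
  {e | e ∈ K.edgeSet ∧ ∃ x m : ℤ, m ∈ R ∧ e = hEdge x (b + m)}

end Pinecone

end

noncomputable section

namespace Pinecone

open Finset

/-! ### Edges -/

/-! The theorem is a condensation identity for Aztec diamonds with arbitrary weights, applied with
weight zero on the absent edges; pinecones appear once forced edges are stripped off.

Condensation for diamonds. Colour the cells like a chessboard. The cells of the root's colour
partition the edges of a diamond. Urban renewal (`weightSum_urbanRenewal`) acts on all of them at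
once: in each cell, the set of corners matched inside the cell is replaced by its complement. This
extracts the product of the cell weights and leaves the concentric diamond of order one less
(`diamondSum_renewal`). Renewing all six diamonds lowers the order of the identity by one. Indeed
the cells of a diamond and of its centre are together those of West and East plus two extreme cells,
and also those of North and South plus two others; the weights of these four cells turn the renewed
weights of the extremal edges back into the original ones. Renewal divides by cell weights, so the
induction is run for positive real weights (`condensation_of_pos`). The result is a polynomial
identity, hence valid in every commutative ring, zero weights included (`condensation`).

Cores. In a closed pinecone the right end of each segment must carry a vertical edge. That edge can
only point towards the base, because the segments get shorter outwards, and parity makes it odd. So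
the right ends trace a chain of odd vertical edges moving strictly left away from the base.
Conversely, the vertices of the diamond weakly to the left of such chains (`Reach`) induce a closed
pinecone if there are any, so they induce the core (`core_inf_diamond`).

Forced edges. In a matching of the diamond, the vertices outside the core are forced, from right to
left, into horizontal pairs fixed by parity (`forcedEdges_subset`). Hence the weighted sum of a
diamond is a monomial times the matching polynomial of the core (`diamondSum_graphWeight`).

Monomials. Substituting into `condensation` gives the theorem up to monomials, whose exponents are
compared edge by edge (`west_east_monomials`, `north_south_monomials`). The inputs are that `P` and
East have the same bound on chains, that West and the centre do too, and that chains for North and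
South are chains for `P` without their first edge on one side, and on the other become chains for
the centre when their first edge is dropped. A nonzero monomial is cancelled at the end. -/

lemma hEdge_inj {x y x' y' : ℤ} : hEdge x y = hEdge x' y' ↔ x = x' ∧ y = y' := by
  simp only [hEdge, Sym2.eq_iff, Prod.mk.injEq]
  omega

lemma vEdge_inj {x y x' y' : ℤ} : vEdge x y = vEdge x' y' ↔ x = x' ∧ y = y' := by
  simp only [vEdge, Sym2.eq_iff, Prod.mk.injEq]
  omega

lemma hEdge_ne_vEdge (x y x' y' : ℤ) : hEdge x y ≠ vEdge x' y' := by
  simp only [hEdge, vEdge, ne_eq, Sym2.eq_iff, Prod.mk.injEq]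
  omega

lemma vEdge_ne_hEdge (x y x' y' : ℤ) : vEdge x y ≠ hEdge x' y' :=
  (hEdge_ne_vEdge _ _ _ _).symm

lemma mem_hEdge {v : ℤ × ℤ} {x y : ℤ} : v ∈ hEdge x y ↔ v.2 = y ∧ (v.1 = x ∨ v.1 = x + 1) := by
  obtain ⟨p, q⟩ := v
  simp only [hEdge, Sym2.mem_iff, Prod.mk.injEq]
  tauto

lemma mem_vEdge {v : ℤ × ℤ} {x y : ℤ} : v ∈ vEdge x y ↔ v.1 = x ∧ (v.2 = y ∨ v.2 = y + 1) := by
  obtain ⟨p, q⟩ := v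
  simp only [vEdge, Sym2.mem_iff, Prod.mk.injEq]
  tauto

/-! ### Covering a set of vertices by edges -/

/-- The number of edges of `F` at the vertex `v`. -/
def deg (F : Finset (Sym2 (ℤ × ℤ))) (v : ℤ × ℤ) : ℕ := #{e ∈ F | v ∈ e}

@[simp] lemma deg_empty (v : ℤ × ℤ) : deg ∅ v = 0 := by simp [deg]

lemma deg_insert {e : Sym2 (ℤ × ℤ)} {F : Finset (Sym2 (ℤ × ℤ))} (h : e ∉ F) (v : ℤ × ℤ) :
    deg (insert e F) v = (if v ∈ e then 1 else 0) + deg F v := by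
  unfold deg
  rw [filter_insert]
  split_ifs
  · rw [card_insert_of_notMem (by simp [h]), add_comm]
  · simp

lemma deg_union {F G : Finset (Sym2 (ℤ × ℤ))} (h : Disjoint F G) (v : ℤ × ℤ) :
    deg (F ∪ G) v = deg F v + deg G v := by
  unfold deg
  rw [filter_union, card_union_of_disjoint (disjoint_filter_filter h)]

lemma deg_pos {F : Finset (Sym2 (ℤ × ℤ))} {e : Sym2 (ℤ × ℤ)} {v : ℤ × ℤ} (he : e ∈ F)
    (hv : v ∈ e) : 0 < deg F v :=
  card_pos.2 ⟨e, mem_filter.2 ⟨he, hv⟩⟩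

open scoped Classical in
/-- The edges of `F` form a perfect matching of the vertex set `S`. -/
def Covers (S : Set (ℤ × ℤ)) (F : Finset (Sym2 (ℤ × ℤ))) : Prop :=
  ∀ v, deg F v = if v ∈ S then 1 else 0

lemma Covers.mem {S : Set (ℤ × ℤ)} {F : Finset (Sym2 (ℤ × ℤ))} (h : Covers S F)
    {e : Sym2 (ℤ × ℤ)} (he : e ∈ F) {v : ℤ × ℤ} (hv : v ∈ e) : v ∈ S := by
  by_contra hS
  have := h v
  rw [if_neg hS] at this
  exact (deg_pos he hv).ne' this

lemma Covers.exists_mem {S : Set (ℤ × ℤ)} {F : Finset (Sym2 (ℤ × ℤ))} (h : Covers S F)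
    {v : ℤ × ℤ} (hv : v ∈ S) : ∃ e ∈ F, v ∈ e := by
  have := h v
  rw [if_pos hv] at this
  obtain ⟨e, he⟩ := card_pos.1 (this.symm ▸ Nat.one_pos : 0 < deg F v)
  exact ⟨e, (mem_filter.1 he).1, (mem_filter.1 he).2⟩

lemma Covers.eq {S : Set (ℤ × ℤ)} {F : Finset (Sym2 (ℤ × ℤ))} (h : Covers S F)
    {e e' : Sym2 (ℤ × ℤ)} (he : e ∈ F) (he' : e' ∈ F) {v : ℤ × ℤ} (hv : v ∈ e) (hv' : v ∈ e') :
    e = e' := by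
  have h1 : deg F v = 1 := by rw [h v, if_pos (h.mem he hv)]
  exact card_le_one.1 h1.le e (mem_filter.2 ⟨he, hv⟩) e' (mem_filter.2 ⟨he', hv'⟩)

open scoped Classical in
/-- The weighted number of perfect matchings of the vertex set `S` by edges of `B`. -/
def weightSum {R : Type*} [CommSemiring R] (B : Finset (Sym2 (ℤ × ℤ))) (S : Set (ℤ × ℤ))
    (w : Sym2 (ℤ × ℤ) → R) : R :=
  ∑ F ∈ B.powerset with Covers S F, ∏ e ∈ F, w e

/-- An edge with an end outside `S` occurs in no matching of `S`. A smaller diamond can therefore be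
summed over the edge set of a larger one. -/
lemma weightSum_congr_edges {R : Type*} [CommSemiring R] {B B' : Finset (Sym2 (ℤ × ℤ))}
    {S : Set (ℤ × ℤ)} {w : Sym2 (ℤ × ℤ) → R}
    (h : ∀ e, (∀ v ∈ e, v ∈ S) → (e ∈ B ↔ e ∈ B')) : weightSum B S w = weightSum B' S w := by
  classical
  unfold weightSum
  congr 1
  ext F
  simp only [mem_filter, mem_powerset]
  constructor
  · rintro ⟨h1, h2⟩
    exact ⟨fun e he => (h e fun v hv => h2.mem he hv).1 (h1 he), h2⟩
  · rintro ⟨h1, h2⟩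
    exact ⟨fun e he => (h e fun v hv => h2.mem he hv).2 (h1 he), h2⟩

lemma weightSum_empty {R : Type*} [CommSemiring R] (B : Finset (Sym2 (ℤ × ℤ)))
    (hB : ∀ e ∈ B, ∃ v, v ∈ e) (w : Sym2 (ℤ × ℤ) → R) : weightSum B ∅ w = 1 := by
  classical
  unfold weightSum
  have : {F ∈ B.powerset | Covers ∅ F} = {∅} := by
    ext F
    simp only [mem_filter, mem_powerset, mem_singleton]
    constructor
    · rintro ⟨h1, h2⟩
      rw [eq_empty_iff_forall_notMem]
      intro e he
      obtain ⟨v, hv⟩ := hB e (h1 he)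
      exact h2.mem he hv
    · rintro rfl
      exact ⟨empty_subset _, fun v => by simp⟩
  rw [this]
  simp

/-! ### Products of local sums -/

lemma sum_powerset_union {α R : Type*} [DecidableEq α] [AddCommMonoid R] {A B : Finset α}
    (h : Disjoint A B) (f : Finset α → R) :
    ∑ F ∈ (A ∪ B).powerset, f F = ∑ G ∈ A.powerset, ∑ H ∈ B.powerset, f (G ∪ H) := by
  rw [← sum_product']
  symm
  refine sum_nbij' (fun p => p.1 ∪ p.2) (fun F => (F ∩ A, F ∩ B)) ?_ ?_ ?_ ?_ ?_
  · rintro ⟨G, H⟩ hp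
    simp only [mem_product, mem_powerset] at hp ⊢
    exact union_subset_union hp.1 hp.2
  · intro F _
    simp [inter_subset_right]
  · rintro ⟨G, H⟩ hp
    simp only [mem_product, mem_powerset] at hp
    rw [disjoint_left] at h
    ext a
    · simp only [mem_inter, mem_union]
      exact ⟨fun ⟨h1, h2⟩ => h1.resolve_right fun h3 => h h2 (hp.2 h3), fun h1 => ⟨.inl h1, hp.1 h1⟩⟩
    · simp only [mem_inter, mem_union]
      exact ⟨fun ⟨h1, h2⟩ => h1.resolve_left fun h3 => h (hp.1 h3) h2, fun h1 => ⟨.inr h1, hp.2 h1⟩⟩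
  · intro F hF
    simp only [mem_powerset] at hF
    simp only
    rw [← inter_union_distrib_left, inter_eq_left.2 hF]
  · simp

/-- Distributivity: a subset of a disjoint union is an independent choice of a subset in each block.
With cells as blocks, sums over matchings become products over cells. -/
lemma sum_powerset_biUnion_prod {ι α R : Type*} [DecidableEq ι] [DecidableEq α] [CommSemiring R]
    (s : Finset ι) (E : ι → Finset α) (hE : (s : Set ι).PairwiseDisjoint E)
    (g : ι → Finset α → R) :
    ∑ F ∈ (s.biUnion E).powerset, ∏ i ∈ s, g i (F ∩ E i) =
      ∏ i ∈ s, ∑ G ∈ (E i).powerset, g i G := by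
  induction s using Finset.induction_on with
  | empty => simp
  | insert i s hi ih =>
    have hd : Disjoint (E i) (s.biUnion E) := by
      rw [disjoint_biUnion_right]
      intro j hj
      exact hE (by simp) (by simp [hj]) (by rintro rfl; exact hi hj)
    rw [biUnion_insert, sum_powerset_union hd, prod_insert (M := R) hi,
      ← ih (hE.subset (by simp)), sum_mul_sum]
    refine sum_congr rfl fun G hG => sum_congr rfl fun H hH => ?_
    rw [mem_powerset] at hG hH
    rw [prod_insert (M := R) hi]
    congr 1
    · rw [union_inter_distrib_right, inter_eq_left.2 hG,
        (disjoint_iff_inter_eq_empty.1 (hd.symm.mono_left hH)), union_empty]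
    · refine prod_congr rfl fun j hj => ?_
      congr 1
      have : Disjoint G (E j) :=
        (hE (by simp) (by simp [hj]) (by rintro rfl; exact hi hj) : Disjoint (E i) (E j)).mono_left hG
      rw [union_inter_distrib_right, disjoint_iff_inter_eq_empty.1 this, empty_union]

/-! ### Cells -/

/-- The four sides of a cell. -/
def cellEdges (c : ℤ × ℤ) : Finset (Sym2 (ℤ × ℤ)) :=
  {hEdge c.1 c.2, hEdge c.1 (c.2 + 1), vEdge c.1 c.2, vEdge (c.1 + 1) c.2}

lemma mem_cellEdges {e : Sym2 (ℤ × ℤ)} {c : ℤ × ℤ} : e ∈ cellEdges c ↔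
    e = hEdge c.1 c.2 ∨ e = hEdge c.1 (c.2 + 1) ∨ e = vEdge c.1 c.2 ∨ e = vEdge (c.1 + 1) c.2 := by
  simp [cellEdges]

lemma mem_corners_of_mem_cellEdges {e : Sym2 (ℤ × ℤ)} {c v : ℤ × ℤ} (he : e ∈ cellEdges c)
    (hv : v ∈ e) : v ∈ corners c := by
  obtain ⟨p, q⟩ := v
  simp only [corners, Set.mem_insert_iff, Set.mem_singleton_iff, Prod.mk.injEq]
  rw [mem_cellEdges] at he
  rcases he with rfl | rfl | rfl | rfl <;> simp only [mem_hEdge, mem_vEdge] at hv <;> omega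

/-- The weight of the two perfect matchings of a cell. -/
def cellWeight {R : Type*} [CommSemiring R] (w : Sym2 (ℤ × ℤ) → R) (c : ℤ × ℤ) : R :=
  w (hEdge c.1 c.2) * w (hEdge c.1 (c.2 + 1)) + w (vEdge c.1 c.2) * w (vEdge (c.1 + 1) c.2)

open scoped Classical in
/-- The sum of the weights of the matchings of a cell that cover the corners lying in `T`. -/
def localSum {R : Type*} [CommSemiring R] (w : Sym2 (ℤ × ℤ) → R) (c : ℤ × ℤ) (T : Set (ℤ × ℤ)) :
    R :=
  ∑ G ∈ (cellEdges c).powerset,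
    if ∀ v ∈ corners c, deg G v = if v ∈ T then 1 else 0 then ∏ e ∈ G, w e else 0

/-- The weights `w'` are obtained from `w` by urban renewal in the cell `c`. -/
structure IsRenewal {K : Type*} [Field K] (w w' : Sym2 (ℤ × ℤ) → K) (c : ℤ × ℤ) : Prop where
  ne_zero : cellWeight w c ≠ 0
  bot : w' (hEdge c.1 c.2) = w (hEdge c.1 (c.2 + 1)) / cellWeight w c
  top : w' (hEdge c.1 (c.2 + 1)) = w (hEdge c.1 c.2) / cellWeight w c
  left : w' (vEdge c.1 c.2) = w (vEdge (c.1 + 1) c.2) / cellWeight w c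
  right : w' (vEdge (c.1 + 1) c.2) = w (vEdge c.1 c.2) / cellWeight w c

-- Only seven sets of sides are matchings: the empty set, the four single sides and the two opposite
-- pairs. The two pairs cover the same corners and merge into `cellWeight`. The indicator `t` of `T`
-- is kept as a variable so that its four values can be split into cases.
open scoped Classical in
lemma localSum_eq {R : Type*} [CommSemiring R] (w : Sym2 (ℤ × ℤ) → R) (c : ℤ × ℤ)
    (T : Set (ℤ × ℤ)) (t : ℕ → ℕ → ℕ)
    (ht : t = fun i j : ℕ => if (c.1 + (i : ℤ), c.2 + (j : ℤ)) ∈ T then 1 else 0) :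
    localSum w c T =
      (if t 0 0 = 0 ∧ t 1 0 = 0 ∧ t 0 1 = 0 ∧ t 1 1 = 0 then 1 else 0) +
      (if t 0 0 = 1 ∧ t 1 0 = 1 ∧ t 0 1 = 0 ∧ t 1 1 = 0 then w (hEdge c.1 c.2) else 0) +
      (if t 0 0 = 0 ∧ t 1 0 = 0 ∧ t 0 1 = 1 ∧ t 1 1 = 1 then w (hEdge c.1 (c.2 + 1)) else 0) +
      (if t 0 0 = 1 ∧ t 1 0 = 0 ∧ t 0 1 = 1 ∧ t 1 1 = 0 then w (vEdge c.1 c.2) else 0) +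
      (if t 0 0 = 0 ∧ t 1 0 = 1 ∧ t 0 1 = 0 ∧ t 1 1 = 1 then w (vEdge (c.1 + 1) c.2) else 0) +
      (if t 0 0 = 1 ∧ t 1 0 = 1 ∧ t 0 1 = 1 ∧ t 1 1 = 1 then cellWeight w c else 0) := by
  obtain ⟨x, y⟩ := c
  have h1 : hEdge x y ∉ ({hEdge x (y + 1), vEdge x y, vEdge (x + 1) y} : Finset _) := by
    simp [hEdge_inj, hEdge_ne_vEdge]
  have h2 : hEdge x (y + 1) ∉ ({vEdge x y, vEdge (x + 1) y} : Finset _) := by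
    simp [hEdge_ne_vEdge]
  have h3 : vEdge x y ∉ ({vEdge (x + 1) y} : Finset _) := by
    simp [vEdge_inj]
  have e0 : ((x, y) ∈ T) = (t 0 0 = 1) := by simp [ht]
  have e1 : ((x + 1, y) ∈ T) = (t 1 0 = 1) := by simp [ht]
  have e2 : ((x, y + 1) ∈ T) = (t 0 1 = 1) := by simp [ht]
  have e3 : ((x + 1, y + 1) ∈ T) = (t 1 1 = 1) := by simp [ht]
  have k0 : t 0 0 = 0 ∨ t 0 0 = 1 := by simp only [ht]; split_ifs <;> simp
  have k1 : t 1 0 = 0 ∨ t 1 0 = 1 := by simp only [ht]; split_ifs <;> simp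
  have k2 : t 0 1 = 0 ∨ t 0 1 = 1 := by simp only [ht]; split_ifs <;> simp
  have k3 : t 1 1 = 0 ∨ t 1 1 = 1 := by simp only [ht]; split_ifs <;> simp
  unfold localSum cellEdges
  simp only
  rw [sum_powerset_insert h1, sum_powerset_insert h2, sum_powerset_insert h2,
    sum_powerset_insert h3, sum_powerset_insert h3, sum_powerset_insert h3, sum_powerset_insert h3]
  clear ht
  have s0 : ({vEdge (x + 1) y} : Finset (Sym2 (ℤ × ℤ))) = insert (vEdge (x + 1) y) ∅ := rfl
  simp only [s0, sum_powerset_insert (notMem_empty _), powerset_empty, sum_singleton]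
  simp only [corners, Set.mem_insert_iff, Set.mem_singleton_iff, forall_eq_or_imp, forall_eq,
    e0, e1, e2, e3]
  simp (discharger := simp [hEdge_inj, vEdge_inj, hEdge_ne_vEdge]) only
    [deg_insert, deg_empty, prod_insert, prod_empty, mem_hEdge, mem_vEdge]
  rcases k0 with k0 | k0 <;> rcases k1 with k1 | k1 <;> rcases k2 with k2 | k2 <;>
    rcases k3 with k3 | k3 <;> simp [k0, k1, k2, k3, cellWeight, add_comm]

/-- Complementing the covered corners exchanges each side with the opposite one, and the empty
matching with the two full ones. Renewed weights are those of the opposite sides divided by the cell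
weight, and the renewed cell weight is the inverse of the old one, so one factor `cellWeight w c`
appears in every case. Corner sets of odd size or diagonal have complements of the same kind, and
both sums vanish. -/
lemma localSum_compl {K : Type*} [Field K] {w w' : Sym2 (ℤ × ℤ) → K} {c : ℤ × ℤ}
    (h : IsRenewal w w' c) {T T' : Set (ℤ × ℤ)} (hT : ∀ v ∈ corners c, v ∈ T' ↔ v ∉ T) :
    localSum w c T = cellWeight w c * localSum w' c T' := by
  classical
  obtain ⟨x, y⟩ := c
  simp only [corners, Set.mem_insert_iff, Set.mem_singleton_iff, forall_eq_or_imp, forall_eq] at hT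
  obtain ⟨t0, t1, t2, t3⟩ := hT
  have hw : cellWeight w' (x, y) = (cellWeight w (x, y))⁻¹ := by
    have := h.ne_zero
    rw [cellWeight, h.bot, h.top, h.left, h.right]
    field_simp
    simp only [cellWeight]
    ring
  rw [localSum_eq w (x, y) T _ rfl, localSum_eq w' (x, y) T' _ rfl, h.bot, h.top, h.left, h.right,
    hw]
  have := h.ne_zero
  simp only [Nat.cast_zero, Nat.cast_one, add_zero, t0, t1, t2, t3]
  by_cases a0 : (x, y) ∈ T <;> by_cases a1 : (x + 1, y) ∈ T <;> by_cases a2 : (x, y + 1) ∈ T <;>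
    by_cases a3 : (x + 1, y + 1) ∈ T <;> simp [a0, a1, a2, a3] <;> field_simp

/-! ### Urban renewal -/

/-- The cell of parity `p` that has `v` as a bottom vertex. -/
def upCell (p : ℤ) (v : ℤ × ℤ) : ℤ × ℤ := if Even (v.1 + v.2 + p) then v else (v.1 - 1, v.2)

/-- The cell of parity `p` that has `v` as a top vertex. -/
def downCell (p : ℤ) (v : ℤ × ℤ) : ℤ × ℤ :=
  if Even (v.1 + v.2 + p) then (v.1 - 1, v.2 - 1) else (v.1, v.2 - 1)

lemma upCell_ne_downCell (p : ℤ) (v : ℤ × ℤ) : upCell p v ≠ downCell p v := by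
  intro h
  have := congrArg Prod.snd h
  unfold upCell downCell at this
  split_ifs at this <;> simp only at this <;> omega

/-- Every vertex is a corner of exactly two cells of a given colour, one above it and one below it.
-/
lemma mem_corners_iff {p : ℤ} {c v : ℤ × ℤ} (hc : Even (c.1 + c.2 + p)) :
    v ∈ corners c ↔ (v.2 = c.2 ∧ c = upCell p v) ∨ (v.2 = c.2 + 1 ∧ c = downCell p v) := by
  obtain ⟨x, y⟩ := c
  obtain ⟨s, t⟩ := v
  simp only [corners, Set.mem_insert_iff, Set.mem_singleton_iff, Prod.mk.injEq, upCell, downCell]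
  simp only [Int.even_iff] at hc ⊢
  split_ifs <;> simp only [Prod.mk.injEq] <;> omega

lemma snd_upCell (p : ℤ) (v : ℤ × ℤ) : (upCell p v).2 = v.2 := by
  unfold upCell
  split_ifs <;> rfl

lemma snd_downCell (p : ℤ) (v : ℤ × ℤ) : (downCell p v).2 = v.2 - 1 := by
  unfold downCell
  split_ifs <;> rfl

/-- The two cells along an edge have opposite colours, so cells of one colour share no side. -/
lemma pairwiseDisjoint_cellEdges {p : ℤ} {s : Set (ℤ × ℤ)} (hs : ∀ c ∈ s, Even (c.1 + c.2 + p)) :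
    s.PairwiseDisjoint cellEdges := by
  rintro ⟨x, y⟩ hc ⟨x', y'⟩ hc' hne
  have h1 := hs _ hc
  have h2 := hs _ hc'
  rw [Function.onFun, disjoint_left]
  intro e he he'
  simp only [mem_cellEdges] at he he'
  simp only [Int.even_iff] at h1 h2
  apply hne
  rw [Prod.mk.injEq]
  rcases he with rfl | rfl | rfl | rfl <;>
    simp only [hEdge_inj, vEdge_inj, hEdge_ne_vEdge, vEdge_ne_hEdge, or_false, false_or] at he' <;>
    omega

section

variable {p : ℤ} {Act : Finset (ℤ × ℤ)} (hAct : ∀ c ∈ Act, Even (c.1 + c.2 + p))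

include hAct in
lemma deg_eq_up_add_down {F : Finset (Sym2 (ℤ × ℤ))} (hF : F ⊆ Act.biUnion cellEdges) (v : ℤ × ℤ) :
    deg F v = (if upCell p v ∈ Act then deg (F ∩ cellEdges (upCell p v)) v else 0) +
      (if downCell p v ∈ Act then deg (F ∩ cellEdges (downCell p v)) v else 0) := by
  have h1 : deg F v = ∑ c ∈ Act, deg (F ∩ cellEdges c) v := by
    unfold deg
    rw [← card_biUnion]
    · congr 1
      ext e
      simp only [mem_filter, mem_biUnion, mem_inter]
      constructor
      · rintro ⟨h1, h2⟩
        obtain ⟨c, hc, hec⟩ := mem_biUnion.1 (hF h1)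
        exact ⟨c, hc, ⟨h1, hec⟩, h2⟩
      · rintro ⟨c, hc, ⟨h1, -⟩, h2⟩
        exact ⟨h1, h2⟩
    · intro c hc c' hc' hne
      exact disjoint_filter_filter ((pairwiseDisjoint_cellEdges (s := Act) hAct hc hc' hne).mono
        inter_subset_right inter_subset_right)
  have h2 : ∀ c ∈ Act, deg (F ∩ cellEdges c) v =
      (if upCell p v = c then deg (F ∩ cellEdges (upCell p v)) v else 0) +
      (if downCell p v = c then deg (F ∩ cellEdges (downCell p v)) v else 0) := by
    intro c hc
    have hne := upCell_ne_downCell p v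
    by_cases hu : upCell p v = c
    · subst hu
      simp [hne.symm]
    by_cases hd : downCell p v = c
    · subst hd
      simp [hne]
    rw [if_neg hu, if_neg hd, add_zero]
    by_contra h0
    obtain ⟨e, he⟩ := card_pos.1 (Nat.pos_of_ne_zero h0)
    rw [mem_filter, mem_inter] at he
    rcases (mem_corners_iff (hAct c hc)).1 (mem_corners_of_mem_cellEdges he.1.2 he.2) with h | h
    · exact hu h.2.symm
    · exact hd h.2.symm
  rw [h1, sum_congr rfl h2, sum_add_distrib, sum_ite_eq, sum_ite_eq]

/-- The bottom vertices of the cells of `Act`. -/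
def bottoms (Act : Finset (ℤ × ℤ)) : Finset (ℤ × ℤ) := Act.biUnion fun c => {c, (c.1 + 1, c.2)}

include hAct in
lemma mem_bottoms {v : ℤ × ℤ} : v ∈ bottoms Act ↔ upCell p v ∈ Act := by
  simp only [bottoms, mem_biUnion, mem_insert, mem_singleton]
  have key : ∀ c ∈ Act, (v = c ∨ v = (c.1 + 1, c.2)) ↔ c = upCell p v := by
    rintro ⟨x, y⟩ hc
    have := hAct _ hc
    obtain ⟨s, t⟩ := v
    simp only [Prod.mk.injEq, upCell]
    simp only [Int.even_iff] at this ⊢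
    split_ifs <;> simp only [Prod.mk.injEq] <;> omega
  constructor
  · rintro ⟨c, hc, h⟩
    rwa [← (key c hc).1 h]
  · intro h
    exact ⟨_, h, (key _ h).2 rfl⟩

/-- The corners of `c` covered inside `c`, when the vertices of `σ` are those vertices of `S` that
are covered in the cell above them. -/
def cellPart (S : Set (ℤ × ℤ)) (σ : Finset (ℤ × ℤ)) (c : ℤ × ℤ) : Set (ℤ × ℤ) :=
  {v | v ∈ S ∧ (v.2 = c.2 ↔ v ∈ σ)}

-- The set `σ` records the vertices matched inside the cell above them. Once it is fixed, the
-- corners to be covered inside each cell are known, and the global covering condition splits into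
-- independent conditions on the cells.
include hAct in
open scoped Classical in
lemma covers_and_filter_iff {S : Set (ℤ × ℤ)} {F : Finset (Sym2 (ℤ × ℤ))}
    (hF : F ⊆ Act.biUnion cellEdges) {σ : Finset (ℤ × ℤ)} (hσ : σ ⊆ bottoms Act)
    (hσS : ∀ v ∈ σ, v ∈ S) (hSσ : ∀ v ∈ S, v ∉ σ → downCell p v ∈ Act) :
    (Covers S F ∧ {v ∈ bottoms Act | deg (F ∩ cellEdges (upCell p v)) v = 1} = σ) ↔
      ∀ c ∈ Act, ∀ v ∈ corners c, deg (F ∩ cellEdges c) v = if v ∈ cellPart S σ c then 1 else 0 := by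
  constructor
  · rintro ⟨h1, rfl⟩ c hc v hv
    have hs := deg_eq_up_add_down hAct hF v
    rw [h1 v] at hs
    rcases (mem_corners_iff (hAct c hc)).1 hv with ⟨hv2, hcv⟩ | ⟨hv2, hcv⟩
    · subst hcv
      rw [if_pos hc] at hs
      have : v ∈ cellPart S {v ∈ bottoms Act | deg (F ∩ cellEdges (upCell p v)) v = 1}
          (upCell p v) ↔ v ∈ S ∧ deg (F ∩ cellEdges (upCell p v)) v = 1 := by
        simp [cellPart, hv2, mem_bottoms hAct, hc]
      simp only [this]
      by_cases h : v ∈ S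
      · simp only [h, if_true, true_and] at hs ⊢
        split_ifs <;> omega
      · simp only [h, if_false, false_and] at hs ⊢
        omega
    · subst hcv
      have hv3 : v.2 ≠ (downCell p v).2 := by omega
      rw [if_pos hc] at hs
      have : v ∈ cellPart S {v ∈ bottoms Act | deg (F ∩ cellEdges (upCell p v)) v = 1}
          (downCell p v) ↔
          v ∈ S ∧ ¬ (upCell p v ∈ Act ∧ deg (F ∩ cellEdges (upCell p v)) v = 1) := by
        simp [cellPart, hv3, mem_bottoms hAct]
      simp only [this]
      by_cases h : v ∈ S
      · by_cases hu : upCell p v ∈ Act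
        · simp only [h, hu, if_true, true_and] at hs ⊢
          split_ifs <;> omega
        · simp only [h, hu, if_true, if_false, false_and, true_and, not_false_eq_true] at hs ⊢
          omega
      · simp only [h, if_false, false_and] at hs ⊢
        omega
  · intro h
    have hup : ∀ v, upCell p v ∈ Act → deg (F ∩ cellEdges (upCell p v)) v =
        if v ∈ σ then 1 else 0 := by
      intro v hv
      rw [h _ hv v ((mem_corners_iff (hAct _ hv)).2 (.inl ⟨(snd_upCell p v).symm, rfl⟩))]
      have := hσS v
      simp only [cellPart, snd_upCell, Set.mem_ofPred_eq, true_iff]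
      congr 1
      exact propext ⟨fun h => h.2, fun h => ⟨this h, h⟩⟩
    have hdown : ∀ v, downCell p v ∈ Act → deg (F ∩ cellEdges (downCell p v)) v =
        if v ∈ S ∧ v ∉ σ then 1 else 0 := by
      intro v hv
      have h2 : v.2 ≠ (downCell p v).2 := by rw [snd_downCell]; omega
      rw [h _ hv v ((mem_corners_iff (hAct _ hv)).2 (.inr ⟨by rw [snd_downCell]; omega, rfl⟩))]
      simp only [cellPart, h2, Set.mem_ofPred_eq, false_iff]
    constructor
    · intro v
      rw [deg_eq_up_add_down hAct hF v]
      by_cases hvσ : v ∈ σ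
      · have := (mem_bottoms hAct).1 (hσ hvσ)
        rw [if_pos this, hup v this, if_pos hvσ, if_pos (hσS v hvσ)]
        split_ifs with hd
        · rw [hdown v hd, if_neg (by tauto)]
        · rfl
      · by_cases hvS : v ∈ S
        · have := hSσ v hvS hvσ
          rw [if_pos hvS, if_pos this, hdown v this, if_pos (c := v ∈ S ∧ v ∉ σ) ⟨hvS, hvσ⟩]
          by_cases hu : upCell p v ∈ Act
          · rw [if_pos hu, hup v hu, if_neg hvσ]
          · rw [if_neg hu]
        · rw [if_neg hvS]
          split_ifs with hu hd hd
          · rw [hup v hu, hdown v hd, if_neg hvσ, if_neg (by tauto)]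
          · rw [hup v hu, if_neg hvσ]
          · rw [hdown v hd, if_neg (by tauto)]
          · rfl
    · ext v
      rw [mem_filter]
      constructor
      · rintro ⟨h1, h2⟩
        rw [hup v ((mem_bottoms hAct).1 h1)] at h2
        by_contra h3
        simp [h3] at h2
      · intro hv
        refine ⟨hσ hv, ?_⟩
        rw [hup v ((mem_bottoms hAct).1 (hσ hv)), if_pos hv]

-- Matchings are sorted by their set `σ`. A vertex of `S` outside `σ` is covered from below, so its
-- lower cell must be active; this is the only constraint on `σ` besides lying in `S` and in
-- `bottoms Act`.
include hAct in
open scoped Classical in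
lemma weightSum_eq_sum_prod_localSum {R : Type*} [CommSemiring R] (S : Set (ℤ × ℤ))
    (w : Sym2 (ℤ × ℤ) → R) :
    weightSum (Act.biUnion cellEdges) S w =
      ∑ σ ∈ (bottoms Act).powerset with
        (∀ v ∈ σ, v ∈ S) ∧ ∀ v ∈ S, v ∉ σ → downCell p v ∈ Act,
        ∏ c ∈ Act, localSum w c (cellPart S σ c) := by
  unfold weightSum
  rw [← sum_fiberwise_of_maps_to
    (g := fun F => {v ∈ bottoms Act | deg (F ∩ cellEdges (upCell p v)) v = 1})]
  · refine sum_congr rfl fun σ hσ => ?_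
    simp only [mem_filter, mem_powerset] at hσ
    unfold localSum
    rw [← sum_powerset_biUnion_prod Act cellEdges (pairwiseDisjoint_cellEdges hAct)
      (fun c G => if ∀ v ∈ corners c, deg G v = if v ∈ cellPart S σ c then 1 else 0 then
        ∏ e ∈ G, w e else 0), filter_filter, sum_filter]
    refine sum_congr rfl fun F hF => ?_
    rw [mem_powerset] at hF
    rw [prod_ite_zero]
    refine if_congr (covers_and_filter_iff hAct hF hσ.1 hσ.2.1 hσ.2.2) ?_ rfl
    rw [← prod_biUnion, ← inter_biUnion, inter_eq_left.2 hF]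
    intro c hc c' hc' hne
    exact (pairwiseDisjoint_cellEdges (s := Act) hAct hc hc' hne).mono
        inter_subset_right inter_subset_right
  · intro F hF
    simp only [mem_filter, mem_powerset] at hF ⊢
    obtain ⟨hF, hS⟩ := hF
    refine ⟨filter_subset _ _, ?_, ?_⟩
    · rintro v ⟨-, hv⟩
      obtain ⟨e, he⟩ := card_pos.1 (hv.symm ▸ Nat.one_pos : 0 < deg _ v)
      rw [mem_filter, mem_inter] at he
      exact hS.mem he.1.1 he.2
    · intro v hv hvσ
      by_contra hd
      have hs := deg_eq_up_add_down hAct hF v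
      rw [hS v, if_pos hv, if_neg hd] at hs
      rw [mem_bottoms hAct] at hvσ
      by_cases hu : upCell p v ∈ Act
      · rw [if_pos hu] at hs
        exact hvσ ⟨hu, by omega⟩
      · rw [if_neg hu] at hs
        omega

include hAct in
/-- Urban renewal in all the cells of `Act`. -/
theorem weightSum_urbanRenewal {K : Type*} [Field K] {w w' : Sym2 (ℤ × ℤ) → K}
    (hw : ∀ c ∈ Act, IsRenewal w w' c) :
    weightSum (Act.biUnion cellEdges) {v | upCell p v ∈ Act ∨ downCell p v ∈ Act} w =
      (∏ c ∈ Act, cellWeight w c) *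
        weightSum (Act.biUnion cellEdges) {v | upCell p v ∈ Act ∧ downCell p v ∈ Act} w' := by
  classical
  rw [weightSum_eq_sum_prod_localSum hAct, weightSum_eq_sum_prod_localSum hAct, mul_sum]
  simp only [← prod_mul_distrib]
  -- A vertex on two active cells switches the cell that covers it. A vertex on a single active cell
  -- is necessarily covered there, and it disappears from the vertex set after renewal. So
  -- complementing `σ` complements the covered corners of every cell.
  refine sum_nbij' (fun σ => bottoms Act \ σ) (fun σ => bottoms Act \ σ) ?_ ?_ ?_ ?_ ?_
  · intro σ hσ
    simp only [mem_filter, mem_powerset, mem_sdiff, Set.mem_ofPred_eq, mem_bottoms hAct] at hσ ⊢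
    refine ⟨sdiff_subset, fun v hv => ⟨hv.1, hσ.2.2 v (.inl hv.1) hv.2⟩, fun v hv _ => hv.2⟩
  · intro σ hσ
    simp only [mem_filter, mem_powerset, mem_sdiff, Set.mem_ofPred_eq, mem_bottoms hAct] at hσ ⊢
    refine ⟨sdiff_subset, fun v hv => .inl hv.1, fun v hv hv' => ?_⟩
    by_cases h : v ∈ σ
    · exact (hσ.2.1 v h).2
    · by_contra h'
      exact hv' ⟨hv.resolve_right h', h⟩
  · intro σ hσ
    simp only [mem_filter, mem_powerset] at hσ
    exact Finset.sdiff_sdiff_eq_self hσ.1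
  · intro σ hσ
    simp only [mem_filter, mem_powerset] at hσ
    exact Finset.sdiff_sdiff_eq_self hσ.1
  · intro σ hσ
    simp only [mem_filter, mem_powerset, Set.mem_ofPred_eq] at hσ
    refine prod_congr rfl fun c hc => localSum_compl (hw c hc) fun v hv => ?_
    simp only [cellPart, Set.mem_ofPred_eq, mem_sdiff, mem_bottoms hAct]
    have hb : v ∈ σ → upCell p v ∈ Act := fun h => (mem_bottoms hAct).1 (hσ.1 h)
    rcases (mem_corners_iff (hAct c hc)).1 hv with ⟨hv2, rfl⟩ | ⟨hv2, rfl⟩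
    · have := hσ.2.2 v (.inl hc)
      simp only [hv2, true_iff, hc, true_and, true_or]
      tauto
    · have h3 : v.2 ≠ (downCell p v).2 := by omega
      simp only [h3, false_iff, hc, and_true, or_true, true_and]
      tauto

end

/-! ### Condensation for diamond graphs -/

/-- The vertices of `diamond a b k`. -/
def diamondVerts (a b k : ℤ) : Set (ℤ × ℤ) :=
  {v | a + segStart (v.2 - b) ≤ v.1 ∧ v.1 ≤ a + 2 * k - 1 - segStart (v.2 - b)}

lemma mem_diamondVerts {a b k x y : ℤ} : (x, y) ∈ diamondVerts a b k ↔
    a + segStart (y - b) ≤ x ∧ x ≤ a + 2 * k - 1 - segStart (y - b) := Iff.rfl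

/-- The cells of `diamond a b k` of the same parity as its root. -/
def diamondCells (a b k : ℤ) : Finset (ℤ × ℤ) :=
  {c ∈ Icc a (a + 2 * k - 2) ×ˢ Icc (b - k + 1) (b + k - 1) |
    a + |c.2 - b| ≤ c.1 ∧ c.1 ≤ a + 2 * k - 2 - |c.2 - b| ∧ Even (c.1 + c.2 + (a + b))}

lemma mem_diamondCells {a b k x y : ℤ} : (x, y) ∈ diamondCells a b k ↔
    a + |y - b| ≤ x ∧ x ≤ a + 2 * k - 2 - |y - b| ∧ Even (x + y + (a + b)) := by
  simp only [diamondCells, mem_filter, mem_product, mem_Icc, and_iff_right_iff_imp]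
  rcases abs_cases (y - b) with h | h <;> omega

lemma even_of_mem_diamondCells {a b k : ℤ} :
    ∀ c ∈ diamondCells a b k, Even (c.1 + c.2 + (a + b)) := by
  rintro ⟨x, y⟩ h
  exact (mem_diamondCells.1 h).2.2

/-- The edges of `diamond a b k`. -/
def diamondEdges (a b k : ℤ) : Finset (Sym2 (ℤ × ℤ)) := (diamondCells a b k).biUnion cellEdges

/-- Cells of a single colour suffice to describe the edges: of the two cells along an edge of the
diamond, the one of the root's colour always lies in the diamond. -/
lemma hEdge_mem_diamondEdges {a b k x y : ℤ} : hEdge x y ∈ diamondEdges a b k ↔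
    (x, y) ∈ diamondVerts a b k ∧ (x + 1, y) ∈ diamondVerts a b k := by
  simp only [diamondEdges, mem_biUnion, mem_cellEdges, hEdge_inj, hEdge_ne_vEdge, or_false,
    mem_diamondVerts, segStart]
  constructor
  · rintro ⟨⟨s, t⟩, h, h'⟩
    rw [mem_diamondCells] at h
    rcases abs_cases (t - b) with h2 | h2 <;> split_ifs <;> simp only at h' <;> omega
  · intro h
    by_cases hp : Even (x + y + (a + b))
    · refine ⟨(x, y), mem_diamondCells.2 ?_, by simp⟩
      refine ⟨?_, ?_, hp⟩ <;> rw [Int.even_iff] at hp <;>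
      rcases abs_cases (y - b) with h2 | h2 <;> split_ifs at h <;> omega
    · refine ⟨(x, y - 1), mem_diamondCells.2 ?_, by simp⟩
      rw [Int.even_iff] at *
      refine ⟨?_, ?_, by omega⟩ <;>
      rcases abs_cases (y - 1 - b) with h2 | h2 <;> split_ifs at h <;> omega

lemma vEdge_mem_diamondEdges {a b k x y : ℤ} : vEdge x y ∈ diamondEdges a b k ↔
    (x, y) ∈ diamondVerts a b k ∧ (x, y + 1) ∈ diamondVerts a b k := by
  simp only [diamondEdges, mem_biUnion, mem_cellEdges, vEdge_inj, vEdge_ne_hEdge, false_or,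
    mem_diamondVerts, segStart]
  constructor
  · rintro ⟨⟨s, t⟩, h, h'⟩
    rw [mem_diamondCells] at h
    rcases abs_cases (t - b) with h2 | h2 <;> split_ifs <;> simp only at h' <;> omega
  · intro h
    by_cases hp : Even (x + y + (a + b))
    · refine ⟨(x, y), mem_diamondCells.2 ?_, by simp⟩
      refine ⟨?_, ?_, hp⟩ <;> rw [Int.even_iff] at hp <;>
      rcases abs_cases (y - b) with h2 | h2 <;> split_ifs at h <;> omega
    · refine ⟨(x - 1, y), mem_diamondCells.2 ?_, by simp⟩
      rw [Int.even_iff] at *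
      refine ⟨?_, ?_, by omega⟩ <;>
      rcases abs_cases (y - b) with h2 | h2 <;> split_ifs at h <;> omega

lemma exists_eq_of_mem_cellEdges {c : ℤ × ℤ} {e : Sym2 (ℤ × ℤ)} (he : e ∈ cellEdges c) :
    (∃ x y, e = hEdge x y) ∨ ∃ x y, e = vEdge x y := by
  rw [mem_cellEdges] at he
  rcases he with h | h | h | h
  exacts [.inl ⟨_, _, h⟩, .inl ⟨_, _, h⟩, .inr ⟨_, _, h⟩, .inr ⟨_, _, h⟩]

lemma exists_eq_of_mem_diamondEdges {a b k : ℤ} {e : Sym2 (ℤ × ℤ)} (he : e ∈ diamondEdges a b k) :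
    (∃ x y, e = hEdge x y) ∨ ∃ x y, e = vEdge x y := by
  obtain ⟨c, -, he⟩ := mem_biUnion.1 he
  exact exists_eq_of_mem_cellEdges he

/-- The weighted number of perfect matchings of `diamond a b k`. -/
def diamondSum {R : Type*} [CommSemiring R] (a b k : ℤ) (w : Sym2 (ℤ × ℤ) → R) : R :=
  weightSum (diamondEdges a b k) (diamondVerts a b k) w

lemma diamondVerts_eq_empty {a b k : ℤ} (hk : k ≤ 0) : diamondVerts a b k = ∅ := by
  ext ⟨x, y⟩
  simp only [mem_diamondVerts, segStart, Set.mem_empty_iff_false, iff_false]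
  split_ifs <;> omega

/-- This includes the centre of order `-1` that occurs in the condensation of a single cell. -/
lemma diamondSum_of_nonpos {R : Type*} [CommSemiring R] {a b k : ℤ} (hk : k ≤ 0)
    (w : Sym2 (ℤ × ℤ) → R) : diamondSum a b k w = 1 := by
  rw [diamondSum, diamondVerts_eq_empty hk]
  refine weightSum_empty _ (fun e he => ?_) w
  rcases exists_eq_of_mem_diamondEdges he with ⟨x, y, rfl⟩ | ⟨x, y, rfl⟩
  · exact ⟨(x, y), by simp [mem_hEdge]⟩
  · exact ⟨(x, y), by simp [mem_vEdge]⟩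

/-- The vertices on at least one root-coloured cell of the diamond are all its vertices; those on
two such cells form the concentric diamond of order one less. -/
lemma diamondSum_renewal {K : Type*} [Field K] {a b k : ℤ} {w w' : Sym2 (ℤ × ℤ) → K}
    (hw : ∀ c : ℤ × ℤ, Even (c.1 + c.2 + (a + b)) → IsRenewal w w' c) :
    diamondSum a b k w =
      (∏ c ∈ diamondCells a b k, cellWeight w c) * diamondSum (a + 1) b (k - 1) w' := by
  have h1 : diamondVerts a b k = {v | upCell (a + b) v ∈ diamondCells a b k ∨
      downCell (a + b) v ∈ diamondCells a b k} := by
    ext ⟨x, y⟩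
    simp only [mem_diamondVerts, upCell, downCell, Set.mem_ofPred_eq, segStart]
    by_cases hp : Even (x + y + (a + b))
    · simp only [hp, if_true, mem_diamondCells]
      simp only [Int.even_iff, and_true] at hp ⊢
      rcases abs_cases (y - b) with h2 | h2 <;> rcases abs_cases (y - 1 - b) with h3 | h3 <;>
        split_ifs <;> omega
    · simp only [hp, if_false, mem_diamondCells]
      simp only [Int.even_iff] at hp ⊢
      rcases abs_cases (y - b) with h2 | h2 <;> rcases abs_cases (y - 1 - b) with h3 | h3 <;>
        split_ifs <;> omega
  have h2 : diamondVerts (a + 1) b (k - 1) = {v | upCell (a + b) v ∈ diamondCells a b k ∧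
      downCell (a + b) v ∈ diamondCells a b k} := by
    ext ⟨x, y⟩
    simp only [mem_diamondVerts, upCell, downCell, Set.mem_ofPred_eq, segStart]
    by_cases hp : Even (x + y + (a + b))
    · simp only [hp, if_true, mem_diamondCells]
      simp only [Int.even_iff, and_true] at hp ⊢
      rcases abs_cases (y - b) with h2 | h2 <;> rcases abs_cases (y - 1 - b) with h3 | h3 <;>
        split_ifs <;> omega
    · simp only [hp, if_false, mem_diamondCells]
      simp only [Int.even_iff] at hp ⊢
      rcases abs_cases (y - b) with h2 | h2 <;> rcases abs_cases (y - 1 - b) with h3 | h3 <;>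
        split_ifs <;> omega
  have h3 : diamondVerts (a + 1) b (k - 1) ⊆ diamondVerts a b k := by
    rw [h1, h2]
    exact fun v hv => .inl hv.1
  have h4 : diamondSum (a + 1) b (k - 1) w' =
      weightSum (diamondEdges a b k) (diamondVerts (a + 1) b (k - 1)) w' := by
    refine weightSum_congr_edges fun e he => ?_
    constructor
    · intro h
      rcases exists_eq_of_mem_diamondEdges h with ⟨x, y, rfl⟩ | ⟨x, y, rfl⟩
      · rw [hEdge_mem_diamondEdges] at *
        exact ⟨h3 h.1, h3 h.2⟩
      · rw [vEdge_mem_diamondEdges] at *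
        exact ⟨h3 h.1, h3 h.2⟩
    · intro h
      rcases exists_eq_of_mem_diamondEdges h with ⟨x, y, rfl⟩ | ⟨x, y, rfl⟩
      · rw [hEdge_mem_diamondEdges]
        exact ⟨he _ (by simp [mem_hEdge]), he _ (by simp [mem_hEdge])⟩
      · rw [vEdge_mem_diamondEdges]
        exact ⟨he _ (by simp [mem_vEdge]), he _ (by simp [mem_vEdge])⟩
  rw [h4, h2, diamondSum, h1]
  exact weightSum_urbanRenewal even_of_mem_diamondCells
    fun c hc => hw c (even_of_mem_diamondCells c hc)

/-- The side of a cell opposite to a given side. -/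
def oppositeEdge (c : ℤ × ℤ) (e : Sym2 (ℤ × ℤ)) : Sym2 (ℤ × ℤ) :=
  if e = hEdge c.1 c.2 then hEdge c.1 (c.2 + 1)
  else if e = hEdge c.1 (c.2 + 1) then hEdge c.1 c.2
  else if e = vEdge c.1 c.2 then vEdge (c.1 + 1) c.2
  else vEdge c.1 c.2

lemma exists_isRenewal (p : ℤ) {w : Sym2 (ℤ × ℤ) → ℝ} (hw : ∀ e, 0 < w e) :
    ∃ w' : Sym2 (ℤ × ℤ) → ℝ, (∀ e, 0 < w' e) ∧
      ∀ c : ℤ × ℤ, Even (c.1 + c.2 + p) → IsRenewal w w' c := by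
  classical
  have hpos : ∀ c, 0 < cellWeight w c := fun c =>
    add_pos (mul_pos (hw _) (hw _)) (mul_pos (hw _) (hw _))
  -- An edge lies in only one cell of parity `p`, so the prescriptions of different cells cannot
  -- conflict. The value `1` concerns only pairs of points that are not lattice edges.
  let w' : Sym2 (ℤ × ℤ) → ℝ := fun e =>
    if h : ∃ c : ℤ × ℤ, Even (c.1 + c.2 + p) ∧ e ∈ cellEdges c then
      w (oppositeEdge h.choose e) / cellWeight w h.choose else 1
  have key : ∀ c : ℤ × ℤ, Even (c.1 + c.2 + p) → ∀ e ∈ cellEdges c,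
      w' e = w (oppositeEdge c e) / cellWeight w c := by
    intro c hc e he
    have h : ∃ c : ℤ × ℤ, Even (c.1 + c.2 + p) ∧ e ∈ cellEdges c := ⟨c, hc, he⟩
    have hch : h.choose = c := by
      by_contra hne
      exact disjoint_left.1 (pairwiseDisjoint_cellEdges (p := p)
        (s := {c | Even (c.1 + c.2 + p)}) (fun _ h => h) h.choose_spec.1 hc hne)
        h.choose_spec.2 he
    simp only [w', dif_pos h, hch]
  refine ⟨w', fun e => ?_, fun c hc => ⟨(hpos c).ne', ?_, ?_, ?_, ?_⟩⟩
  · simp only [w']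
    split_ifs
    · exact div_pos (hw _) (hpos _)
    · exact one_pos
  all_goals
    rw [key c hc _ (by simp [cellEdges])]
    simp [oppositeEdge, hEdge_inj, vEdge_inj, vEdge_ne_hEdge]

/-- The hypothesis is an equality of multisets, `A + C = W + E + {s} + {t}`, expressed by
multiplicities. -/
lemma prod_mul_prod_eq {α R : Type*} [DecidableEq α] [CommMonoid R] {A C W E : Finset α} {s t : α}
    (h : ∀ c, (if c ∈ A then 1 else 0) + (if c ∈ C then 1 else 0) =
      (if c ∈ W then 1 else 0) + (if c ∈ E then 1 else 0) + (if c = s then 1 else 0) +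
        if c = t then 1 else 0) (f : α → R) :
    (∏ c ∈ A, f c) * ∏ c ∈ C, f c = (∏ c ∈ W, f c) * (∏ c ∈ E, f c) * f s * f t := by
  have : A.val + C.val = W.val + E.val + {s} + {t} := by
    ext c
    simp only [Multiset.count_add, Multiset.count_singleton,
      Multiset.count_eq_of_nodup A.nodup, Multiset.count_eq_of_nodup C.nodup,
      Multiset.count_eq_of_nodup W.nodup, Multiset.count_eq_of_nodup E.nodup, mem_val, h c]
  have := congrArg (fun m => (m.map f).prod) this
  simp only [Multiset.map_add, Multiset.prod_add, Multiset.map_singleton,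
    Multiset.prod_singleton] at this
  exact this

/-- West and East intersect in the centre, and together they miss only the top and bottom cells of
the root's colour. For `k = 1` these two cells would coincide. -/
lemma prod_diamondCells_west_east {R : Type*} [CommMonoid R] {a b k : ℤ} (hk : 2 ≤ k)
    (f : ℤ × ℤ → R) :
    (∏ c ∈ diamondCells a b k, f c) * ∏ c ∈ diamondCells (a + 2) b (k - 2), f c =
      (∏ c ∈ diamondCells a b (k - 1), f c) * (∏ c ∈ diamondCells (a + 2) b (k - 1), f c) *
        f (a + k - 1, b + k - 1) * f (a + k - 1, b - k + 1) := by
  refine prod_mul_prod_eq ?_ f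
  rintro ⟨x, y⟩
  simp only [mem_diamondCells, Prod.mk.injEq, Int.even_iff]
  rcases abs_cases (y - b) with h2 | h2 <;> rw [h2.1] <;> split_ifs <;> omega

/-- North and South also intersect in the centre; the cells they both miss are the two ends of the
longest row. -/
lemma prod_diamondCells_north_south {R : Type*} [CommMonoid R] {a b k : ℤ} (hk : 2 ≤ k)
    (f : ℤ × ℤ → R) :
    (∏ c ∈ diamondCells a b k, f c) * ∏ c ∈ diamondCells (a + 2) b (k - 2), f c =
      (∏ c ∈ diamondCells (a + 1) (b + 1) (k - 1), f c) *
        (∏ c ∈ diamondCells (a + 1) (b - 1) (k - 1), f c) *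
        f (a, b) * f (a + 2 * k - 2, b) := by
  refine prod_mul_prod_eq ?_ f
  rintro ⟨x, y⟩
  simp only [mem_diamondCells, Prod.mk.injEq, Int.even_iff]
  rcases lt_trichotomy y b with h | h | h
  · rw [abs_of_neg (by omega : y - b < 0), abs_of_neg (by omega : y - (b + 1) < 0),
      abs_of_nonpos (by omega : y - (b - 1) ≤ 0)]
    split_ifs <;> omega
  · subst h
    rw [abs_of_nonneg (by omega : 0 ≤ y - y), abs_of_neg (by omega : y - (y + 1) < 0),
      abs_of_pos (by omega : 0 < y - (y - 1))]
    split_ifs <;> omega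
  · rw [abs_of_pos (by omega : 0 < y - b), abs_of_nonneg (by omega : 0 ≤ y - (b + 1)),
      abs_of_pos (by omega : 0 < y - (b - 1))]
    split_ifs <;> omega

/-- Positivity makes all cell weights nonzero and is inherited by the renewed weights, so that
renewal can be iterated. -/
lemma condensation_of_pos (n : ℕ) : ∀ (a b : ℤ) (w : Sym2 (ℤ × ℤ) → ℝ), (∀ e, 0 < w e) →
    diamondSum a b (n + 1) w * diamondSum (a + 2) b (n - 1) w =
      w (hEdge (a + n) (b + n + 1)) * w (hEdge (a + n) (b - n)) *
        diamondSum a b n w * diamondSum (a + 2) b n w +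
      w (vEdge a b) * w (vEdge (a + 2 * n + 1) b) *
        diamondSum (a + 1) (b + 1) n w * diamondSum (a + 1) (b - 1) n w := by
  induction n with
  | zero =>
    intro a b w hw
    obtain ⟨w', -, hr⟩ := exists_isRenewal (a + b) hw
    have h1 : diamondCells a b 1 = {(a, b)} := by
      ext ⟨x, y⟩
      simp only [mem_diamondCells, mem_singleton, Prod.mk.injEq, Int.even_iff]
      rcases abs_cases (y - b) with h2 | h2 <;> rw [h2.1] <;> omega
    simp only [Nat.cast_zero, zero_add, zero_sub, add_zero, sub_zero, mul_zero]
    rw [diamondSum_renewal hr, h1, prod_singleton, diamondSum_of_nonpos (by norm_num),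
      diamondSum_of_nonpos (by norm_num), diamondSum_of_nonpos (by norm_num),
      diamondSum_of_nonpos (by norm_num), diamondSum_of_nonpos (by norm_num),
      diamondSum_of_nonpos (by norm_num), cellWeight]
    ring
  | succ n ih =>
    intro a b w hw
    obtain ⟨w', hw', hr⟩ := exists_isRenewal (a + b) hw
    have par : ∀ a' b' : ℤ, Even (a' + b' + (a + b)) →
        ∀ c : ℤ × ℤ, Even (c.1 + c.2 + (a' + b')) → IsRenewal w w' c := by
      intro a' b' h c hc
      apply hr
      rw [Int.even_iff] at *
      omega
    have ih' := ih (a + 1) b w' hw'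
    have hWE := prod_diamondCells_west_east (a := a) (b := b) (k := n + 1 + 1) (by omega)
      (cellWeight w)
    have hNS := prod_diamondCells_north_south (a := a) (b := b) (k := n + 1 + 1) (by omega)
      (cellWeight w)
    rw [show (n : ℤ) + 1 + 1 - 2 = n by ring, show (n : ℤ) + 1 + 1 - 1 = n + 1 by ring,
      show a + (n + 1 + 1) - 1 = a + n + 1 by ring, show b + (n + 1 + 1) - 1 = b + n + 1 by ring,
      show b - (n + 1 + 1) + 1 = b - n - 1 by ring] at hWE
    rw [show (n : ℤ) + 1 + 1 - 2 = n by ring, show (n : ℤ) + 1 + 1 - 1 = n + 1 by ring,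
      show a + 2 * (n + 1 + 1) - 2 = a + 2 * n + 2 by ring] at hNS
    have ht := (hr (a + n + 1, b + n + 1) (by rw [Int.even_iff]; simp only; omega))
    have hb := (hr (a + n + 1, b - n - 1) (by rw [Int.even_iff]; simp only; omega))
    have hl := (hr (a, b) (by rw [Int.even_iff]; simp only; omega))
    have hr' := (hr (a + 2 * n + 2, b) (by rw [Int.even_iff]; simp only; omega))
    push_cast
    rw [diamondSum_renewal (par a b (by rw [Int.even_iff]; omega)),
      diamondSum_renewal (a := a + 2) (par (a + 2) b (by rw [Int.even_iff]; omega)),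
      diamondSum_renewal (par a b (by rw [Int.even_iff]; omega)),
      diamondSum_renewal (a := a + 2) (par (a + 2) b (by rw [Int.even_iff]; omega)),
      diamondSum_renewal (par (a + 1) (b + 1) (by rw [Int.even_iff]; omega)),
      diamondSum_renewal (par (a + 1) (b - 1) (by rw [Int.even_iff]; omega))]
    -- The inner side of an extreme cell is an extremal edge of the renewed diamond. Its renewed
    -- weight times the cell weight is the old weight of the outer side, which is an extremal edge
    -- of the original diamond.
    have e1 := ht.bot
    have e2 := hb.top
    have e3 := hl.right
    have e4 := hr'.left
    rw [eq_div_iff ht.ne_zero] at e1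
    rw [eq_div_iff hb.ne_zero] at e2
    rw [eq_div_iff hl.ne_zero] at e3
    rw [eq_div_iff hr'.ne_zero] at e4
    simp only at e1 e2 e3 e4
    simp only [add_sub_cancel_right]
    rw [show a + 1 + (n : ℤ) = a + n + 1 by ring, show a + 1 + 2 * (n : ℤ) + 1 = a + 2 * n + 2 by ring,
      show a + 1 + 2 = a + 2 + 1 by ring] at ih'
    rw [sub_add_cancel] at e2
    rw [show a + ((n : ℤ) + 1) = a + n + 1 by ring, show b + ((n : ℤ) + 1) + 1 = b + n + 1 + 1 by ring,
      show b - ((n : ℤ) + 1) = b - n - 1 by ring,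
      show a + 2 * ((n : ℤ) + 1) + 1 = a + 2 * n + 2 + 1 by ring, ← e1, ← e2, ← e3, ← e4]
    generalize (∏ c ∈ diamondCells a b (n + 1 + 1), cellWeight w c) = PA at *
    generalize (∏ c ∈ diamondCells (a + 2) b n, cellWeight w c) = PC at *
    linear_combination PA * PC * ih' +
      w' (hEdge (a + n + 1) (b + n + 1)) * w' (hEdge (a + n + 1) (b - n)) *
        diamondSum (a + 1) b n w' * diamondSum (a + 2 + 1) b n w' * hWE +
      w' (vEdge (a + 1) b) * w' (vEdge (a + 2 * n + 2) b) *
        diamondSum (a + 1 + 1) (b + 1) n w' * diamondSum (a + 1 + 1) (b - 1) n w' * hNS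

lemma map_weightSum {R R' : Type*} [CommSemiring R] [CommSemiring R'] (φ : R →+* R')
    (B : Finset (Sym2 (ℤ × ℤ))) (S : Set (ℤ × ℤ)) (w : Sym2 (ℤ × ℤ) → R) :
    φ (weightSum B S w) = weightSum B S fun e => φ (w e) := by
  simp [weightSum, map_sum, map_prod]

/-- Condensation for weighted diamond graphs. -/
theorem condensation {R : Type*} [CommRing R] (a b k : ℤ) (hk : 1 ≤ k) (w : Sym2 (ℤ × ℤ) → R) :
    diamondSum a b k w * diamondSum (a + 2) b (k - 2) w =
      w (hEdge (a + k - 1) (b + k)) * w (hEdge (a + k - 1) (b - k + 1)) *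
        diamondSum a b (k - 1) w * diamondSum (a + 2) b (k - 1) w +
      w (vEdge a b) * w (vEdge (a + 2 * k - 1) b) *
        diamondSum (a + 1) (b + 1) (k - 1) w * diamondSum (a + 1) (b - 1) (k - 1) w := by
  have generic : (diamondSum a b k MvPolynomial.X * diamondSum (a + 2) b (k - 2) MvPolynomial.X :
      MvPolynomial (Sym2 (ℤ × ℤ)) ℤ) =
      .X (hEdge (a + k - 1) (b + k)) * .X (hEdge (a + k - 1) (b - k + 1)) *
        diamondSum a b (k - 1) .X * diamondSum (a + 2) b (k - 1) .X +
      .X (vEdge a b) * .X (vEdge (a + 2 * k - 1) b) *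
        diamondSum (a + 1) (b + 1) (k - 1) .X * diamondSum (a + 1) (b - 1) (k - 1) .X := by
    -- Integer polynomials are determined by their values at positive real points, where the
    -- induction applies.
    apply MvPolynomial.map_injective (Int.castRingHom ℝ) Int.cast_injective
    refine MvPolynomial.funext_set (fun _ => Set.Ioi 0) (fun _ => Set.Ioi_infinite 0) fun w hw => ?_
    have hw' : ∀ e, 0 < w e := fun e => hw e trivial
    obtain ⟨n, rfl⟩ : ∃ n : ℕ, k = n + 1 := ⟨(k - 1).toNat, by omega⟩
    have := condensation_of_pos n a b w hw'
    simp only [diamondSum, map_add, map_mul, map_weightSum, MvPolynomial.map_X,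
      MvPolynomial.eval_X] at this ⊢
    rw [show a + ((n : ℤ) + 1) - 1 = a + n by ring, show b + ((n : ℤ) + 1) = b + n + 1 by ring,
      show b - ((n : ℤ) + 1) + 1 = b - n by ring, show (n : ℤ) + 1 - 1 = n by ring,
      show (n : ℤ) + 1 - 2 = n - 1 by ring, show a + 2 * ((n : ℤ) + 1) - 1 = a + 2 * n + 1 by ring]
    exact this
  -- The generic identity is specialised to the given weights, which are now allowed to vanish.
  have := congrArg (MvPolynomial.eval₂Hom (Int.castRingHom R) w) generic
  simpa only [diamondSum, map_add, map_mul, map_weightSum, MvPolynomial.coe_eval₂Hom,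
    MvPolynomial.eval₂_X] using this

/-! ### Lattice graphs -/

lemma squareLattice_adj_cases {u v : ℤ × ℤ} (h : squareLattice.Adj u v) :
    v = (u.1 + 1, u.2) ∨ v = (u.1 - 1, u.2) ∨ v = (u.1, u.2 + 1) ∨ v = (u.1, u.2 - 1) := by
  obtain ⟨x, y⟩ := u
  obtain ⟨s, t⟩ := v
  have h : |x - s| + |y - t| = 1 := h
  simp only [Prod.mk.injEq]
  rcases abs_cases (x - s) with h1 | h1 <;> rcases abs_cases (y - t) with h2 | h2 <;> omega

lemma squareLattice_adj_right (x y : ℤ) : squareLattice.Adj (x, y) (x + 1, y) := by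
  simp [squareLattice]

lemma squareLattice_adj_up (x y : ℤ) : squareLattice.Adj (x, y) (x, y + 1) := by
  simp [squareLattice]

lemma latticeGraph_le {G H : LatticeGraph} (hv : G.verts ⊆ H.verts)
    (hh : ∀ x y, G.Adj (x, y) (x + 1, y) → H.Adj (x, y) (x + 1, y))
    (hu : ∀ x y, G.Adj (x, y) (x, y + 1) → H.Adj (x, y) (x, y + 1)) : G ≤ H := by
  refine ⟨hv, ?_⟩
  rintro ⟨x, y⟩ v h
  rcases squareLattice_adj_cases h.adj_sub with rfl | rfl | rfl | rfl
  · exact hh _ _ h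
  · have := hh (x - 1) y (by simpa using h.symm)
    simpa using this.symm
  · exact hu _ _ h
  · have := hu x (y - 1) (by simpa using h.symm)
    simpa using this.symm

lemma latticeGraph_ext {G H : LatticeGraph} (hv : G.verts = H.verts)
    (hh : ∀ x y, G.Adj (x, y) (x + 1, y) ↔ H.Adj (x, y) (x + 1, y))
    (hu : ∀ x y, G.Adj (x, y) (x, y + 1) ↔ H.Adj (x, y) (x, y + 1)) : G = H :=
  le_antisymm (latticeGraph_le hv.le (fun x y => (hh x y).1) fun x y => (hu x y).1)
    (latticeGraph_le hv.ge (fun x y => (hh x y).2) fun x y => (hu x y).2)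

lemma diamond_verts (a b k : ℤ) : (diamond a b k).verts = diamondVerts a b k := by
  ext ⟨x, y⟩
  simp only [diamond, cellGraph, Set.mem_ofPred_eq, mem_diamondVerts, corners,
    Set.mem_insert_iff, Set.mem_singleton_iff, Prod.mk.injEq, Prod.exists, segStart]
  constructor
  · rintro ⟨s, t, h, h'⟩
    rcases abs_cases (t - b) with h2 | h2 <;> split_ifs <;> omega
  · intro h
    by_cases hy : 1 ≤ y - b
    · rw [if_pos hy] at h
      by_cases hx : x < a + 2 * k - 1 - (y - b - 1)
      · refine ⟨x, y - 1, ?_, by omega⟩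
        rw [abs_of_nonneg (by omega)]
        omega
      · refine ⟨x - 1, y - 1, ?_, by omega⟩
        rw [abs_of_nonneg (by omega)]
        omega
    · rw [if_neg hy] at h
      by_cases hx : x < a + 2 * k - 1 - -(y - b)
      · refine ⟨x, y, ?_, by omega⟩
        rw [abs_of_nonpos (by omega)]
        omega
      · refine ⟨x - 1, y, ?_, by omega⟩
        rw [abs_of_nonpos (by omega)]
        omega

lemma diamond_adj_right {a b k x y : ℤ} : (diamond a b k).Adj (x, y) (x + 1, y) ↔
    (x, y) ∈ diamondVerts a b k ∧ (x + 1, y) ∈ diamondVerts a b k := by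
  constructor
  · intro h
    rw [← diamond_verts]
    exact ⟨h.fst_mem, h.snd_mem⟩
  · intro h
    refine ⟨squareLattice_adj_right x y, ?_⟩
    simp only [mem_diamondVerts, segStart, Set.mem_ofPred_eq, corners,
      Set.mem_insert_iff, Set.mem_singleton_iff, Prod.mk.injEq, Prod.exists] at h ⊢
    by_cases hy : 1 ≤ y - b
    · rw [if_pos hy] at h
      refine ⟨x, y - 1, ?_, by omega, by omega⟩
      rw [abs_of_nonneg (by omega)]
      omega
    · rw [if_neg hy] at h
      refine ⟨x, y, ?_, by omega, by omega⟩
      rw [abs_of_nonpos (by omega)]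
      omega

lemma diamond_adj_up {a b k x y : ℤ} : (diamond a b k).Adj (x, y) (x, y + 1) ↔
    (x, y) ∈ diamondVerts a b k ∧ (x, y + 1) ∈ diamondVerts a b k := by
  constructor
  · intro h
    rw [← diamond_verts]
    exact ⟨h.fst_mem, h.snd_mem⟩
  · intro h
    refine ⟨squareLattice_adj_up x y, ?_⟩
    simp only [mem_diamondVerts, segStart, Set.mem_ofPred_eq, corners,
      Set.mem_insert_iff, Set.mem_singleton_iff, Prod.mk.injEq, Prod.exists] at h ⊢
    by_cases hx : x = a + 2 * k - 1 - |y - b|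
    · refine ⟨x - 1, y, ?_, by omega, by omega⟩
      rcases abs_cases (y - b) with h2 | h2 <;> split_ifs at h <;> omega
    · refine ⟨x, y, ?_, by omega, by omega⟩
      rcases abs_cases (y - b) with h2 | h2 <;> split_ifs at h <;> omega

/-! ### Greedy chains of odd vertical edges -/

/-- There is a chain of positions `x ≤ xₙ < ⋯ < x₁ < x₀ ≤ B` with `Q i xᵢ`. -/
def Chain (Q : ℕ → ℤ → Prop) (B : ℤ) : ℕ → ℤ → Prop
  | 0, x => ∃ x', x ≤ x' ∧ x' ≤ B ∧ Q 0 x'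
  | n + 1, x => ∃ x', x ≤ x' ∧ Q (n + 1) x' ∧ Chain Q B n (x' + 1)

/-- The vertex `(x, y)` lies weakly to the left of a chain of vertical edges, taken from `O`,
that join the successive ordinates from `b`, `b + 1` to `y` and move strictly to the left,
starting at an abscissa at most `B`. -/
def Reach (O : Set (ℤ × ℤ)) (B b y x : ℤ) : Prop :=
  if b < y then Chain (fun n z => (z, b + n) ∈ O) B (y - b - 1).toNat x
  else Chain (fun n z => (z, b - n) ∈ O) B (b - y).toNat x

section Reach

variable {O : Set (ℤ × ℤ)} {B b y x : ℤ}

/-- The first edge of a chain joins the ordinates `b` and `b + 1`, so it serves both of them and the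
two base cases coincide. -/
lemma reach_self : Reach O B b b x ↔ ∃ x', x ≤ x' ∧ x' ≤ B ∧ (x', b) ∈ O := by
  simp [Reach, Chain]

lemma reach_add_one : Reach O B b (b + 1) x ↔ ∃ x', x ≤ x' ∧ x' ≤ B ∧ (x', b) ∈ O := by
  simp [Reach, Chain]

lemma reach_up (hy : b < y) :
    Reach O B b (y + 1) x ↔ ∃ x', x ≤ x' ∧ (x', y) ∈ O ∧ Reach O B b y (x' + 1) := by
  obtain ⟨n, rfl⟩ : ∃ n : ℕ, y = b + 1 + n := ⟨(y - b - 1).toNat, by omega⟩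
  have h1 : (b + 1 + n + 1 - b - 1).toNat = n + 1 := by omega
  have h2 : (b + 1 + n - b - 1).toNat = n := by omega
  have h3 : b + ((n + 1 : ℕ) : ℤ) = b + 1 + n := by push_cast; ring
  simp only [Reach, if_pos hy, if_pos (by omega : b < b + 1 + n + 1), h1, h2, Chain, h3]

lemma reach_down (hy : y ≤ b) :
    Reach O B b (y - 1) x ↔ ∃ x', x ≤ x' ∧ (x', y - 1) ∈ O ∧ Reach O B b y (x' + 1) := by
  obtain ⟨n, rfl⟩ : ∃ n : ℕ, y = b - n := ⟨(b - y).toNat, by omega⟩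
  have h1 : (b - (b - n - 1)).toNat = n + 1 := by omega
  have h2 : (b - (b - n)).toNat = n := by omega
  have h3 : b - ((n + 1 : ℕ) : ℤ) = b - n - 1 := by push_cast; ring
  simp only [Reach, if_neg (by omega : ¬ b < b - (n : ℤ)), if_neg (by omega : ¬ b < b - (n : ℤ) - 1),
    h1, h2, Chain, h3]

/-- There are two starting ordinates because a diamond has two longest segments, one for each half.
-/
lemma vertical_induction {p : ℤ → Prop} (b : ℤ) (h0 : p b) (h1 : p (b + 1))
    (up : ∀ y, b < y → p y → p (y + 1)) (down : ∀ y, y ≤ b → p y → p (y - 1)) (y : ℤ) : p y := by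
  rcases le_or_gt y b with h | h
  · exact Int.leInductionDown h0 (fun n hn => down n hn) y h
  · exact Int.leInduction h1 (fun n hn => up n (by omega)) y h

lemma Reach.mono {x' : ℤ} (h : Reach O B b y x) (hx : x' ≤ x) : Reach O B b y x' := by
  revert h
  refine vertical_induction (p := fun y => Reach O B b y x → Reach O B b y x') b ?_ ?_ ?_ ?_ y
  · rw [reach_self, reach_self]
    exact fun ⟨z, h, h'⟩ => ⟨z, hx.trans h, h'⟩
  · rw [reach_add_one, reach_add_one]
    exact fun ⟨z, h, h'⟩ => ⟨z, hx.trans h, h'⟩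
  · intro y hy _
    rw [reach_up hy, reach_up hy]
    exact fun ⟨z, h, h'⟩ => ⟨z, hx.trans h, h'⟩
  · intro y hy _
    rw [reach_down hy, reach_down hy]
    exact fun ⟨z, h, h'⟩ => ⟨z, hx.trans h, h'⟩

/-- A chain moves left by at least one unit per ordinate, so reached vertices stay within the right
border of the diamond. -/
lemma Reach.le (h : Reach O B b y x) : x ≤ B - segStart (y - b) := by
  refine vertical_induction (p := fun y => ∀ x, Reach O B b y x → x ≤ B - segStart (y - b))
    b ?_ ?_ ?_ ?_ y x h
  · intro x
    rw [reach_self]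
    rintro ⟨z, h, h', -⟩
    simp only [segStart]
    split_ifs <;> omega
  · intro x
    rw [reach_add_one]
    rintro ⟨z, h, h', -⟩
    simp only [segStart]
    split_ifs <;> omega
  · intro y hy ih x
    rw [reach_up hy]
    rintro ⟨z, h, -, h'⟩
    have := ih _ h'
    simp only [segStart] at this ⊢
    split_ifs at this ⊢ <;> omega
  · intro y hy ih x
    rw [reach_down hy]
    rintro ⟨z, h, -, h'⟩
    have := ih _ h'
    simp only [segStart] at this ⊢
    split_ifs at this ⊢ <;> omega

/-- The last edge of the chain is itself weakly to the left of the chain. Consequently the greatest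
reached abscissa of a row carries a vertical edge towards the base. -/
lemma Reach.exists_up (h : Reach O B b y x) (hy : b < y) :
    ∃ x', x ≤ x' ∧ (x', y - 1) ∈ O ∧ Reach O B b y x' := by
  obtain rfl | hy' : y = b + 1 ∨ b < y - 1 := by omega
  · rw [reach_add_one] at h
    obtain ⟨z, h1, h2, h3⟩ := h
    exact ⟨z, h1, by simpa using h3, reach_add_one.2 ⟨z, le_rfl, h2, h3⟩⟩
  · obtain ⟨t, rfl⟩ : ∃ t, y = t + 1 := ⟨y - 1, by ring⟩
    rw [add_sub_cancel_right] at *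
    obtain ⟨z, h1, h2, h3⟩ := (reach_up hy').1 h
    exact ⟨z, h1, h2, (reach_up hy').2 ⟨z, le_rfl, h2, h3⟩⟩

lemma Reach.exists_down (h : Reach O B b y x) (hy : y ≤ b) :
    ∃ x', x ≤ x' ∧ (x', y) ∈ O ∧ Reach O B b y x' := by
  obtain rfl | hy' : y = b ∨ y + 1 ≤ b := by omega
  · rw [reach_self] at h
    obtain ⟨z, h1, h2, h3⟩ := h
    exact ⟨z, h1, h3, reach_self.2 ⟨z, le_rfl, h2, h3⟩⟩
  · obtain ⟨t, rfl⟩ : ∃ t, y = t - 1 := ⟨y + 1, by ring⟩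
    rw [sub_add_cancel] at hy'
    obtain ⟨z, h1, h2, h3⟩ := (reach_down hy').1 h
    exact ⟨z, h1, h2, (reach_down hy').2 ⟨z, le_rfl, h2, h3⟩⟩

/-- Dropping the last edge of a chain shows that being reached is inherited towards the base. -/
lemma Reach.sub_one (h : Reach O B b y x) (hy : b < y) : Reach O B b (y - 1) x := by
  obtain rfl | hy' : y = b + 1 ∨ b < y - 1 := by omega
  · rw [add_sub_cancel_right, reach_self]
    exact reach_add_one.1 h
  · obtain ⟨t, rfl⟩ : ∃ t, y = t + 1 := ⟨y - 1, by ring⟩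
    rw [add_sub_cancel_right] at *
    obtain ⟨z, h1, h2, h3⟩ := (reach_up hy').1 h
    exact h3.mono (by omega)

lemma Reach.add_one (h : Reach O B b y x) (hy : y ≤ b) : Reach O B b (y + 1) x := by
  obtain rfl | hy' : y = b ∨ y + 1 ≤ b := by omega
  · rw [reach_add_one]
    exact reach_self.1 h
  · obtain ⟨t, rfl⟩ : ∃ t, y = t - 1 := ⟨y + 1, by ring⟩
    rw [sub_add_cancel] at *
    obtain ⟨z, h1, h2, h3⟩ := (reach_down hy').1 h
    exact h3.mono (by omega)

end Reach

/-! ### Pinecones and their profiles -/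

/-- The horizontal segments of `Q` are at the ordinates from `b - j` to `b + i`, and the one at
ordinate `y` goes from `a + segStart (y - b)` to `R y`. -/
structure Profile (a b i j : ℤ) (R : ℤ → ℤ) (Q : LatticeGraph) : Prop where
  hi : 1 ≤ i
  hj : 0 ≤ j
  adj : ∀ x y, Q.Adj (x, y) (x + 1, y) ↔
    b - j ≤ y ∧ y ≤ b + i ∧ a + segStart (y - b) ≤ x ∧ x < R y
  verts : ∀ x y, (x, y) ∈ Q.verts ↔
    b - j ≤ y ∧ y ≤ b + i ∧ a + segStart (y - b) ≤ x ∧ x ≤ R y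
  base : R (b + 1) = R b
  up : ∀ y, b < y → y < b + i → R (y + 1) < R y
  down : ∀ y, y ≤ b → b - j < y → R (y - 1) < R y
  parity_up : ∀ y, b < y → y ≤ b + i → Even (R y + y)
  parity_down : ∀ y, y ≤ b → b - j ≤ y → Odd (R y + y)
  lt : ∀ y, b - j ≤ y → y ≤ b + i → a + segStart (y - b) < R y

lemma IsPinecone.exists_profile {a b k : ℤ} {Q : LatticeGraph} (h : IsPinecone a b k Q) :
    ∃ i j R, Profile a b i j R Q ∧ R b = a + 2 * k - 1 := by
  obtain ⟨hab, ⟨i, j, L, hi, hj, hL, hL0, hL1, hmono, hanti, hadj⟩, hv, -⟩ := h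
  have hadj' : ∀ x y, Q.Adj (x, y) (x + 1, y) ↔ b - j ≤ y ∧ y ≤ b + i ∧
      a + segStart (y - b) ≤ x ∧ x < a + segStart (y - b) + L (y - b) := by
    intro x y
    have := hadj (x - a) (y - b)
    rw [add_sub_cancel, add_sub_cancel] at this
    rw [this, Set.mem_Icc]
    omega
  rw [Int.even_iff] at hab
  have hodd : ∀ y, b - j ≤ y → y ≤ b + i → 0 < L (y - b) ∧ L (y - b) % 2 = 1 := by
    intro y h1 h2
    have := hL (y - b) ⟨by omega, by omega⟩
    rwa [Int.odd_iff] at this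
  refine ⟨i, j, fun y => a + segStart (y - b) + L (y - b), ⟨hi, hj, hadj', ?_, ?_, ?_, ?_, ?_, ?_,
    ?_⟩, ?_⟩
  · intro x y
    rw [hv, hadj']
    have := hadj' (x - 1) y
    rw [sub_add_cancel] at this
    rw [this]
    have := hodd y
    omega
  · simp only [add_sub_cancel_left, sub_self, hL0, hL1, segStart]
    norm_num
  · intro y h1 h2
    have h3 := hanti (a := y - b) ⟨by omega, by omega⟩ (b := y + 1 - b) ⟨by omega, by omega⟩
      (by omega)
    have h4 := hodd y (by omega) (by omega)
    have h5 := hodd (y + 1) (by omega) (by omega)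
    simp only [segStart]
    split_ifs <;> omega
  · intro y h1 h2
    have h3 := hmono (a := y - 1 - b) ⟨by omega, by omega⟩ (b := y - b) ⟨by omega, by omega⟩
      (by omega)
    have h4 := hodd y (by omega) (by omega)
    have h5 := hodd (y - 1) (by omega) (by omega)
    simp only [segStart]
    split_ifs <;> omega
  · intro y h1 h2
    have h4 := hodd y (by omega) (by omega)
    simp only [segStart, Int.even_iff]
    split_ifs <;> omega
  · intro y h1 h2
    have h4 := hodd y (by omega) (by omega)
    simp only [segStart, Int.odd_iff]
    split_ifs <;> omega
  · intro y h1 h2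
    have h4 := hodd y (by omega) (by omega)
    omega
  · simp only [sub_self, hL0, segStart]
    norm_num
    ring

lemma Profile.isPinecone {a b i j : ℤ} {R : ℤ → ℤ} {Q : LatticeGraph} (h : Profile a b i j R Q)
    (hab : Even (a + b)) (hv : ∀ x y : ℤ, (x, y) ∈ Q.verts → (x, y + 1) ∈ Q.verts →
      Even (x + y) → Q.Adj (x, y) (x, y + 1)) : ∃ k, IsPinecone a b k Q := by
  have hi := h.hi
  have hj := h.hj
  have hpar := h.parity_down b le_rfl (by omega)
  rw [Int.odd_iff] at hpar
  rw [Int.even_iff] at hab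
  refine ⟨(R b - a + 1) / 2, Int.even_iff.2 hab,
    ⟨i, j, fun m => R (b + m) - a - segStart m, hi, hj, ?_, ?_, ?_, ?_, ?_, ?_⟩, ?_, hv⟩
  · rintro m ⟨h1, h2⟩
    have h3 := h.lt (b + m) (by omega) (by omega)
    have h4 := h.parity_up (b + m)
    have h5 := h.parity_down (b + m)
    rw [add_sub_cancel_left] at h3
    simp only [Int.even_iff, Int.odd_iff] at h4 h5 ⊢
    simp only [segStart] at h3 ⊢
    split_ifs at h3 ⊢ <;> omega
  · simp only [segStart]
    norm_num
    omega
  · have := h.base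
    simp only [segStart]
    norm_num
    omega
  · refine strictMonoOn_of_lt_succ Set.ordConnected_Icc fun m _ h1 h2 => ?_
    rw [Order.succ_eq_add_one] at *
    have := h.down (b + m + 1) (by have := h2.2; omega) (by have := h1.1; omega)
    rw [add_sub_cancel_right] at this
    have h3 := h2.2
    simp only [← add_assoc, segStart]
    split_ifs <;> omega
  · refine strictAntiOn_of_succ_lt Set.ordConnected_Icc fun m _ h1 h2 => ?_
    rw [Order.succ_eq_add_one] at *
    have := h.up (b + m) (by have := h1.1; omega) (by have := h2.2; omega)
    have h3 := h1.1
    simp only [← add_assoc, segStart]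
    split_ifs <;> omega
  · intro x m
    rw [h.adj, add_sub_cancel_left, Set.mem_Icc]
    beta_reduce
    omega
  · intro x y
    have h1 := h.lt y
    have h2 := h.adj (x - 1) y
    rw [sub_add_cancel] at h2
    rw [h.verts, h.adj, h2]
    omega

lemma exists_adj_ne {Q : LatticeGraph} {u v : ℤ × ℤ} (hv : (Q.neighborSet v).encard ≠ 1)
    (hu : Q.Adj v u) : ∃ u', Q.Adj v u' ∧ u' ≠ u := by
  by_contra! hc
  refine hv (Set.encard_eq_one.2 ⟨u, ?_⟩)
  ext z
  simp only [SimpleGraph.Subgraph.mem_neighborSet, Set.mem_singleton_iff]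
  exact ⟨hc z, by rintro rfl; exact hu⟩

lemma encard_neighborSet_ne_one {Q : LatticeGraph} {u u' v : ℤ × ℤ} (h : Q.Adj v u)
    (h' : Q.Adj v u') (hne : u ≠ u') : (Q.neighborSet v).encard ≠ 1 := by
  intro hc
  obtain ⟨z, hz⟩ := Set.encard_eq_one.1 hc
  have h1 : u ∈ Q.neighborSet v := h
  have h2 : u' ∈ Q.neighborSet v := h'
  rw [hz] at h1 h2
  exact hne (h1.trans h2.symm)

section

variable {a b i j : ℤ} {R : ℤ → ℤ} {Q : LatticeGraph} (h : Profile a b i j R Q)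
  (hQ : ∀ v ∈ Q.verts, (Q.neighborSet v).encard ≠ 1)

include h hQ

/-- The right end has no right neighbour, and no vertex lies beyond it because the next segment
outwards ends strictly further left. Its second edge can only go towards the base. -/
lemma Profile.adj_up_end {y : ℤ} (hy : b < y) (hy' : y ≤ b + i) :
    Q.Adj (R y, y - 1) (R y, y) := by
  have hj := h.hj
  have hlt := h.lt y (by omega) hy'
  have hl : Q.Adj (R y - 1, y) (R y - 1 + 1, y) := (h.adj _ _).2 ⟨by omega, hy', by omega, by omega⟩
  rw [sub_add_cancel] at hl
  obtain ⟨u, hu, hne⟩ := exists_adj_ne (hQ _ hl.snd_mem) hl.symm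
  rcases squareLattice_adj_cases hu.adj_sub with rfl | rfl | rfl | rfl
  · have := (h.adj _ _).1 hu
    omega
  · exact absurd rfl hne
  · have h1 := (h.verts _ _).1 hu.snd_mem
    simp only at h1
    have h2 := h.up y hy (by omega)
    omega
  · exact hu.symm

lemma Profile.adj_down_end {y : ℤ} (hy : y ≤ b) (hy' : b - j ≤ y) :
    Q.Adj (R y, y) (R y, y + 1) := by
  have hi := h.hi
  have hlt := h.lt y hy' (by omega)
  have hl : Q.Adj (R y - 1, y) (R y - 1 + 1, y) :=
    (h.adj _ _).2 ⟨by omega, by omega, by omega, by omega⟩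
  rw [sub_add_cancel] at hl
  obtain ⟨u, hu, hne⟩ := exists_adj_ne (hQ _ hl.snd_mem) hl.symm
  rcases squareLattice_adj_cases hu.adj_sub with rfl | rfl | rfl | rfl
  · have := (h.adj _ _).1 hu
    omega
  · exact absurd rfl hne
  · exact hu
  · have h1 := (h.verts _ _).1 hu.snd_mem
    have h2 := h.down y hy (by omega)
    simp only at h1
    omega

/-- The vertices of a pinecone without vertices of degree one are reached by chains of odd
vertical edges. -/
lemma Profile.reach {O : Set (ℤ × ℤ)} {B : ℤ} (hB : R b ≤ B)
    (hO : ∀ x y, Odd (x + y) → Q.Adj (x, y) (x, y + 1) → (x, y) ∈ O) {x y : ℤ}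
    (hxy : (x, y) ∈ Q.verts) : Reach O B b y x := by
  have hi := h.hi
  have hj := h.hj
  suffices key : ∀ y, b - j ≤ y ∧ y ≤ b + i → Reach O B b y (R y) by
    have := (h.verts x y).1 hxy
    exact (key y ⟨this.1, this.2.1⟩).mono this.2.2.2
  have hOu : ∀ y, b < y → y ≤ b + i → (R y, y - 1) ∈ O := by
    intro y h1 h2
    have := h.parity_up y h1 h2
    refine hO _ _ ?_ (by simpa using h.adj_up_end hQ h1 h2)
    rw [Int.even_iff] at this
    rw [Int.odd_iff]
    omega
  have hOd : ∀ y, y ≤ b → b - j ≤ y → (R y, y) ∈ O := fun y h1 h2 =>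
    hO _ _ (h.parity_down y h1 h2) (h.adj_down_end hQ h1 h2)
  refine vertical_induction b ?_ ?_ ?_ ?_
  · intro _
    exact reach_self.2 ⟨R b, le_rfl, hB, hOd b le_rfl (by omega)⟩
  · intro _
    rw [h.base]
    exact reach_add_one.2 ⟨R b, le_rfl, hB, hOd b le_rfl (by omega)⟩
  · intro y hy ih hr
    rw [reach_up hy]
    refine ⟨_, le_rfl, ?_, (ih ⟨by omega, by omega⟩).mono ?_⟩
    · simpa using hOu (y + 1) (by omega) hr.2
    · have := h.up y hy (by omega)
      omega
  · intro y hy ih hr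
    rw [reach_down hy]
    refine ⟨_, le_rfl, hOd (y - 1) (by omega) hr.1, (ih ⟨by omega, by omega⟩).mono ?_⟩
    have := h.down y hy (by omega)
    omega

end

/-! ### The core of a graph -/

/-- The positions of the odd vertical edges of `G`. -/
def oddVerticals (G : LatticeGraph) : Set (ℤ × ℤ) :=
  {v | Odd (v.1 + v.2) ∧ G.Adj (v.1, v.2) (v.1, v.2 + 1)}

/-- The vertices of the core of the part of a graph lying in `diamond a b k`, where `O` is the set
of positions of the odd vertical edges. -/
def coreVerts (O : Set (ℤ × ℤ)) (a b k : ℤ) : Set (ℤ × ℤ) :=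
  {v | a + segStart (v.2 - b) ≤ v.1 ∧ Reach O (a + 2 * k - 1) b v.2 v.1}

lemma mem_coreVerts {O : Set (ℤ × ℤ)} {a b k x y : ℤ} : (x, y) ∈ coreVerts O a b k ↔
    a + segStart (y - b) ≤ x ∧ Reach O (a + 2 * k - 1) b y x := Iff.rfl

lemma coreVerts_subset (O : Set (ℤ × ℤ)) (a b k : ℤ) : coreVerts O a b k ⊆ diamondVerts a b k :=
  fun _ h => ⟨h.1, h.2.le⟩

lemma coreVerts_sub_one {O : Set (ℤ × ℤ)} {a b k x y : ℤ} (h : (x, y) ∈ coreVerts O a b k) (hy : b < y) :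
    (x, y - 1) ∈ coreVerts O a b k := by
  refine ⟨?_, h.2.sub_one hy⟩
  have := h.1
  simp only [segStart] at *
  split_ifs at * <;> omega

lemma coreVerts_add_one {O : Set (ℤ × ℤ)} {a b k x y : ℤ} (h : (x, y) ∈ coreVerts O a b k) (hy : y ≤ b) :
    (x, y + 1) ∈ coreVerts O a b k := by
  refine ⟨?_, h.2.add_one hy⟩
  have := h.1
  simp only [segStart] at *
  split_ifs at * <;> omega

/-- `G` contains all the horizontal and all the even vertical edges of `diamond a b k`. -/
structure IsFullOn (G : LatticeGraph) (a b k : ℤ) : Prop where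
  horizontal : ∀ x y, (x, y) ∈ diamondVerts a b k → (x + 1, y) ∈ diamondVerts a b k →
    G.Adj (x, y) (x + 1, y)
  vertical : ∀ x y, (x, y) ∈ diamondVerts a b k → (x, y + 1) ∈ diamondVerts a b k → Even (x + y) →
    G.Adj (x, y) (x, y + 1)

section

variable {G : LatticeGraph} {a b k : ℤ} (hG : IsFullOn G a b k) (hab : Even (a + b))

include hG hab

/-- The right end of a row is its greatest reached abscissa. It carries an odd vertical edge of a
chain, which gives the parity of the segment, and the next edges of chains lie strictly further
left, which gives monotonicity. -/
lemma exists_profile_induce_coreVerts (hne : (coreVerts (oddVerticals G) a b k).Nonempty) :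
    ∃ i j R, Profile a b i j R (G.induce (coreVerts (oddVerticals G) a b k)) := by
  set O := oddVerticals G with hO
  have hsub := coreVerts_subset O a b k
  let N : ℤ → Prop := fun y => ∃ x, (x, y) ∈ coreVerts O a b k
  have hNle : ∀ y, N y → b - k < y ∧ y ≤ b + k := by
    rintro y ⟨x, hx⟩
    have := hsub hx
    rw [mem_diamondVerts] at this
    simp only [segStart] at this
    split_ifs at this <;> omega
  have hN0 : N b ↔ N (b + 1) := by
    simp only [N, mem_coreVerts, reach_self, reach_add_one, segStart]
    norm_num
  have hNup : ∀ y, b < y → N (y + 1) → N y := by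
    rintro y hy ⟨x, hx1, hx2⟩
    refine ⟨x, ?_, ?_⟩
    · simp only [segStart] at *
      split_ifs at * <;> omega
    · simpa using hx2.sub_one (by omega)
  have hNdown : ∀ y, y ≤ b → N (y - 1) → N y := by
    rintro y hy ⟨x, hx1, hx2⟩
    refine ⟨x, ?_, ?_⟩
    · simp only [segStart] at *
      split_ifs at * <;> omega
    · simpa using hx2.add_one (by omega)
  have hNb : N b := by
    obtain ⟨⟨x, y⟩, hxy⟩ := hne
    have hy : N y := ⟨x, hxy⟩
    revert hy
    exact vertical_induction (p := fun y => N y → N b) b id hN0.2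
      (fun y hy ih h => ih (hNup y hy h)) (fun y hy ih h => ih (hNdown y hy h)) y
  -- The nonempty rows form an interval around the base, since being reached is inherited towards
  -- it; `i` and `j` measure this interval.
  obtain ⟨i, ⟨hi1, hNi⟩, hi⟩ := Int.exists_greatest_of_bdd (P := fun m => 1 ≤ m ∧ N (b + m))
    ⟨k, fun m hm => by have := hNle _ hm.2; omega⟩ ⟨1, le_rfl, hN0.1 hNb⟩
  obtain ⟨j, ⟨hj0, hNj⟩, hj⟩ := Int.exists_greatest_of_bdd (P := fun m => 0 ≤ m ∧ N (b - m))
    ⟨k, fun m hm => by have := hNle _ hm.2; omega⟩ ⟨0, le_rfl, by simpa using hNb⟩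
  have hNiff : ∀ y, N y ↔ b - j ≤ y ∧ y ≤ b + i := by
    have hup : ∀ m, m ≤ i → 1 ≤ m → N (b + m) := by
      refine Int.leInductionDown (fun _ => hNi) fun m hm ih h => ?_
      refine hNup (b + (m - 1)) (by omega) ?_
      rw [show b + (m - 1) + 1 = b + m by ring]
      exact ih (by omega)
    have hdown : ∀ m, m ≤ j → 0 ≤ m → N (b - m) := by
      refine Int.leInductionDown (fun _ => hNj) fun m hm ih h => ?_
      refine hNdown (b - (m - 1)) (by omega) ?_
      rw [show b - (m - 1) - 1 = b - m by ring]
      exact ih (by omega)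
    intro y
    constructor
    · intro hy
      rcases le_or_gt y b with h | h
      · have := hj (b - y) ⟨by omega, by rwa [sub_sub_cancel]⟩
        omega
      · have := hi (y - b) ⟨by omega, by rwa [add_sub_cancel]⟩
        omega
    · intro hy
      rcases le_or_gt y b with h | h
      · simpa using hdown (b - y) (by omega) (by omega)
      · simpa using hup (y - b) (by omega) (by omega)
  have hR : ∀ y, ∃ r, N y → a + segStart (y - b) ≤ r ∧
      ∀ x, Reach O (a + 2 * k - 1) b y x ↔ x ≤ r := by
    intro y
    by_cases hy : N y
    · obtain ⟨x, hx⟩ := hy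
      obtain ⟨r, hr, hr'⟩ := Int.exists_greatest_of_bdd (P := Reach O (a + 2 * k - 1) b y)
        ⟨_, fun z hz => hz.le⟩ ⟨x, hx.2⟩
      exact ⟨r, fun _ => ⟨hx.1.trans (hr' _ hx.2), fun z => ⟨hr' z, fun hz => hr.mono hz⟩⟩⟩
    · exact ⟨0, fun h => absurd h hy⟩
  choose R hR using hR
  have hRup : ∀ y, b < y → N y → (R y, y - 1) ∈ O := by
    intro y hy hN
    obtain ⟨x', h1, h2, h3⟩ := (((hR y hN).2 _).2 le_rfl).exists_up hy
    rwa [le_antisymm h1 (((hR y hN).2 _).1 h3)]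
  have hRdown : ∀ y, y ≤ b → N y → (R y, y) ∈ O := by
    intro y hy hN
    obtain ⟨x', h1, h2, h3⟩ := (((hR y hN).2 _).2 le_rfl).exists_down hy
    rwa [le_antisymm h1 (((hR y hN).2 _).1 h3)]
  have hverts : ∀ x y, (x, y) ∈ coreVerts O a b k ↔
      b - j ≤ y ∧ y ≤ b + i ∧ a + segStart (y - b) ≤ x ∧ x ≤ R y := by
    intro x y
    by_cases hy : N y
    · have := (hNiff y).1 hy
      rw [mem_coreVerts, (hR y hy).2]
      tauto
    · have h1 : (x, y) ∉ coreVerts O a b k := fun h => hy ⟨x, h⟩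
      rw [hNiff y] at hy
      tauto
  have hparup : ∀ y, b < y → y ≤ b + i → Even (R y + y) := by
    intro y hy hy'
    have := (hRup y hy ((hNiff y).2 ⟨by omega, hy'⟩)).1
    rw [Int.odd_iff] at this
    rw [Int.even_iff]
    simp only at this
    omega
  have hpardown : ∀ y, y ≤ b → b - j ≤ y → Odd (R y + y) := fun y hy hy' =>
    (hRdown y hy ((hNiff y).2 ⟨by omega, by omega⟩)).1
  refine ⟨i, j, R, hi1, hj0, ?_, hverts, ?_, ?_, ?_, hparup, hpardown, ?_⟩
  · intro x y
    rw [SimpleGraph.Subgraph.induce_adj, hverts, hverts]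
    constructor
    · rintro ⟨h1, h2, -⟩
      omega
    · intro h
      refine ⟨by omega, by omega, hG.horizontal _ _ (hsub ((hverts _ _).2 (by omega)))
        (hsub ((hverts _ _).2 (by omega)))⟩
  · have h1 := hR b hNb
    have h2 := hR (b + 1) (hN0.1 hNb)
    simp only [reach_self] at h1
    simp only [reach_add_one] at h2
    exact le_antisymm (by rw [← h1.2, h2.2]) (by rw [← h2.2, h1.2])
  · intro y hy hy'
    have h1 := hR y ((hNiff y).2 ⟨by omega, by omega⟩)
    have h2 := hR (y + 1) ((hNiff _).2 ⟨by omega, by omega⟩)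
    obtain ⟨x', h3, -, h4⟩ := (reach_up hy).1 ((h2.2 _).2 le_rfl)
    have := (h1.2 _).1 h4
    omega
  · intro y hy hy'
    have h1 := hR y ((hNiff y).2 ⟨by omega, by omega⟩)
    have h2 := hR (y - 1) ((hNiff _).2 ⟨by omega, by omega⟩)
    obtain ⟨x', h3, -, h4⟩ := (reach_down hy).1 ((h2.2 _).2 le_rfl)
    have := (h1.2 _).1 h4
    omega
  · intro y hy hy'
    have h1 := (hR y ((hNiff y).2 ⟨by omega, by omega⟩)).1
    have h2 := hparup y
    have h3 := hpardown y
    rw [Int.even_iff] at hab h2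
    rw [Int.odd_iff] at h3
    simp only [segStart] at *
    split_ifs at * <;> omega

/-- Inner vertices of a segment have two horizontal neighbours. A left end has an even vertical
edge, which is available because `G` is full on the diamond; a right end has the odd vertical edge
of a chain. -/
lemma isClosedPinecone_induce_coreVerts (hne : (coreVerts (oddVerticals G) a b k).Nonempty) :
    ∃ k', IsClosedPinecone a b k' (G.induce (coreVerts (oddVerticals G) a b k)) := by
  obtain ⟨i, j, R, hp⟩ := exists_profile_induce_coreVerts hG hab hne
  have hsub := coreVerts_subset (oddVerticals G) a b k
  obtain ⟨k', hk'⟩ := hp.isPinecone hab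
    fun x y h h' he => ⟨h, h', hG.vertical x y (hsub h) (hsub h') he⟩
  refine ⟨k', hk', ?_⟩
  rintro ⟨x, y⟩ hxy
  have hv := (hp.verts x y).1 hxy
  have hl := hp.lt y hv.1 hv.2.1
  have hleft : a + segStart (y - b) < x →
      (G.induce (coreVerts (oddVerticals G) a b k)).Adj (x, y) (x - 1, y) := by
    intro h
    have := (hp.adj (x - 1) y).2 ⟨hv.1, hv.2.1, by omega, by omega⟩
    rw [sub_add_cancel] at this
    exact this.symm
  have hright : x < R y →
      (G.induce (coreVerts (oddVerticals G) a b k)).Adj (x, y) (x + 1, y) := by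
    intro h
    exact (hp.adj x y).2 ⟨hv.1, hv.2.1, by omega, by omega⟩
  have hvert : (x = a + segStart (y - b) ∨ x = R y) →
      (G.induce (coreVerts (oddVerticals G) a b k)).Adj (x, y) (x, y - 1) ∨
      (G.induce (coreVerts (oddVerticals G) a b k)).Adj (x, y) (x, y + 1) := by
    intro h
    rw [Int.even_iff] at hab
    rcases le_or_gt y b with hy | hy
    · right
      have h1 := coreVerts_add_one hxy hy
      refine ⟨hxy, h1, ?_⟩
      rcases h with h | h
      · refine hG.vertical _ _ (hsub hxy) (hsub h1) ?_
        rw [Int.even_iff, h]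
        simp only [segStart]
        split_ifs <;> omega
      · obtain ⟨x', h2, h3, h4⟩ := hxy.2.exists_down hy
        have h5 := (hp.verts x' y).1 ⟨hxy.1.trans h2, h4⟩
        obtain rfl : x' = x := by simp only at h2; omega
        exact h3.2
    · left
      have h1 := coreVerts_sub_one hxy hy
      refine ⟨hxy, h1, SimpleGraph.Subgraph.Adj.symm ?_⟩
      rcases h with h | h
      · have := hG.vertical x (y - 1) (hsub h1) (by simpa using hsub hxy) ?_
        · simpa using this
        rw [Int.even_iff, h]
        simp only [segStart]
        split_ifs <;> omega
      · obtain ⟨x', h2, h3, h4⟩ := hxy.2.exists_up hy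
        have h5 := (hp.verts x' y).1 ⟨hxy.1.trans h2, h4⟩
        obtain rfl : x' = x := by simp only at h2; omega
        simpa using h3.2
  by_cases h1 : x = a + segStart (y - b)
  · rcases hvert (.inl h1) with h | h
    · exact encard_neighborSet_ne_one h (hright (by omega)) (by simp)
    · exact encard_neighborSet_ne_one h (hright (by omega)) (by simp)
  · by_cases h2 : x = R y
    · rcases hvert (.inr h2) with h | h
      · exact encard_neighborSet_ne_one h (hleft (by omega)) (by simp)
      · exact encard_neighborSet_ne_one h (hleft (by omega)) (by simp)
    · exact encard_neighborSet_ne_one (hleft (by omega)) (hright (by omega))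
        (by simp only [ne_eq, Prod.mk.injEq]; omega)

/-- The core of the part of `G` in a diamond is induced by the vertices reached by chains of odd
vertical edges. -/
theorem core_inf_diamond :
    core a b (G ⊓ diamond a b k) = G.induce (coreVerts (oddVerticals G) a b k) := by
  have hsub := coreVerts_subset (oddVerticals G) a b k
  apply le_antisymm
  -- The right ends of any closed pinecone contained in the intersection form a chain, and the
  -- diamond bounds its first edge; so all vertices of the pinecone are reached.
  · refine sSup_le ?_
    rintro Q ⟨hQ, k', hk', hQd⟩
    obtain ⟨i, j, R, hp, -⟩ := hk'.exists_profile
    have hi := hp.hi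
    have hj := hp.hj
    have hlt := hp.lt b (by omega) (by omega)
    have hB : R b ≤ a + 2 * k - 1 := by
      have h1 : (R b, b) ∈ Q.verts := (hp.verts _ _).2 ⟨by omega, by omega, by omega, le_rfl⟩
      have h2 := (hQ.1 h1).2
      rw [diamond_verts, mem_diamondVerts] at h2
      simp only [sub_self, segStart] at h2
      norm_num at h2
      omega
    have hv : Q.verts ⊆ coreVerts (oddVerticals G) a b k := by
      rintro ⟨x, y⟩ hxy
      refine ⟨((hp.verts x y).1 hxy).2.2.1, hp.reach hQd hB ?_ hxy⟩
      exact fun x y h1 h2 => ⟨h1, (hQ.2 h2).1⟩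
    exact ⟨hv, fun u v h => ⟨hv h.fst_mem, hv h.snd_mem, (hQ.2 h).1⟩⟩
  · rcases (coreVerts (oddVerticals G) a b k).eq_empty_or_nonempty with h | h
    · rw [h]
      exact ⟨Set.empty_subset _, fun u v h => absurd h.1 (by simp)⟩
    · refine le_sSup ⟨?_, isClosedPinecone_induce_coreVerts hG hab h⟩
      obtain ⟨i, j, R, hp⟩ := exists_profile_induce_coreVerts hG hab h
      refine latticeGraph_le ?_ ?_ ?_
      · rintro ⟨x, y⟩ hxy
        refine ⟨?_, by rw [diamond_verts]; exact hsub hxy⟩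
        have h1 := (hp.verts x y).1 hxy
        have h2 := hp.lt y h1.1 h1.2.1
        by_cases h3 : x < R y
        · exact ((hp.adj x y).2 ⟨h1.1, h1.2.1, h1.2.2.1, h3⟩).2.2.fst_mem
        · have := ((hp.adj (x - 1) y).2 ⟨h1.1, h1.2.1, by omega, by omega⟩).2.2.snd_mem
          simpa using this
      · rintro x y ⟨h1, h2, h3⟩
        exact ⟨h3, diamond_adj_right.2 ⟨hsub h1, hsub h2⟩⟩
      · rintro x y ⟨h1, h2, h3⟩
        exact ⟨h3, diamond_adj_up.2 ⟨hsub h1, hsub h2⟩⟩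

end

/-! ### Matching polynomials as weighted sums -/

lemma exists_mem_sym2 (e : Sym2 (ℤ × ℤ)) : ∃ v, v ∈ e := by
  induction e with
  | _ u v => exact ⟨u, by simp⟩

lemma covers_of_isPerfectMatchingOf {H K : LatticeGraph} (hK : IsPerfectMatchingOf H K)
    {F : Finset (Sym2 (ℤ × ℤ))} (hF : ∀ e, e ∈ F ↔ e ∈ K.edgeSet) : Covers H.verts F := by
  classical
  obtain ⟨-, hv, hm⟩ := hK
  intro v
  split_ifs with h
  · rw [← hv] at h
    obtain ⟨u, hu, hu'⟩ := hm h
    have : {e ∈ F | v ∈ e} = {s(v, u)} := by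
      ext e
      simp only [mem_filter, mem_singleton, hF]
      constructor
      · rintro ⟨h1, h2⟩
        obtain ⟨z, rfl⟩ := Sym2.mem_iff_exists.1 h2
        rw [hu' z h1]
      · rintro rfl
        exact ⟨hu, by simp⟩
    rw [deg, this, card_singleton]
  · rw [deg, card_eq_zero, filter_eq_empty_iff]
    intro e he hve
    obtain ⟨z, rfl⟩ := Sym2.mem_iff_exists.1 hve
    rw [hF] at he
    exact h (hv ▸ K.edge_vert he)

/-- The spanning subgraph of `H` with edge set `F`. -/
def ofEdges (H : LatticeGraph) (F : Set (Sym2 (ℤ × ℤ))) (hF : F ⊆ H.edgeSet) : LatticeGraph where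
  verts := H.verts
  Adj u v := s(u, v) ∈ F
  adj_sub h := H.adj_sub (hF h)
  edge_vert h := H.edge_vert (hF h)
  symm := ⟨fun u v h => by rwa [Sym2.eq_swap]⟩

lemma mem_edgeSet_ofEdges {H : LatticeGraph} {F : Set (Sym2 (ℤ × ℤ))} {hF : F ⊆ H.edgeSet}
    {e : Sym2 (ℤ × ℤ)} : e ∈ (ofEdges H F hF).edgeSet ↔ e ∈ F := by
  induction e with
  | _ u v => rfl

lemma isPerfectMatchingOf_ofEdges {H : LatticeGraph} {F : Finset (Sym2 (ℤ × ℤ))}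
    (hF : (F : Set (Sym2 (ℤ × ℤ))) ⊆ H.edgeSet) (hc : Covers H.verts F) :
    IsPerfectMatchingOf H (ofEdges H F hF) := by
  refine ⟨⟨le_rfl, fun u v h => hF h⟩, rfl, fun v hv => ?_⟩
  obtain ⟨e, he, hve⟩ := hc.exists_mem hv
  obtain ⟨u, rfl⟩ := Sym2.mem_iff_exists.1 hve
  refine ⟨u, he, fun z hz => ?_⟩
  have := hc.eq (mem_coe.1 hz) he (Sym2.mem_mk_left v z) (Sym2.mem_mk_left v u)
  exact Sym2.congr_right.1 this

/-- A perfect matching has the same vertices as `H`, so as a subgraph it is determined by its edges.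
-/
lemma matchingPoly_eq_weightSum {H : LatticeGraph} {B : Finset (Sym2 (ℤ × ℤ))}
    (hB : ∀ e, (∀ v ∈ e, v ∈ H.verts) → (e ∈ B ↔ e ∈ H.edgeSet)) :
    matchingPoly H = weightSum B H.verts MvPolynomial.X := by
  classical
  have hmem : ∀ e ∈ H.edgeSet, e ∈ B := fun e he =>
    (hB e fun v hv => H.mem_verts_of_mem_edge he hv).2 he
  unfold matchingPoly weightSum
  rw [← finsum_mem_coe_finset]
  refine finsum_mem_eq_of_bijOn (fun K : LatticeGraph => {e ∈ B | e ∈ K.edgeSet}) ⟨?_, ?_, ?_⟩ ?_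
  · intro K hK
    simp only [coe_filter, mem_powerset, Set.mem_ofPred_eq]
    exact ⟨filter_subset _ _, covers_of_isPerfectMatchingOf hK fun e =>
      ⟨fun h => (mem_filter.1 h).2, fun h => mem_filter.2
        ⟨hmem e (SimpleGraph.Subgraph.edgeSet_mono hK.1 h), h⟩⟩⟩
  · intro K hK K' hK' h
    have hE : ∀ e, e ∈ K.edgeSet ↔ e ∈ K'.edgeSet := by
      intro e
      have := Finset.ext_iff.1 h e
      simp only [mem_filter] at this
      constructor
      · intro he
        exact (this.1 ⟨hmem e (SimpleGraph.Subgraph.edgeSet_mono hK.1 he), he⟩).2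
      · intro he
        exact (this.2 ⟨hmem e (SimpleGraph.Subgraph.edgeSet_mono hK'.1 he), he⟩).2
    refine SimpleGraph.Subgraph.ext (hK.2.1.trans hK'.2.1.symm) ?_
    ext u v
    exact hE s(u, v)
  · intro F hF
    simp only [coe_filter, mem_powerset, Set.mem_ofPred_eq] at hF
    have hF' : (F : Set (Sym2 (ℤ × ℤ))) ⊆ H.edgeSet := fun e he =>
      (hB e fun v hv => hF.2.mem he hv).1 (hF.1 he)
    refine ⟨ofEdges H F hF', isPerfectMatchingOf_ofEdges hF' hF.2, ?_⟩
    ext e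
    simp only [mem_filter, mem_edgeSet_ofEdges, mem_coe]
    exact ⟨fun h => h.2, fun h => ⟨hF.1 h, h⟩⟩
  · intro K hK
    rw [edgeProd, ← finprod_mem_coe_finset]
    congr! 3 with e
    simp only [coe_filter, Set.mem_ofPred_eq]
    exact ⟨fun h => ⟨hmem e (SimpleGraph.Subgraph.edgeSet_mono hK.1 h), h⟩, fun h => h.2⟩

/-! ### Horizontal pairs -/

/-- The vertices at which the horizontal edges of a forced matching start, for the base
ordinate `b`. -/
def IsLeftEnd (b x y : ℤ) : Prop := if b < y then Odd (x + y) else Even (x + y)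

lemma isLeftEnd_add_one {b x y : ℤ} : IsLeftEnd b (x + 1) y ↔ ¬ IsLeftEnd b x y := by
  simp only [IsLeftEnd, Int.even_iff, Int.odd_iff]
  split_ifs <;> omega

lemma isLeftEnd_add_two {b x y : ℤ} : IsLeftEnd b (x + 2) y ↔ IsLeftEnd b x y := by
  simp only [IsLeftEnd, Int.even_iff, Int.odd_iff]
  split_ifs <;> omega

/-- The set `T` is a disjoint union of pairs of horizontal neighbours. -/
def IsPaired (b : ℤ) (T : Set (ℤ × ℤ)) : Prop :=
  ∀ x y, IsLeftEnd b x y → ((x, y) ∈ T ↔ (x + 1, y) ∈ T)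

lemma IsPaired.diff {b : ℤ} {S T : Set (ℤ × ℤ)} (hS : IsPaired b S) (hT : IsPaired b T) :
    IsPaired b (S \ T) := fun x y h => by
  rw [Set.mem_sdiff, Set.mem_sdiff, hS x y h, hT x y h]

/-- The horizontal edges joining the pairs of `T`. -/
def pairEdges (b : ℤ) (T : Set (ℤ × ℤ)) : Set (Sym2 (ℤ × ℤ)) :=
  {e | ∃ x y, IsLeftEnd b x y ∧ (x, y) ∈ T ∧ e = hEdge x y}

lemma hEdge_mem_pairEdges {b x y : ℤ} {T : Set (ℤ × ℤ)} :
    hEdge x y ∈ pairEdges b T ↔ IsLeftEnd b x y ∧ (x, y) ∈ T := by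
  constructor
  · rintro ⟨x', y', h1, h2, h⟩
    obtain ⟨rfl, rfl⟩ := hEdge_inj.1 h
    exact ⟨h1, h2⟩
  · exact fun h => ⟨x, y, h.1, h.2, rfl⟩

lemma finite_pairEdges {b : ℤ} {T : Set (ℤ × ℤ)} (hT : T.Finite) : (pairEdges b T).Finite := by
  refine (hT.image fun v => hEdge v.1 v.2).subset ?_
  rintro e ⟨x, y, -, h, rfl⟩
  exact ⟨(x, y), h, rfl⟩

lemma IsPaired.exists_pairEdge {b : ℤ} {T : Set (ℤ × ℤ)} (hT : IsPaired b T) {v : ℤ × ℤ} (hv : v ∈ T) :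
    ∃ e ∈ pairEdges b T, v ∈ e := by
  obtain ⟨x, y⟩ := v
  by_cases h : IsLeftEnd b x y
  · exact ⟨hEdge x y, ⟨x, y, h, hv, rfl⟩, by simp [mem_hEdge]⟩
  · have h' : IsLeftEnd b (x - 1) y := by
      by_contra h'
      rw [← isLeftEnd_add_one, sub_add_cancel] at h'
      exact h h'
    have := (hT _ _ h').2 (by simpa using hv)
    exact ⟨hEdge (x - 1) y, ⟨_, _, h', this, rfl⟩, by simp [mem_hEdge]⟩

lemma IsPaired.mem_of_mem_pairEdge {b : ℤ} {T : Set (ℤ × ℤ)} (hT : IsPaired b T) {v : ℤ × ℤ}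
    {e : Sym2 (ℤ × ℤ)} (he : e ∈ pairEdges b T) (hv : v ∈ e) : v ∈ T := by
  obtain ⟨x, y, h1, h2, rfl⟩ := he
  obtain ⟨s, t⟩ := v
  rw [mem_hEdge] at hv
  obtain ⟨rfl, rfl | rfl⟩ := hv
  · exact h2
  · exact (hT _ _ h1).1 h2

lemma pairEdges_eq_of_mem {b : ℤ} {T : Set (ℤ × ℤ)} {v : ℤ × ℤ} {e e' : Sym2 (ℤ × ℤ)}
    (he : e ∈ pairEdges b T) (he' : e' ∈ pairEdges b T) (hv : v ∈ e) (hv' : v ∈ e') : e = e' := by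
  obtain ⟨x, y, h1, h2, rfl⟩ := he
  obtain ⟨x', y', h1', h2', rfl⟩ := he'
  rw [mem_hEdge] at hv hv'
  obtain rfl : y = y' := by omega
  obtain rfl | rfl | rfl : x = x' ∨ x' = x + 1 ∨ x = x' + 1 := by omega
  · rfl
  · exact absurd h1 (isLeftEnd_add_one.1 h1')
  · exact absurd h1' (isLeftEnd_add_one.1 h1)

lemma IsPaired.covers {b : ℤ} {T : Set (ℤ × ℤ)} (hT : IsPaired b T) {F : Finset (Sym2 (ℤ × ℤ))}
    (hF : ∀ e, e ∈ F ↔ e ∈ pairEdges b T) : Covers T F := by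
  intro v
  split_ifs with h
  · obtain ⟨e, he, hv⟩ := hT.exists_pairEdge h
    rw [deg, card_eq_one]
    refine ⟨e, ?_⟩
    ext e'
    rw [mem_filter, mem_singleton, hF]
    constructor
    · rintro ⟨h1, h2⟩
      exact pairEdges_eq_of_mem h1 he h2 hv
    · rintro rfl
      exact ⟨he, hv⟩
  · rw [deg, card_eq_zero, filter_eq_empty_iff]
    intro e he hve
    exact h (hT.mem_of_mem_pairEdge ((hF e).1 he) hve)

/-- A graph whose vertices are paired by horizontal edges has a unique horizontal matching. -/
theorem exists_unique_horizontalMatching {H : LatticeGraph} {b : ℤ} (hfin : H.verts.Finite)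
    (hT : IsPaired b H.verts) (hE : pairEdges b H.verts ⊆ H.edgeSet) :
    ∃ K, (IsHorizontalMatchingOf H K ∧ ∀ K', IsHorizontalMatchingOf H K' → K' = K) ∧
      K.edgeSet = pairEdges b H.verts := by
  have hc : Covers H.verts (finite_pairEdges (b := b) hfin).toFinset := hT.covers (by simp)
  have hE' : ((finite_pairEdges (b := b) hfin).toFinset : Set (Sym2 (ℤ × ℤ))) ⊆ H.edgeSet := by
    simpa using hE
  have hK := isPerfectMatchingOf_ofEdges hE' hc
  refine ⟨_, ⟨⟨hK, ?_⟩, ?_⟩, ?_⟩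
  · intro e he
    rw [mem_edgeSet_ofEdges, Set.Finite.coe_toFinset] at he
    obtain ⟨x, y, -, -, rfl⟩ := he
    exact ⟨x, y, rfl⟩
  · rintro K' ⟨⟨hle, hv, hm⟩, hh⟩
    obtain ⟨M, hM⟩ : ∃ M, ∀ x y, (x, y) ∈ H.verts → x < M := by
      obtain ⟨M, hM⟩ := (hfin.image Prod.fst).bddAbove
      exact ⟨M + 1, fun x y h => Int.lt_add_one_of_le (hM ⟨_, h, rfl⟩)⟩
    -- Pairs are settled from right to left. The right vertex of a pair cannot be matched further
    -- right, since that neighbour starts the next pair, which is already settled.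
    have key : ∀ n : ℕ, ∀ x y, M - n ≤ x → IsLeftEnd b x y → (x, y) ∈ H.verts →
        K'.Adj (x, y) (x + 1, y) := by
      intro n
      induction n with
      | zero =>
        intro x y h _ h'
        have := hM x y h'
        simp only [Nat.cast_zero] at h
        omega
      | succ n ih =>
        intro x y h hl hx
        have h1 := (hT x y hl).1 hx
        obtain ⟨u, hu, -⟩ := hm (hv.symm ▸ h1)
        have : ∃ s t, s((x + 1, y), u) = hEdge s t := hh _ hu
        obtain ⟨s, t, hst⟩ := this
        have hmem : (x + 1, y) ∈ hEdge s t := hst ▸ Sym2.mem_mk_left _ _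
        rw [mem_hEdge] at hmem
        obtain ⟨rfl, h3 | h3⟩ := hmem
        · simp only at h3
          subst h3
          have hu2 : u = (x + 2, y) := by
            have h5 : u = (x + 1 + 1, y) := by simpa only [hEdge, Sym2.congr_right] using hst
            rw [h5, add_assoc]
            rfl
          subst hu2
          have h4 := ih (x + 2) y (by push_cast at h; omega) (isLeftEnd_add_two.2 hl)
            (hv ▸ K'.edge_vert hu.symm)
          have := (hm (K'.edge_vert hu.symm)).unique hu.symm h4
          simp at this
        · simp only at h3
          obtain rfl : s = x := by omega
          have : u = (s, y) := by
            simp only [hEdge] at hst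
            rw [Sym2.eq_swap] at hst
            simpa using hst
          subst this
          exact hu.symm
    symm
    refine SimpleGraph.Subgraph.ext hv.symm ?_
    have hsub : ∀ u v, (ofEdges H _ hE').Adj u v → K'.Adj u v := by
      intro u v huv
      have huv' : s(u, v) ∈ pairEdges b H.verts := (Set.Finite.mem_toFinset _).1 (mem_coe.1 huv)
      obtain ⟨x, y, h1, h2, h3⟩ := huv'
      have h4 := key (M - x).toNat x y (by omega) h1 h2
      rcases Sym2.eq_iff.1 h3 with ⟨rfl, rfl⟩ | ⟨rfl, rfl⟩
      · exact h4
      · exact h4.symm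
    ext u v
    constructor
    · exact hsub u v
    · intro huv
      have hu : u ∈ H.verts := hv ▸ K'.edge_vert huv
      obtain ⟨z, hz, -⟩ := hK.2.2 hu
      rwa [(hm (K'.edge_vert huv)).unique huv (hsub u z hz)]
  · ext e
    rw [mem_edgeSet_ofEdges, Set.Finite.coe_toFinset]

/-! ### Removing forced edges -/

lemma weightSum_of_forced {R : Type*} [CommSemiring R] {B F₀ : Finset (Sym2 (ℤ × ℤ))}
    {S T : Set (ℤ × ℤ)} (hTS : T ⊆ S) (hB : F₀ ⊆ B) (hF₀ : Covers T F₀)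
    (hforced : ∀ F ⊆ B, Covers S F → F₀ ⊆ F) (w : Sym2 (ℤ × ℤ) → R) :
    weightSum B S w = (∏ e ∈ F₀, w e) * weightSum B (S \ T) w := by
  classical
  have hdisj : ∀ F, Covers (S \ T) F → Disjoint F₀ F := by
    intro F hF
    rw [disjoint_left]
    intro e he he'
    obtain ⟨v, hv⟩ := exists_mem_sym2 e
    exact (hF.mem he' hv).2 (hF₀.mem he hv)
  unfold weightSum
  rw [mul_sum]
  symm
  refine sum_nbij' (fun F => F₀ ∪ F) (fun F => F \ F₀) ?_ ?_ ?_ ?_ ?_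
  · intro F hF
    simp only [mem_filter, mem_powerset] at hF ⊢
    refine ⟨union_subset hB hF.1, fun v => ?_⟩
    rw [deg_union (hdisj F hF.2), hF₀ v, hF.2 v]
    by_cases h1 : v ∈ T
    · simp [h1, hTS h1]
    · simp [h1]
  · intro F hF
    simp only [mem_filter, mem_powerset] at hF ⊢
    have hsub := hforced F hF.1 hF.2
    refine ⟨sdiff_subset.trans hF.1, fun v => ?_⟩
    have h1 := deg_union (disjoint_sdiff (s := F₀) (t := F)) v
    rw [union_sdiff_of_subset hsub, hF.2 v, hF₀ v] at h1
    by_cases h2 : v ∈ T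
    · simp [h2, hTS h2] at h1 ⊢
      omega
    · by_cases h3 : v ∈ S <;> simp [h2, h3] at h1 ⊢ <;> omega
  · intro F hF
    simp only [mem_filter, mem_powerset] at hF
    exact union_sdiff_cancel_left (hdisj F hF.2)
  · intro F hF
    simp only [mem_filter, mem_powerset] at hF
    exact union_sdiff_of_subset (hforced F hF.1 hF.2)
  · intro F hF
    simp only [mem_filter, mem_powerset] at hF
    rw [prod_union (hdisj F hF.2)]

/-! ### Matchings of a diamond and of its core -/

lemma weightSum_ite {R : Type*} [CommSemiring R] (B : Finset (Sym2 (ℤ × ℤ))) (S : Set (ℤ × ℤ))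
    (w : Sym2 (ℤ × ℤ) → R) (p : Sym2 (ℤ × ℤ) → Prop) [DecidablePred p] :
    weightSum B S (fun e => if p e then w e else 0) = weightSum {e ∈ B | p e} S w := by
  classical
  unfold weightSum
  simp only [prod_ite_zero]
  rw [← sum_filter, filter_filter]
  congr 1
  ext F
  simp only [mem_filter, mem_powerset, subset_iff]
  exact ⟨fun ⟨h1, h2, h3⟩ => ⟨fun e he => ⟨h1 he, h3 e he⟩, h2⟩,
    fun ⟨h1, h2⟩ => ⟨fun e he => (h1 he).1, h2, fun e he => (h1 he).2⟩⟩

lemma exists_eq_of_mem_edgeSet {G : LatticeGraph} {e : Sym2 (ℤ × ℤ)} (he : e ∈ G.edgeSet) :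
    (∃ x y, e = hEdge x y) ∨ ∃ x y, e = vEdge x y := by
  induction e with
  | _ u v =>
    have h : G.Adj u v := he
    obtain ⟨x, y⟩ := u
    rcases squareLattice_adj_cases h.adj_sub with rfl | rfl | rfl | rfl
    · exact .inl ⟨x, y, rfl⟩
    · exact .inl ⟨x - 1, y, by rw [hEdge, sub_add_cancel, Sym2.eq_swap]⟩
    · exact .inr ⟨x, y, rfl⟩
    · exact .inr ⟨x, y - 1, by rw [vEdge, sub_add_cancel, Sym2.eq_swap]⟩

lemma finite_diamondVerts (a b k : ℤ) : (diamondVerts a b k).Finite := by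
  refine (Set.toFinite (Set.Icc a (a + 2 * k) ×ˢ Set.Icc (b - k) (b + k))).subset ?_
  rintro ⟨x, y⟩ h
  rw [mem_diamondVerts] at h
  simp only [Set.mem_prod, Set.mem_Icc, segStart] at *
  split_ifs at h <;> omega

lemma isPaired_diamondVerts {a b k : ℤ} (hab : Even (a + b)) : IsPaired b (diamondVerts a b k) := by
  intro x y h
  rw [mem_diamondVerts, mem_diamondVerts]
  rw [Int.even_iff] at hab
  simp only [IsLeftEnd, Int.even_iff, Int.odd_iff] at h
  simp only [segStart]
  split_ifs at h ⊢ <;> omega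

/-- The greatest reached abscissa of a row carries an odd vertical edge, so it has the wrong parity
to be a left end; a reached left end is therefore never the last vertex of its row. -/
lemma Reach.of_isLeftEnd {O : Set (ℤ × ℤ)} (hO : ∀ v ∈ O, Odd (v.1 + v.2)) {B b x y : ℤ}
    (h : Reach O B b y x) (hx : IsLeftEnd b x y) : Reach O B b y (x + 1) := by
  rw [IsLeftEnd] at hx
  split_ifs at hx with hy
  · obtain ⟨x', h1, h2, h3⟩ := h.exists_up hy
    have := hO _ h2
    rw [Int.odd_iff] at *
    exact h3.mono (by simp only at this; omega)
  · obtain ⟨x', h1, h2, h3⟩ := h.exists_down (not_lt.1 hy)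
    have := hO _ h2
    rw [Int.odd_iff] at *
    rw [Int.even_iff] at *
    exact h3.mono (by simp only at this; omega)

/-- The left border starts a pair by the parity of the root, and the right border ends one by
`Reach.of_isLeftEnd`. -/
lemma isPaired_coreVerts {O : Set (ℤ × ℤ)} (hO : ∀ v ∈ O, Odd (v.1 + v.2)) {a b k : ℤ}
    (hab : Even (a + b)) : IsPaired b (coreVerts O a b k) := by
  intro x y h
  rw [mem_coreVerts, mem_coreVerts]
  constructor
  · rintro ⟨h1, h2⟩
    exact ⟨by omega, h2.of_isLeftEnd hO h⟩
  · rintro ⟨h1, h2⟩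
    refine ⟨?_, h2.mono (by omega)⟩
    rw [Int.even_iff] at hab
    simp only [IsLeftEnd, Int.even_iff, Int.odd_iff] at h
    simp only [segStart] at *
    split_ifs at h ⊢ <;> omega

/-- The horizontal edges forced in all matchings of `diamond a b k`, outside of the core. -/
def forcedEdges (O : Set (ℤ × ℤ)) (a b k : ℤ) : Set (Sym2 (ℤ × ℤ)) :=
  pairEdges b (diamondVerts a b k \ coreVerts O a b k)

lemma hEdge_mem_forcedEdges {O : Set (ℤ × ℤ)} {a b k x y : ℤ} :
    hEdge x y ∈ forcedEdges O a b k ↔ IsLeftEnd b x y ∧ (x, y) ∈ diamondVerts a b k ∧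
      ¬ Reach O (a + 2 * k - 1) b y x := by
  rw [forcedEdges, hEdge_mem_pairEdges, Set.mem_sdiff, mem_coreVerts]
  constructor
  · rintro ⟨h1, h2, h3⟩
    exact ⟨h1, h2, fun h => h3 ⟨h2.1, h⟩⟩
  · rintro ⟨h1, h2, h3⟩
    exact ⟨h1, h2, fun h => h3 h.2⟩

lemma finite_forcedEdges (O : Set (ℤ × ℤ)) (a b k : ℤ) : (forcedEdges O a b k).Finite :=
  finite_pairEdges (finite_diamondVerts a b k).sdiff

/-- The induction runs from right to left. Let `(x, y)` be an unreached left end. Its partner `(x +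
1, y)` cannot be matched to the right, where the next pair is already forced. Nor can it be matched
vertically: the vertical neighbour is again a left end, and it is either unreached, hence already
forced to the right, or reached in a way that makes `(x + 1, y)` reached; across the base the edge
itself would start a chain. -/
lemma forcedEdges_subset {G : LatticeGraph} {a b k : ℤ} {F : Finset (Sym2 (ℤ × ℤ))}
    (hF : ∀ e ∈ F, e ∈ G.edgeSet) (hab : Even (a + b)) (hc : Covers (diamondVerts a b k) F) :
    ∀ e ∈ forcedEdges (oddVerticals G) a b k, e ∈ F := by
  set O := oddVerticals G with hOdef
  have hO : ∀ v ∈ O, Odd (v.1 + v.2) := fun v hv => hv.1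
  have key : ∀ n : ℕ, ∀ x y, a + 2 * k - n ≤ x → IsLeftEnd b x y → (x, y) ∈ diamondVerts a b k →
      ¬ Reach O (a + 2 * k - 1) b y x → hEdge x y ∈ F := by
    intro n
    induction n with
    | zero =>
      intro x y h _ h'
      rw [mem_diamondVerts] at h'
      simp only [Nat.cast_zero, segStart] at h h'
      split_ifs at h' <;> omega
    | succ n ih =>
      intro x y h hl hx hr
      push_cast at h
      have hx1 := (isPaired_diamondVerts hab x y hl).1 hx
      have hr1 : ¬ Reach O (a + 2 * k - 1) b y (x + 1) := fun h => hr (h.mono (by omega))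
      obtain ⟨e, he, hxe⟩ := hc.exists_mem hx1
      have step : ∀ s t, x < s → IsLeftEnd b s t → ¬ Reach O (a + 2 * k - 1) b t s → (s, t) ∈ e →
          e = hEdge s t := by
        intro s t h1 h2 h3 h4
        exact hc.eq he (ih s t (by omega) h2 (hc.mem he h4) h3) h4 (by simp [mem_hEdge])
      -- In the lower half the upward edge is odd and points to the base, so it extends a chain
      -- reaching its upper end, or starts one at `y = b`. In the upper half it points away from the
      -- base, and a reached upper end would make its lower end reached. In `hdown` the halves
      -- exchange roles.
      have hup : ∀ s t, s = x + 1 → e = vEdge s t → t = y → False := by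
        rintro s t rfl rfl rfl
        rcases le_or_gt t b with hy | hy
        · have hOe : (x + 1, t) ∈ O := by
            refine ⟨?_, hF _ he⟩
            rw [IsLeftEnd, if_neg (not_lt.2 hy), Int.even_iff] at hl
            rw [Int.odd_iff]
            simp only
            omega
          obtain rfl | hy' : t = b ∨ t + 1 ≤ b := by omega
          · refine hr1 (reach_self.2 ⟨x + 1, le_rfl, ?_, hOe⟩)
            have := hx1.2
            simp only [segStart] at this
            split_ifs at this <;> omega
          · have hl' : IsLeftEnd b (x + 1) (t + 1) := by
              simp only [IsLeftEnd, if_neg (not_lt.2 hy), if_neg (not_lt.2 hy'), Int.even_iff] at *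
              omega
            refine vEdge_ne_hEdge _ _ _ _ (step (x + 1) (t + 1) (by omega) hl' ?_
              (by simp [mem_vEdge]))
            intro h3
            have h4 := (reach_down hy').2 ⟨x + 1, le_rfl, by simpa using hOe,
              h3.of_isLeftEnd hO hl'⟩
            rw [add_sub_cancel_right] at h4
            exact hr1 h4
        · have hl' : IsLeftEnd b (x + 1) (t + 1) := by
            simp only [IsLeftEnd, if_pos hy, if_pos (by omega : b < t + 1), Int.odd_iff] at *
            omega
          refine vEdge_ne_hEdge _ _ _ _ (step (x + 1) (t + 1) (by omega) hl' ?_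
            (by simp [mem_vEdge]))
          intro h3
          have := h3.sub_one (by omega)
          rw [add_sub_cancel_right] at this
          exact hr1 this
      have hdown : ∀ s t, s = x + 1 → e = vEdge s t → t + 1 = y → False := by
        rintro s t rfl rfl rfl
        rcases le_or_gt (t + 1) b with hy | hy
        · have hl' : IsLeftEnd b (x + 1) t := by
            simp only [IsLeftEnd, if_neg (not_lt.2 hy), if_neg (by omega : ¬ b < t),
              Int.even_iff] at *
            omega
          refine vEdge_ne_hEdge _ _ _ _ (step (x + 1) t (by omega) hl' ?_ (by simp [mem_vEdge]))
          exact fun h3 => hr1 (h3.add_one (by omega))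
        · have hOe : (x + 1, t) ∈ O := by
            refine ⟨?_, hF _ he⟩
            rw [IsLeftEnd, if_pos hy, Int.odd_iff] at hl
            rw [Int.odd_iff]
            simp only
            omega
          obtain rfl | hy' : t = b ∨ b < t := by omega
          · refine hr1 (reach_add_one.2 ⟨x + 1, le_rfl, ?_, hOe⟩)
            have := hx1.2
            simp only [segStart] at this
            split_ifs at this <;> omega
          · have hl' : IsLeftEnd b (x + 1) t := by
              simp only [IsLeftEnd, if_pos hy, if_pos hy', Int.odd_iff] at *
              omega
            refine vEdge_ne_hEdge _ _ _ _ (step (x + 1) t (by omega) hl' ?_ (by simp [mem_vEdge]))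
            intro h3
            exact hr1 ((reach_up hy').2 ⟨x + 1, le_rfl, hOe, h3.of_isLeftEnd hO hl'⟩)
      rcases exists_eq_of_mem_edgeSet (hF e he) with ⟨s, t, hst⟩ | ⟨s, t, hst⟩
      · rw [hst, mem_hEdge] at hxe
        obtain ⟨h1, h2⟩ := hxe
        simp only at h1 h2
        subst h1
        rcases h2 with h2 | h2
        · subst h2
          have := step (x + 2) y (by omega) (isLeftEnd_add_two.2 hl)
            (fun h => hr1 (h.mono (by omega))) (by rw [hst, mem_hEdge]; simp; omega)
          rw [hst, hEdge_inj] at this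
          omega
        · obtain rfl : s = x := by omega
          exact hst ▸ he
      · have hm := hxe
        rw [hst, mem_vEdge] at hm
        rcases hm.2 with h2 | h2
        · exact (hup s t hm.1.symm hst h2.symm).elim
        · exact (hdown s t hm.1.symm hst h2.symm).elim
  rintro e ⟨x, y, h1, ⟨h2, h3⟩, rfl⟩
  exact key (a + 2 * k - x).toNat x y (by omega) h1 h2 fun h => h3 ⟨h2.1, h⟩

lemma finite_edges_prod {E : Set (Sym2 (ℤ × ℤ))} (hE : E.Finite) :
    edgeProd E = ∏ e ∈ hE.toFinset, MvPolynomial.X e :=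
  finprod_mem_eq_finite_toFinset_prod _ hE

open scoped Classical in
/-- The weight of the edges of `G` is their indeterminate, that of the other edges is zero. -/
def graphWeight (G : LatticeGraph) (e : Sym2 (ℤ × ℤ)) : MvPolynomial (Sym2 (ℤ × ℤ)) ℤ :=
  if e ∈ G.edgeSet then .X e else 0

/-- The matchings of the part of `G` in a diamond are those of its core, completed by forced
horizontal edges. -/
theorem diamondSum_graphWeight {G : LatticeGraph} {a b k : ℤ} (hG : IsFullOn G a b k)
    (hab : Even (a + b)) : diamondSum a b k (graphWeight G) =
      edgeProd (forcedEdges (oddVerticals G) a b k) *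
        matchingPoly (core a b (G ⊓ diamond a b k)) := by
  classical
  set O := oddVerticals G
  have hO : ∀ v ∈ O, Odd (v.1 + v.2) := fun v hv => hv.1
  have hsub := coreVerts_subset O a b k
  have hB : ∀ e, (∀ v ∈ e, v ∈ diamondVerts a b k) →
      (e ∈ {e ∈ diamondEdges a b k | e ∈ G.edgeSet} ↔ e ∈ G.edgeSet) := by
    intro e he
    rw [mem_filter, and_iff_right_iff_imp]
    intro h
    rcases exists_eq_of_mem_edgeSet h with ⟨x, y, rfl⟩ | ⟨x, y, rfl⟩
    · rw [hEdge_mem_diamondEdges]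
      exact ⟨he _ (by simp [mem_hEdge]), he _ (by simp [mem_hEdge])⟩
    · rw [vEdge_mem_diamondEdges]
      exact ⟨he _ (by simp [mem_vEdge]), he _ (by simp [mem_vEdge])⟩
  have hpair := (isPaired_diamondVerts (k := k) hab).diff (isPaired_coreVerts (k := k) hO hab)
  unfold diamondSum graphWeight
  -- Zero weights discard the edges absent from `G`; the forced edges then factor out, and exactly
  -- the vertices of the core remain.
  rw [weightSum_ite, weightSum_of_forced (F₀ := (finite_forcedEdges O a b k).toFinset)
    (T := diamondVerts a b k \ coreVerts O a b k) Set.sdiff_subset]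
  · rw [finite_edges_prod (finite_forcedEdges O a b k), core_inf_diamond hG hab,
      matchingPoly_eq_weightSum (B := {e ∈ diamondEdges a b k | e ∈ G.edgeSet}),
      Set.sdiff_sdiff_cancel_left hsub]
    · rfl
    · intro e he
      rw [hB e fun v hv => hsub (he v hv)]
      induction e with
      | _ u v => exact ⟨fun h => ⟨he u (by simp), he v (by simp), h⟩, fun h => h.2.2⟩
  · intro e he
    rw [Set.Finite.mem_toFinset] at he
    rw [hB e fun v hv => (hpair.mem_of_mem_pairEdge he hv).1]
    obtain ⟨x, y, h1, h2, rfl⟩ := he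
    exact hG.horizontal _ _ h2.1 ((hpair x y h1).1 h2).1
  · exact hpair.covers (by simp [forcedEdges])
  · intro F hF hc e he
    rw [Set.Finite.mem_toFinset] at he
    exact forcedEdges_subset (fun e he => (mem_filter.1 (hF he)).2) hab hc e he

/-! ### Parts of a core and horizontal factors -/

section

variable {G : LatticeGraph} {a b k : ℤ}

lemma induce_coreVerts_adj_right (hG : IsFullOn G a b k) {O : Set (ℤ × ℤ)} {x y : ℤ} :
    (G.induce (coreVerts O a b k)).Adj (x, y) (x + 1, y) ↔
      (x, y) ∈ coreVerts O a b k ∧ (x + 1, y) ∈ coreVerts O a b k :=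
  ⟨fun h => ⟨h.1, h.2.1⟩, fun h => ⟨h.1, h.2,
    hG.horizontal _ _ (coreVerts_subset _ _ _ _ h.1) (coreVerts_subset _ _ _ _ h.2)⟩⟩

lemma hEdge_mem_induce_coreVerts (hG : IsFullOn G a b k) {O : Set (ℤ × ℤ)} {x y : ℤ} :
    hEdge x y ∈ (G.induce (coreVerts O a b k)).edgeSet ↔
      (x, y) ∈ coreVerts O a b k ∧ (x + 1, y) ∈ coreVerts O a b k :=
  induce_coreVerts_adj_right hG

lemma IsPaired.exists_pair {T : Set (ℤ × ℤ)} (hT : IsPaired b T) {x y : ℤ} (h : (x, y) ∈ T) :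
    ∃ z, (x = z ∨ x = z + 1) ∧ (z, y) ∈ T ∧ (z + 1, y) ∈ T := by
  by_cases hl : IsLeftEnd b x y
  · exact ⟨x, .inl rfl, h, (hT x y hl).1 h⟩
  · have h' : IsLeftEnd b (x - 1) y := by
      by_contra h'
      rw [← isLeftEnd_add_one, sub_add_cancel] at h'
      exact hl h'
    exact ⟨x - 1, .inr (by ring), (hT _ _ h').2 (by simpa using h), by simpa using h⟩

variable (hG : IsFullOn G a b k) {O : Set (ℤ × ℤ)}

include hG

lemma mem_cellGraph_of_upper {Rw : Set ℤ} {z y : ℤ} (hy : b < y) (hr : y - 1 ∈ Rw)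
    (h : (z, y) ∈ coreVerts O a b k) (h' : (z + 1, y) ∈ coreVerts O a b k) :
    (z, y - 1) ∈ {c : ℤ × ℤ | hEdge c.1 c.2 ∈ (G.induce (coreVerts O a b k)).edgeSet ∧
      hEdge c.1 (c.2 + 1) ∈ (G.induce (coreVerts O a b k)).edgeSet ∧ c.2 ∈ Rw} := by
  refine ⟨(hEdge_mem_induce_coreVerts hG).2 ⟨coreVerts_sub_one h hy, coreVerts_sub_one h' hy⟩, ?_, hr⟩
  rw [sub_add_cancel]
  exact (hEdge_mem_induce_coreVerts hG).2 ⟨h, h'⟩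

lemma mem_cellGraph_of_lower {Rw : Set ℤ} {z y : ℤ} (hy : y ≤ b) (hr : y ∈ Rw)
    (h : (z, y) ∈ coreVerts O a b k) (h' : (z + 1, y) ∈ coreVerts O a b k) :
    (z, y) ∈ {c : ℤ × ℤ | hEdge c.1 c.2 ∈ (G.induce (coreVerts O a b k)).edgeSet ∧
      hEdge c.1 (c.2 + 1) ∈ (G.induce (coreVerts O a b k)).edgeSet ∧ c.2 ∈ Rw} :=
  ⟨(hEdge_mem_induce_coreVerts hG).2 ⟨h, h'⟩,
    (hEdge_mem_induce_coreVerts hG).2 ⟨coreVerts_add_one h hy, coreVerts_add_one h' hy⟩, hr⟩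

section

variable (hab : Even (a + b)) (hO : ∀ v ∈ O, Odd (v.1 + v.2))

include hab hO

/-- Above the base the segments shrink, so a cell is present as soon as its top side is. On the
lowest ordinate `r` of the part, only the vertices lying under a vertex of ordinate `r + 1` survive.
-/
lemma mem_rowsPart_upper {r : ℤ} (hr : b ≤ r) {x y : ℤ} :
    (x, y) ∈ (rowsPart (G.induce (coreVerts O a b k)) (Set.Ici r)).verts ↔
      (r < y ∧ (x, y) ∈ coreVerts O a b k) ∨ (y = r ∧ (x, r + 1) ∈ coreVerts O a b k) := by
  constructor
  · rintro ⟨h1, ⟨s, t⟩, ⟨h2, h3, h4⟩, h5⟩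
    have h1 : (x, y) ∈ coreVerts O a b k := h1
    rw [hEdge_mem_induce_coreVerts hG] at h3
    simp only [corners, Set.mem_insert_iff, Set.mem_singleton_iff, Prod.mk.injEq, Set.mem_Ici]
      at h5 h4 h3
    by_cases hy : r < y
    · exact .inl ⟨hy, h1⟩
    · obtain rfl : t = r := by omega
      refine .inr ⟨by omega, ?_⟩
      obtain rfl | rfl : x = s ∨ x = s + 1 := by omega
      exacts [h3.1, h3.2]
  · rintro (⟨h1, h2⟩ | ⟨rfl, h2⟩)
    · refine ⟨h2, ?_⟩
      obtain ⟨z, hz, h3, h4⟩ := (isPaired_coreVerts hO hab).exists_pair h2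
      refine ⟨_, mem_cellGraph_of_upper hG (by omega) (show r ≤ y - 1 by omega) h3 h4, ?_⟩
      simp only [corners, Set.mem_insert_iff, Set.mem_singleton_iff, Prod.mk.injEq]
      omega
    · refine ⟨by simpa using coreVerts_sub_one h2 (by omega), ?_⟩
      obtain ⟨z, hz, h3, h4⟩ := (isPaired_coreVerts hO hab).exists_pair h2
      refine ⟨_, mem_cellGraph_of_upper hG (by omega) (show y ≤ y + 1 - 1 by omega) h3 h4, ?_⟩
      simp only [corners, Set.mem_insert_iff, Set.mem_singleton_iff, Prod.mk.injEq]
      omega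

lemma mem_rowsPart_lower {r : ℤ} (hr : r ≤ b) {x y : ℤ} :
    (x, y) ∈ (rowsPart (G.induce (coreVerts O a b k)) (Set.Iic r)).verts ↔
      (y ≤ r ∧ (x, y) ∈ coreVerts O a b k) ∨ (y = r + 1 ∧ (x, r) ∈ coreVerts O a b k) := by
  constructor
  · rintro ⟨h1, ⟨s, t⟩, ⟨h2, h3, h4⟩, h5⟩
    have h1 : (x, y) ∈ coreVerts O a b k := h1
    rw [hEdge_mem_induce_coreVerts hG] at h2
    simp only [corners, Set.mem_insert_iff, Set.mem_singleton_iff, Prod.mk.injEq, Set.mem_Iic]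
      at h5 h4 h2
    by_cases hy : y ≤ r
    · exact .inl ⟨hy, h1⟩
    · obtain rfl : t = r := by omega
      refine .inr ⟨by omega, ?_⟩
      obtain rfl | rfl : x = s ∨ x = s + 1 := by omega
      exacts [h2.1, h2.2]
  · rintro (⟨h1, h2⟩ | ⟨rfl, h2⟩)
    · refine ⟨h2, ?_⟩
      obtain ⟨z, hz, h3, h4⟩ := (isPaired_coreVerts hO hab).exists_pair h2
      refine ⟨_, mem_cellGraph_of_lower hG (by omega) (show y ≤ r from h1) h3 h4, ?_⟩
      rcases hz with rfl | rfl <;> simp [corners]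
    · refine ⟨coreVerts_add_one h2 hr, ?_⟩
      obtain ⟨z, hz, h3, h4⟩ := (isPaired_coreVerts hO hab).exists_pair h2
      refine ⟨_, mem_cellGraph_of_lower hG hr (show r ≤ r from le_rfl) h3 h4, ?_⟩
      rcases hz with rfl | rfl <;> simp [corners]

lemma rowsPart_upper_adj {x y : ℤ}
    (h : (x, y) ∈ (rowsPart (G.induce (coreVerts O a b k)) (Set.Ici b)).verts)
    (h' : (x + 1, y) ∈ (rowsPart (G.induce (coreVerts O a b k)) (Set.Ici b)).verts) :
    (rowsPart (G.induce (coreVerts O a b k)) (Set.Ici b)).Adj (x, y) (x + 1, y) := by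
  refine ⟨(induce_coreVerts_adj_right hG).2 ⟨h.1, h'.1⟩, squareLattice_adj_right x y, ?_⟩
  rw [mem_rowsPart_upper hG hab hO le_rfl] at h h'
  by_cases hy : b < y
  · refine ⟨_, mem_cellGraph_of_upper hG hy (show b ≤ y - 1 by omega)
      (h.resolve_right (by omega)).2 (h'.resolve_right (by omega)).2, ?_⟩
    simp [corners]
  · have h1 := h.resolve_left fun h => hy h.1
    refine ⟨_, mem_cellGraph_of_upper hG (y := b + 1) (by omega) (show b ≤ b + 1 - 1 by omega)
      h1.2 (h'.resolve_left fun h => hy h.1).2, ?_⟩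
    simp [corners, h1.1]

lemma rowsPart_lower_adj {x y : ℤ}
    (h : (x, y) ∈ (rowsPart (G.induce (coreVerts O a b k)) (Set.Iic b)).verts)
    (h' : (x + 1, y) ∈ (rowsPart (G.induce (coreVerts O a b k)) (Set.Iic b)).verts) :
    (rowsPart (G.induce (coreVerts O a b k)) (Set.Iic b)).Adj (x, y) (x + 1, y) := by
  refine ⟨(induce_coreVerts_adj_right hG).2 ⟨h.1, h'.1⟩, squareLattice_adj_right x y, ?_⟩
  rw [mem_rowsPart_lower hG hab hO le_rfl] at h h'
  by_cases hy : y ≤ b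
  · refine ⟨_, mem_cellGraph_of_lower hG hy (show y ≤ b from hy)
      (h.resolve_right (by omega)).2 (h'.resolve_right (by omega)).2, ?_⟩
    simp [corners]
  · have h1 := h.resolve_left fun h => hy h.1
    refine ⟨_, mem_cellGraph_of_lower hG (y := b) le_rfl (show b ≤ b from le_rfl)
      h1.2 (h'.resolve_left fun h => hy h.1).2, ?_⟩
    simp [corners, h1.1]

end

end

section

variable {G : LatticeGraph} {a b k : ℤ} {O : Set (ℤ × ℤ)} (hO : ∀ v ∈ O, Odd (v.1 + v.2))
  (hab : Even (a + b)) (hC : IsFullOn G (a + 2) b (k - 2))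

include hO hab hC

/-- The horizontal matching of `P^C_≤ ∖ P^N_<`. -/
lemma exists_unique_lowerMatching (hN : IsFullOn G (a + 1) (b + 1) (k - 1)) :
    ∃ K, (IsHorizontalMatchingOf (graphDiff
        (rowsPart (G.induce (coreVerts O (a + 2) b (k - 2))) (Set.Iic b))
        (rowsPart (G.induce (coreVerts O (a + 1) (b + 1) (k - 1))) (Set.Iio (b + 1)))) K ∧
      ∀ K', IsHorizontalMatchingOf (graphDiff
        (rowsPart (G.induce (coreVerts O (a + 2) b (k - 2))) (Set.Iic b))
        (rowsPart (G.induce (coreVerts O (a + 1) (b + 1) (k - 1))) (Set.Iio (b + 1)))) K' →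
        K' = K) ∧
      ∀ x y, hEdge x y ∈ edgesAt K b (Set.Iic 0) ↔ y ≤ b ∧ IsLeftEnd b x y ∧
        (x, y) ∈ coreVerts O (a + 2) b (k - 2) ∧
        (x, y) ∉ coreVerts O (a + 1) (b + 1) (k - 1) := by
  have hab2 : Even (a + 2 + b) := by rw [Int.even_iff] at *; omega
  have hab1 : Even (a + 1 + (b + 1)) := by rw [Int.even_iff] at *; omega
  have hIio : Set.Iio (b + 1) = Set.Iic b := by ext; simp
  rw [hIio]
  set H := graphDiff (rowsPart (G.induce (coreVerts O (a + 2) b (k - 2))) (Set.Iic b))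
    (rowsPart (G.induce (coreVerts O (a + 1) (b + 1) (k - 1))) (Set.Iic b)) with hH
  -- The vertices at ordinate `b + 1` are a vertical copy of those at ordinate `b`. The parity rule
  -- for left ends also flips there, so the copy is paired in the same way; its edges are not
  -- counted by `edgesAt`.
  have hv : ∀ x y, (x, y) ∈ H.verts ↔
      (y ≤ b ∧ (x, y) ∈ coreVerts O (a + 2) b (k - 2) ∧
        (x, y) ∉ coreVerts O (a + 1) (b + 1) (k - 1)) ∨
      (y = b + 1 ∧ (x, b) ∈ coreVerts O (a + 2) b (k - 2) ∧
        (x, b) ∉ coreVerts O (a + 1) (b + 1) (k - 1)) := by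
    intro x y
    have h1 := mem_rowsPart_lower hC hab2 hO le_rfl (x := x) (y := y)
    have h2 := mem_rowsPart_lower hN hab1 hO (r := b) (by omega) (x := x) (y := y)
    rw [hH, graphDiff, SimpleGraph.Subgraph.deleteVerts_verts, Set.mem_sdiff, h1, h2]
    by_cases hy : y ≤ b
    · have : y ≠ b + 1 := by omega
      tauto
    · by_cases hy' : y = b + 1
      · subst hy'
        tauto
      · tauto
  have hpC := isPaired_coreVerts (k := k - 2) hO hab2
  have hpN := isPaired_coreVerts (k := k - 1) hO hab1
  have hpaired : IsPaired b H.verts := by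
    intro x y hl
    rw [hv, hv]
    have key : ∀ t, t ≤ b → Even (x + t) →
        ((x, t) ∈ coreVerts O (a + 2) b (k - 2) ↔ (x + 1, t) ∈ coreVerts O (a + 2) b (k - 2)) ∧
        ((x, t) ∈ coreVerts O (a + 1) (b + 1) (k - 1) ↔
          (x + 1, t) ∈ coreVerts O (a + 1) (b + 1) (k - 1)) := by
      intro t ht he
      exact ⟨hpC x t (by rwa [IsLeftEnd, if_neg (by omega)]),
        hpN x t (by rwa [IsLeftEnd, if_neg (by omega)])⟩
    by_cases hy : y ≤ b
    · rw [IsLeftEnd, if_neg (not_lt.2 hy)] at hl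
      have := key y hy hl
      have h' : y ≠ b + 1 := by omega
      tauto
    · by_cases hy' : y = b + 1
      · subst hy'
        rw [IsLeftEnd, if_pos (by omega), Int.odd_iff] at hl
        have := key b le_rfl (by rw [Int.even_iff]; omega)
        tauto
      · tauto
  have hfin : H.verts.Finite :=
    (finite_diamondVerts (a + 2) b (k - 2)).subset fun v hv => coreVerts_subset _ _ _ _ hv.1.1
  have hE : pairEdges b H.verts ⊆ H.edgeSet := by
    rintro e ⟨x, y, h1, h2, rfl⟩
    have h3 := (hpaired x y h1).1 h2
    have : H.Adj (x, y) (x + 1, y) := by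
      rw [hH, graphDiff, SimpleGraph.Subgraph.deleteVerts_adj]
      exact ⟨h2.1, h2.2, h3.1, h3.2, rowsPart_lower_adj hC hab2 hO h2.1 h3.1⟩
    exact this
  obtain ⟨K, hK, hKE⟩ := exists_unique_horizontalMatching hfin hpaired hE
  refine ⟨K, hK, fun x y => ?_⟩
  simp only [edgesAt, hKE, Set.mem_ofPred_eq, hEdge_mem_pairEdges, hv, hEdge_inj, Set.mem_Iic]
  constructor
  · rintro ⟨⟨h1, h2⟩, x', m, hm, rfl, rfl⟩
    have hy : b + m ≤ b := by omega
    have := h2.resolve_right (by omega)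
    tauto
  · rintro ⟨h1, h2, h3⟩
    exact ⟨⟨h2, .inl ⟨h1, h3⟩⟩, x, y - b, by omega, rfl, by ring⟩

/-- The horizontal matching of `P^C_≥ ∖ P^S_>`. -/
lemma exists_unique_upperMatching (hS : IsFullOn G (a + 1) (b - 1) (k - 1)) :
    ∃ K, (IsHorizontalMatchingOf (graphDiff
        (rowsPart (G.induce (coreVerts O (a + 2) b (k - 2))) (Set.Ici b))
        (rowsPart (G.induce (coreVerts O (a + 1) (b - 1) (k - 1))) (Set.Ioi (b - 1)))) K ∧
      ∀ K', IsHorizontalMatchingOf (graphDiff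
        (rowsPart (G.induce (coreVerts O (a + 2) b (k - 2))) (Set.Ici b))
        (rowsPart (G.induce (coreVerts O (a + 1) (b - 1) (k - 1))) (Set.Ioi (b - 1)))) K' →
        K' = K) ∧
      ∀ x y, hEdge x y ∈ edgesAt K b (Set.Ioi 0) ↔ b < y ∧ IsLeftEnd b x y ∧
        (x, y) ∈ coreVerts O (a + 2) b (k - 2) ∧
        (x, y) ∉ coreVerts O (a + 1) (b - 1) (k - 1) := by
  have hab2 : Even (a + 2 + b) := by rw [Int.even_iff] at *; omega
  have hab1 : Even (a + 1 + (b - 1)) := by rw [Int.even_iff] at *; omega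
  have hIoi : Set.Ioi (b - 1) = Set.Ici b := by ext; simp
  rw [hIoi]
  set H := graphDiff (rowsPart (G.induce (coreVerts O (a + 2) b (k - 2))) (Set.Ici b))
    (rowsPart (G.induce (coreVerts O (a + 1) (b - 1) (k - 1))) (Set.Ici b)) with hH
  have hv : ∀ x y, (x, y) ∈ H.verts ↔
      (b < y ∧ (x, y) ∈ coreVerts O (a + 2) b (k - 2) ∧
        (x, y) ∉ coreVerts O (a + 1) (b - 1) (k - 1)) ∨
      (y = b ∧ (x, b + 1) ∈ coreVerts O (a + 2) b (k - 2) ∧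
        (x, b + 1) ∉ coreVerts O (a + 1) (b - 1) (k - 1)) := by
    intro x y
    have h1 := mem_rowsPart_upper hC hab2 hO le_rfl (x := x) (y := y)
    have h2 := mem_rowsPart_upper hS hab1 hO (r := b) (by omega) (x := x) (y := y)
    rw [hH, graphDiff, SimpleGraph.Subgraph.deleteVerts_verts, Set.mem_sdiff, h1, h2]
    by_cases hy : b < y
    · have : y ≠ b := by omega
      tauto
    · by_cases hy' : y = b
      · subst hy'
        tauto
      · tauto
  have hpC := isPaired_coreVerts (k := k - 2) hO hab2
  have hpS := isPaired_coreVerts (k := k - 1) hO hab1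
  have hpaired : IsPaired b H.verts := by
    intro x y hl
    rw [hv, hv]
    have key : ∀ t, b < t → Odd (x + t) →
        ((x, t) ∈ coreVerts O (a + 2) b (k - 2) ↔ (x + 1, t) ∈ coreVerts O (a + 2) b (k - 2)) ∧
        ((x, t) ∈ coreVerts O (a + 1) (b - 1) (k - 1) ↔
          (x + 1, t) ∈ coreVerts O (a + 1) (b - 1) (k - 1)) := by
      intro t ht he
      exact ⟨hpC x t (by rwa [IsLeftEnd, if_pos (by omega)]),
        hpS x t (by rwa [IsLeftEnd, if_pos (by omega)])⟩
    by_cases hy : b < y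
    · rw [IsLeftEnd, if_pos hy] at hl
      have := key y hy hl
      have h' : y ≠ b := by omega
      tauto
    · by_cases hy' : y = b
      · subst hy'
        rw [IsLeftEnd, if_neg (by omega), Int.even_iff] at hl
        have := key (y + 1) (by omega) (by rw [Int.odd_iff]; omega)
        tauto
      · tauto
  have hfin : H.verts.Finite :=
    (finite_diamondVerts (a + 2) b (k - 2)).subset fun v hv => coreVerts_subset _ _ _ _ hv.1.1
  have hE : pairEdges b H.verts ⊆ H.edgeSet := by
    rintro e ⟨x, y, h1, h2, rfl⟩
    have h3 := (hpaired x y h1).1 h2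
    have : H.Adj (x, y) (x + 1, y) := by
      rw [hH, graphDiff, SimpleGraph.Subgraph.deleteVerts_adj]
      exact ⟨h2.1, h2.2, h3.1, h3.2, rowsPart_upper_adj hC hab2 hO h2.1 h3.1⟩
    exact this
  obtain ⟨K, hK, hKE⟩ := exists_unique_horizontalMatching hfin hpaired hE
  refine ⟨K, hK, fun x y => ?_⟩
  simp only [edgesAt, hKE, Set.mem_ofPred_eq, hEdge_mem_pairEdges, hv, hEdge_inj, Set.mem_Ioi]
  constructor
  · rintro ⟨⟨h1, h2⟩, x', m, hm, rfl, rfl⟩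
    have hy : b < b + m := by omega
    have := h2.resolve_right (by omega)
    tauto
  · rintro ⟨h1, h2, h3⟩
    exact ⟨⟨h2, .inl ⟨h1, h3⟩⟩, x, y - b, by omega, rfl, by ring⟩

end

/-! ### Comparison of monomials -/

section

open scoped Classical in
lemma prod_map_edgeProd_eq (U : Finset (Sym2 (ℤ × ℤ))) (l : List (Set (Sym2 (ℤ × ℤ))))
    (hl : ∀ s ∈ l, s ⊆ U) : (l.map edgeProd).prod =
      ∏ e ∈ U, MvPolynomial.X e ^ (l.map fun s => if e ∈ s then 1 else 0).sum := by
  induction l with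
  | nil => simp
  | cons s l ih =>
    have hs : s ⊆ U := hl s (by simp)
    have hfin : s.Finite := U.finite_toSet.subset hs
    simp only [List.map_cons, List.prod_cons, List.sum_cons, pow_add, prod_mul_distrib]
    rw [ih fun s hs => hl s (by simp [hs]), finite_edges_prod hfin]
    congr 1
    refine (prod_congr rfl fun e he => ?_).trans (prod_subset (s₁ := hfin.toFinset) ?_ ?_)
    · simp [(Set.Finite.mem_toFinset hfin).1 he]
    · simpa using hs
    · intro e _ he
      rw [Set.Finite.mem_toFinset] at he
      simp [he]

-- Products of monomials are equal when every edge has the same total exponent on both sides, which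
-- reduces the comparison to counting memberships.
open scoped Classical in
lemma prod_map_edgeProd_congr {l l' : List (Set (Sym2 (ℤ × ℤ)))} (hl : ∀ s ∈ l, s.Finite)
    (hl' : ∀ s ∈ l', s.Finite)
    (h : ∀ e, (l.map fun s => if e ∈ s then 1 else 0).sum =
      (l'.map fun s => if e ∈ s then 1 else 0).sum) :
    (l.map edgeProd).prod = (l'.map edgeProd).prod := by
  have hU : (⋃ s ∈ {s | s ∈ l ∨ s ∈ l'}, s).Finite := by
    refine Set.Finite.biUnion ((List.finite_toSet (l ++ l')).subset ?_) ?_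
    · intro s hs
      simpa using hs
    · rintro s (hs | hs)
      exacts [hl s hs, hl' s hs]
  rw [prod_map_edgeProd_eq hU.toFinset, prod_map_edgeProd_eq hU.toFinset]
  · exact prod_congr rfl fun e _ => by rw [h e]
  · intro s hs
    rw [Set.Finite.coe_toFinset]
    exact Set.subset_biUnion_of_mem (u := id) (show s ∈ {s | s ∈ l ∨ s ∈ l'} from .inr hs)
  · intro s hs
    rw [Set.Finite.coe_toFinset]
    exact Set.subset_biUnion_of_mem (u := id) (show s ∈ {s | s ∈ l ∨ s ∈ l'} from .inl hs)

lemma edgeProd_singleton (e : Sym2 (ℤ × ℤ)) : edgeProd {e} = MvPolynomial.X e := by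
  simp [edgeProd]

lemma edgeProd_ne_zero {E : Set (Sym2 (ℤ × ℤ))} (hE : E.Finite) : edgeProd E ≠ 0 := by
  rw [finite_edges_prod hE]
  exact prod_ne_zero_iff.2 fun e _ => MvPolynomial.X_ne_zero e

end

/-! ### Comparison of chains -/

section

variable {O : Set (ℤ × ℤ)} {B b x y : ℤ}

lemma Reach.mono_bound {B' : ℤ} (h : Reach O B b y x) (hB : B ≤ B') : Reach O B' b y x := by
  refine vertical_induction (p := fun y => ∀ x, Reach O B b y x → Reach O B' b y x) b
    ?_ ?_ ?_ ?_ y x h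
  · intro x
    rw [reach_self, reach_self]
    exact fun ⟨z, h1, h2, h3⟩ => ⟨z, h1, h2.trans hB, h3⟩
  · intro x
    rw [reach_add_one, reach_add_one]
    exact fun ⟨z, h1, h2, h3⟩ => ⟨z, h1, h2.trans hB, h3⟩
  · intro y hy ih x
    rw [reach_up hy, reach_up hy]
    exact fun ⟨z, h1, h2, h3⟩ => ⟨z, h1, h2, ih _ h3⟩
  · intro y hy ih x
    rw [reach_down hy, reach_down hy]
    exact fun ⟨z, h1, h2, h3⟩ => ⟨z, h1, h2, ih _ h3⟩

/-- The edge at `(B, b)` is as far east as a first edge can be, so it can precede any continuation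
starting strictly to the left of `B`. The first step is then no restriction and can be omitted. -/
lemma reach_north_iff (hB : (B, b) ∈ O) (hy : b + 1 < y) :
    Reach O (B - 1) (b + 1) y x ↔ Reach O B b y x := by
  have key : ∀ y, b + 2 ≤ y → ∀ x, Reach O (B - 1) (b + 1) y x ↔ Reach O B b y x := by
    refine Int.leInduction ?_ ?_
    · intro x
      rw [show b + 2 = b + 1 + 1 by ring, reach_add_one, reach_up (by omega)]
      simp only [reach_add_one]
      constructor
      · rintro ⟨z, h1, h2, h3⟩
        exact ⟨z, h1, h3, B, by omega, le_rfl, hB⟩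
      · rintro ⟨z, h1, h2, z', h3, h4, -⟩
        exact ⟨z, h1, by omega, h2⟩
    · intro y hy ih x
      rw [reach_up (by omega), reach_up (by omega)]
      simp only [ih]
  exact key y (by omega) x

lemma reach_south_iff (hB : (B, b) ∈ O) (hy : y < b) :
    Reach O (B - 1) (b - 1) y x ↔ Reach O B b y x := by
  have key : ∀ y, y ≤ b - 1 → ∀ x, Reach O (B - 1) (b - 1) y x ↔ Reach O B b y x := by
    refine Int.leInductionDown ?_ ?_
    · intro x
      rw [reach_self, reach_down le_rfl]
      simp only [reach_self]
      constructor
      · rintro ⟨z, h1, h2, h3⟩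
        exact ⟨z, h1, h3, B, by omega, le_rfl, hB⟩
      · rintro ⟨z, h1, h2, z', h3, h4, -⟩
        exact ⟨z, h1, by omega, h2⟩
    · intro y hy ih x
      rw [reach_down (by omega), reach_down (by omega)]
      simp only [ih]
  exact key y (by omega) x

/-- Below its base `b + 1`, a chain has its next edge at ordinate `b`, at least one unit further
left, hence at abscissa at most `B`. Without its first edge it is a chain with base `b` and bound
`B`. -/
lemma reach_of_north (h : Reach O (B + 1) (b + 1) y x) (hy : y ≤ b) : Reach O B b y x := by
  have key : ∀ y, y ≤ b → ∀ x, Reach O (B + 1) (b + 1) y x → Reach O B b y x := by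
    refine Int.leInductionDown ?_ ?_
    · intro x h
      rw [show b = b + 1 - 1 by ring] at h
      rw [sub_add_cancel, reach_down le_rfl] at h
      obtain ⟨z, h1, h2, h3⟩ := h
      have := h3.le
      simp only [segStart, sub_self] at this
      norm_num at this
      exact reach_self.2 ⟨z, h1, by omega, by simpa using h2⟩
    · intro y hy ih x
      rw [reach_down (by omega), reach_down (by omega)]
      exact fun ⟨z, h1, h2, h3⟩ => ⟨z, h1, h2, ih _ h3⟩
  exact key y hy x h

lemma reach_of_south (h : Reach O (B + 1) (b - 1) y x) (hy : b < y) : Reach O B b y x := by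
  have key : ∀ y, b + 1 ≤ y → ∀ x, Reach O (B + 1) (b - 1) y x → Reach O B b y x := by
    refine Int.leInduction ?_ ?_
    · intro x h
      rw [reach_up (by omega)] at h
      obtain ⟨z, h1, h2, h3⟩ := h
      have := h3.le
      simp only [segStart] at this
      norm_num at this
      exact reach_add_one.2 ⟨z, h1, by omega, h2⟩
    · intro y hy ih x
      rw [reach_up (by omega), reach_up (by omega)]
      exact fun ⟨z, h1, h2, h3⟩ => ⟨z, h1, h2, ih _ h3⟩
  exact key y hy x h

end

/-! ### The completion of a pinecone -/

section

variable {a b k : ℤ} {P : LatticeGraph} (hP : IsClosedPinecone a b k P)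

lemma isFullOn_completion (a b k : ℤ) (P : LatticeGraph) : IsFullOn (completion a b k P) a b k :=
  ⟨fun x y h h' => .inr ⟨diamond_adj_right.2 ⟨h, h'⟩, .inl ⟨x, y, rfl⟩⟩,
    fun x y h h' he => .inr ⟨diamond_adj_up.2 ⟨h, h'⟩, .inr ⟨x, y, he, rfl⟩⟩⟩

lemma IsFullOn.mono {G : LatticeGraph} {a' b' k' : ℤ} (h : IsFullOn G a b k)
    (hsub : diamondVerts a' b' k' ⊆ diamondVerts a b k) : IsFullOn G a' b' k' :=
  ⟨fun x y h1 h2 => h.horizontal x y (hsub h1) (hsub h2),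
    fun x y h1 h2 => h.vertical x y (hsub h1) (hsub h2)⟩

lemma completion_adj_up {x y : ℤ} : (completion a b k P).Adj (x, y) (x, y + 1) ↔
    P.Adj (x, y) (x, y + 1) ∨ ((x, y) ∈ diamondVerts a b k ∧ (x, y + 1) ∈ diamondVerts a b k ∧
      Even (x + y)) := by
  constructor
  · rintro (h | ⟨h, ⟨x', y', h'⟩ | ⟨x', y', he, h'⟩⟩)
    · exact .inl h
    · exact absurd h' (vEdge_ne_hEdge _ _ _ _)
    · obtain ⟨rfl, rfl⟩ := vEdge_inj.1 h'
      have := diamond_adj_up.1 h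
      exact .inr ⟨this.1, this.2, he⟩
  · rintro (h | ⟨h1, h2, h3⟩)
    · exact .inl h
    · exact (isFullOn_completion a b k P).vertical _ _ h1 h2 h3

lemma mem_oddVerticals_completion {x y : ℤ} : (x, y) ∈ oddVerticals (completion a b k P) ↔
    Odd (x + y) ∧ P.Adj (x, y) (x, y + 1) := by
  simp only [oddVerticals, Set.mem_ofPred_eq, completion_adj_up]
  constructor
  · rintro ⟨h, h' | h'⟩
    · exact ⟨h, h'⟩
    · exact absurd h'.2.2 (Int.not_even_iff_odd.2 h)
  · exact fun h => ⟨h.1, .inl h.2⟩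

include hP

lemma IsClosedPinecone.pos : 1 ≤ k := by
  obtain ⟨i, j, R, hp, hR⟩ := hP.1.exists_profile
  have := hp.lt b (by have := hp.hj; omega) (by have := hp.hi; omega)
  simp only [sub_self, segStart] at this
  norm_num at this
  omega

lemma IsClosedPinecone.east_mem :
    (a + 2 * k - 1, b) ∈ oddVerticals (completion a b k P) := by
  obtain ⟨i, j, R, hp, hR⟩ := hP.1.exists_profile
  have hj := hp.hj
  rw [mem_oddVerticals_completion, ← hR]
  exact ⟨hp.parity_down b le_rfl (by omega), hp.adj_down_end hP.2 le_rfl (by omega)⟩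

/-- The completion adds only even vertical edges, so its chains use vertical edges of `P` and cannot
leave `P`. -/
lemma IsClosedPinecone.verts_eq :
    P.verts = coreVerts (oddVerticals (completion a b k P)) a b k := by
  obtain ⟨i, j, R, hp, hR⟩ := hP.1.exists_profile
  have hi := hp.hi
  have hj := hp.hj
  ext ⟨x, y⟩
  constructor
  · intro h
    exact ⟨((hp.verts x y).1 h).2.2.1, hp.reach hP.2 hR.le
      (fun x y h1 h2 => mem_oddVerticals_completion.2 ⟨h1, h2⟩) h⟩
  · rintro ⟨h1, h2⟩
    simp only at h1 h2
    refine (hp.verts x y).2 ?_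
    suffices b - j ≤ y ∧ y ≤ b + i ∧ x ≤ R y by tauto
    refine vertical_induction (p := fun y => ∀ x,
      Reach (oddVerticals (completion a b k P)) (a + 2 * k - 1) b y x →
        b - j ≤ y ∧ y ≤ b + i ∧ x ≤ R y) b ?_ ?_ ?_ ?_ y x h2
    · intro x h
      obtain ⟨z, h1, h2, -⟩ := reach_self.1 h
      omega
    · intro x h
      obtain ⟨z, h1, h2, -⟩ := reach_add_one.1 h
      have := hp.base
      omega
    · intro y hy ih x h
      obtain ⟨z, h1, h2, -⟩ := (reach_up hy).1 h
      have := (hp.verts _ _).1 (mem_oddVerticals_completion.1 h2).2.snd_mem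
      omega
    · intro y hy ih x h
      obtain ⟨z, h1, h2, -⟩ := (reach_down hy).1 h
      have := (hp.verts _ _).1 (mem_oddVerticals_completion.1 h2).2.fst_mem
      omega

lemma IsClosedPinecone.eq_induce :
    P = (completion a b k P).induce (coreVerts (oddVerticals (completion a b k P)) a b k) := by
  obtain ⟨i, j, R, hp, hR⟩ := hP.1.exists_profile
  have hv := hP.verts_eq
  refine latticeGraph_ext hv ?_ ?_
  · intro x y
    rw [induce_coreVerts_adj_right (isFullOn_completion a b k P), ← hv, hp.verts, hp.verts, hp.adj]
    omega
  · intro x y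
    rw [SimpleGraph.Subgraph.induce_adj, ← hv, completion_adj_up]
    constructor
    · exact fun h => ⟨h.fst_mem, h.snd_mem, .inl h⟩
    · rintro ⟨h1, h2, h | h⟩
      · exact h
      · exact hP.1.2.2.2 x y h1 h2 h.2.2

end

/-! ### The monomial factors of the condensation identity -/

section

variable {a b k : ℤ} {P : LatticeGraph} (hP : IsClosedPinecone a b k P)

lemma isFullOn_west : IsFullOn (completion a b k P) a b (k - 1) := by
  refine (isFullOn_completion a b k P).mono ?_
  rintro ⟨x, y⟩ h
  rw [mem_diamondVerts] at *
  omega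

lemma isFullOn_east : IsFullOn (completion a b k P) (a + 2) b (k - 1) := by
  refine (isFullOn_completion a b k P).mono ?_
  rintro ⟨x, y⟩ h
  rw [mem_diamondVerts] at *
  omega

lemma isFullOn_center : IsFullOn (completion a b k P) (a + 2) b (k - 2) := by
  refine (isFullOn_completion a b k P).mono ?_
  rintro ⟨x, y⟩ h
  rw [mem_diamondVerts] at *
  omega

lemma isFullOn_north : IsFullOn (completion a b k P) (a + 1) (b + 1) (k - 1) := by
  refine (isFullOn_completion a b k P).mono ?_
  rintro ⟨x, y⟩ h
  rw [mem_diamondVerts] at *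
  simp only [segStart] at *
  split_ifs at * <;> omega

lemma isFullOn_south : IsFullOn (completion a b k P) (a + 1) (b - 1) (k - 1) := by
  refine (isFullOn_completion a b k P).mono ?_
  rintro ⟨x, y⟩ h
  rw [mem_diamondVerts] at *
  simp only [segStart] at *
  split_ifs at * <;> omega

include hP

lemma IsClosedPinecone.finite_edgeSet : P.edgeSet.Finite := by
  refine (diamondEdges a b k).finite_toSet.subset ?_
  intro e he
  have hv : ∀ v ∈ e, v ∈ diamondVerts a b k := fun v hv =>
    coreVerts_subset _ _ _ _ (hP.verts_eq ▸ P.mem_verts_of_mem_edge he hv)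
  rcases exists_eq_of_mem_edgeSet he with ⟨x, y, rfl⟩ | ⟨x, y, rfl⟩
  · exact hEdge_mem_diamondEdges.2 ⟨hv _ (by simp [mem_hEdge]), hv _ (by simp [mem_hEdge])⟩
  · exact vEdge_mem_diamondEdges.2 ⟨hv _ (by simp [mem_vEdge]), hv _ (by simp [mem_vEdge])⟩

lemma IsClosedPinecone.hEdge_mem {x y : ℤ} : hEdge x y ∈ P.edgeSet ↔
    a + segStart (y - b) ≤ x ∧
      Reach (oddVerticals (completion a b k P)) (a + 2 * k - 1) b y (x + 1) := by
  conv_lhs => rw [hP.eq_induce]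
  rw [hEdge_mem_induce_coreVerts (isFullOn_completion a b k P), mem_coreVerts, mem_coreVerts]
  constructor
  · exact fun h => ⟨h.1.1, h.2.2⟩
  · exact fun h => ⟨⟨h.1, h.2.mono (by omega)⟩, by omega, h.2⟩

omit hP in
lemma hEdge_mem_core {a' b' k' : ℤ} (hG : IsFullOn (completion a b k P) a' b' k')
    (hab : Even (a' + b')) {x y : ℤ} :
    hEdge x y ∈ (core a' b' (completion a b k P ⊓ diamond a' b' k')).edgeSet ↔
      a' + segStart (y - b') ≤ x ∧
        Reach (oddVerticals (completion a b k P)) (a' + 2 * k' - 1) b' y (x + 1) := by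
  rw [core_inf_diamond hG hab, hEdge_mem_induce_coreVerts hG, mem_coreVerts, mem_coreVerts]
  constructor
  · exact fun h => ⟨h.1.1, h.2.2⟩
  · exact fun h => ⟨⟨h.1, h.2.mono (by omega)⟩, by omega, h.2⟩

/-- `P` and its West sub-pinecone have the same left border; they differ only in the bound on the
first edge of chains, which is smaller by two for West. -/
lemma IsClosedPinecone.mem_edgesE1 {x y : ℤ} : hEdge x y ∈ edgesE1 a b k P ↔
    x = a + segStart (y - b) ∧
      Reach (oddVerticals (completion a b k P)) (a + 2 * k - 1) b y x ∧
      ¬ Reach (oddVerticals (completion a b k P)) (a + 2 * k - 3) b y x := by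
  have hab := hP.1.1
  have hO : ∀ v ∈ oddVerticals (completion a b k P), Odd (v.1 + v.2) := fun v hv => hv.1
  have h1 : hEdge x y ∈ edgesE1 a b k P ↔ (hEdge x y ∈ P.edgeSet ∧ hEdge (x - 1) y ∉ P.edgeSet) ∧
      hEdge x y ∉ (subW a b k P).edgeSet := by
    rw [edgesE1, Set.mem_sdiff, leftEdges, Set.mem_ofPred_eq]
    refine and_congr_left fun _ => ⟨?_, fun h => ⟨x, y, rfl, h⟩⟩
    rintro ⟨x', y', h, h'⟩
    obtain ⟨rfl, rfl⟩ := hEdge_inj.1 h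
    exact h'
  have hl : x = a + segStart (y - b) → IsLeftEnd b x y := by
    rintro rfl
    rw [Int.even_iff] at hab
    simp only [IsLeftEnd, Int.even_iff, Int.odd_iff, segStart]
    split_ifs <;> omega
  rw [h1, subW, hEdge_mem_core isFullOn_west hab, hP.hEdge_mem, hP.hEdge_mem, sub_add_cancel,
    show a + 2 * (k - 1) - 1 = a + 2 * k - 3 by ring]
  constructor
  · rintro ⟨⟨⟨h2, h3⟩, h4⟩, h5⟩
    have h6 := h3.mono (x' := x) (by omega)
    have hx : x = a + segStart (y - b) := by
      by_contra hne
      exact h4 ⟨by omega, h6⟩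
    exact ⟨hx, h6, fun h => h5 ⟨h2, h.of_isLeftEnd hO (hl hx)⟩⟩
  · rintro ⟨hx, h2, h3⟩
    exact ⟨⟨⟨hx.ge, h2.of_isLeftEnd hO (hl hx)⟩, fun h => by have := h.1; omega⟩,
      fun h => h3 (h.2.mono (by omega))⟩

/-- Comparison of the factors of `M(P^W) M(P^E)`. -/
lemma IsClosedPinecone.west_east_monomials :
    edgeProd (forcedEdges (oddVerticals (completion a b k P)) a b k) *
      edgeProd (forcedEdges (oddVerticals (completion a b k P)) (a + 2) b (k - 2)) *
      edgeProd (edgesE1 a b k P) =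
    .X (hEdge (a + k - 1) (b + k)) * .X (hEdge (a + k - 1) (b - k + 1)) *
      edgeProd (forcedEdges (oddVerticals (completion a b k P)) a b (k - 1)) *
      edgeProd (forcedEdges (oddVerticals (completion a b k P)) (a + 2) b (k - 1)) := by
  classical
  have hk := hP.pos
  have hab := hP.1.1
  have hE1 : (edgesE1 a b k P).Finite :=
    hP.finite_edgeSet.subset fun e ⟨⟨x, y, h1, h2, _⟩, _⟩ => h1 ▸ h2
  have key := prod_map_edgeProd_congr
    (l := [forcedEdges (oddVerticals (completion a b k P)) a b k,
      forcedEdges (oddVerticals (completion a b k P)) (a + 2) b (k - 2), edgesE1 a b k P])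
    (l' := [{hEdge (a + k - 1) (b + k)}, {hEdge (a + k - 1) (b - k + 1)},
      forcedEdges (oddVerticals (completion a b k P)) a b (k - 1),
      forcedEdges (oddVerticals (completion a b k P)) (a + 2) b (k - 1)])
    (by simp [finite_forcedEdges, hE1]) (by simp [finite_forcedEdges]) ?_
  · simpa only [List.map_cons, List.map_nil, List.prod_cons, List.prod_nil, mul_one, mul_assoc,
      edgeProd_singleton] using key
  · intro e
    simp only [List.map_cons, List.map_nil, List.sum_cons, List.sum_nil, add_zero,
      Set.mem_singleton_iff]
    by_cases he : ∃ x y, e = hEdge x y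
    · obtain ⟨x, y, rfl⟩ := he
      rw [hP.mem_edgesE1]
      simp only [hEdge_mem_forcedEdges, mem_diamondVerts, hEdge_inj,
        show a + 2 + 2 * (k - 2) - 1 = a + 2 * k - 3 by ring,
        show a + 2 + 2 * (k - 1) - 1 = a + 2 * k - 1 by ring,
        show a + 2 * (k - 1) - 1 = a + 2 * k - 3 by ring]
      -- `P` and East have the same right border and bound, and so do West and the centre, so forced
      -- edges cancel in pairs except at the left border. There, the forced edges of `P` and the
      -- edges of `E₁` together are the left edges not reached for West, whether or not the West
      -- diamond contains them.
      have hAle := fun h : Reach (oddVerticals (completion a b k P)) (a + 2 * k - 1) b y x => h.le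
      have hWle := fun h : Reach (oddVerticals (completion a b k P)) (a + 2 * k - 3) b y x => h.le
      have hWA := fun h : Reach (oddVerticals (completion a b k P)) (a + 2 * k - 3) b y x =>
        h.mono_bound (show a + 2 * k - 3 ≤ a + 2 * k - 1 by omega)
      generalize Reach (oddVerticals (completion a b k P)) (a + 2 * k - 1) b y x = rA at *
      generalize Reach (oddVerticals (completion a b k P)) (a + 2 * k - 3) b y x = rW at *
      -- On the two extremal ordinates the West diamond has no vertex, and the missing edge is
      -- supplied by an extremal horizontal edge.
      have hs : segStart (y - b) = k - 1 ↔ y = b + k ∨ y = b - k + 1 := by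
        simp only [segStart]
        split_ifs <;> omega
      have hl : IsLeftEnd b x y ↔ (x - a - segStart (y - b)) % 2 = 0 := by
        rw [Int.even_iff] at hab
        simp only [IsLeftEnd, Int.even_iff, Int.odd_iff, segStart]
        split_ifs <;> omega
      rw [hl]
      generalize segStart (y - b) = s at *
      by_cases hA : rA
      · by_cases hW : rW
        · have := hWle hW
          simp only [hA, hW, not_true_eq_false, and_false, if_false, add_zero]
          split_ifs <;> omega
        · have := hAle hA
          simp only [hA, hW, not_true_eq_false, not_false_eq_true, and_false, and_true, if_false,
            add_zero, zero_add]
          split_ifs <;> omega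
      · have hW : ¬ rW := fun h => hA (hWA h)
        simp only [hA, hW, not_false_eq_true, and_true, and_false, if_false, add_zero]
        split_ifs <;> omega
    · have hf : ∀ O a b k, e ∉ forcedEdges O a b k :=
        fun O a b k ⟨x, y, _, _, h⟩ => he ⟨x, y, h⟩
      have h1 : e ∉ edgesE1 a b k P := fun ⟨⟨x, y, h, _⟩, _⟩ => he ⟨x, y, h⟩
      have h2 : ∀ x y, e ≠ hEdge x y := fun x y h => he ⟨x, y, h⟩
      simp [hf, h1, h2]

/-- The extreme abscissas of the diamond occur only at ordinates `b` and `b + 1`, which leaves room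
for one vertical edge on each side. -/
lemma IsClosedPinecone.vEdge_mem {x y : ℤ} (h : vEdge x y ∈ P.edgeSet) :
    a ≤ x ∧ x ≤ a + 2 * k - 1 ∧ (x = a ∨ x = a + 2 * k - 1 → y = b) := by
  have hv : ∀ v ∈ vEdge x y, v ∈ diamondVerts a b k := fun v hv =>
    coreVerts_subset _ _ _ _ (hP.verts_eq ▸ P.mem_verts_of_mem_edge h hv)
  have h1 := hv (x, y) (by simp [mem_vEdge])
  have h2 := hv (x, y + 1) (by simp [mem_vEdge])
  rw [mem_diamondVerts] at h1 h2
  simp only [segStart] at h1 h2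
  split_ifs at h1 h2 <;> omega

lemma IsClosedPinecone.mem_edgesE20 {x y : ℤ} : vEdge x y ∈ edgesE20 P ↔
    (x = a ∧ y = b) ∨ (x = a + 2 * k - 1 ∧ y = b) := by
  have hk := hP.pos
  have heast : vEdge (a + 2 * k - 1) b ∈ P.edgeSet := by
    have := (mem_oddVerticals_completion.1 hP.east_mem).2
    exact this
  have hwest : vEdge a b ∈ P.edgeSet := by
    have h0 := reach_self.2 ⟨a + 2 * k - 1, show a ≤ a + 2 * k - 1 by omega, le_rfl, hP.east_mem⟩
    have h1 : (a, b) ∈ P.verts := by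
      rw [hP.verts_eq]
      exact ⟨by simp [segStart], h0⟩
    have h2 : (a, b + 1) ∈ P.verts := by
      rw [hP.verts_eq] at h1 ⊢
      exact coreVerts_add_one h1 le_rfl
    exact hP.1.2.2.2 a b h1 h2 hP.1.1
  constructor
  · rintro ⟨x', y', h1, h2, h3⟩
    obtain ⟨rfl, rfl⟩ := vEdge_inj.1 h1
    have h4 := hP.vEdge_mem h2
    rcases h3 with h3 | h3
    · have := h3 _ _ heast
      right
      omega
    · have := h3 _ _ hwest
      left
      omega
  · rintro (⟨rfl, rfl⟩ | ⟨rfl, rfl⟩)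
    · exact ⟨_, _, rfl, hwest, .inr fun x' y' h => (hP.vEdge_mem h).1⟩
    · exact ⟨_, _, rfl, heast, .inl fun x' y' h => (hP.vEdge_mem h).2.1⟩

/-- All of ordinate `b + 1` is reached in `P` by the east edge. For North this ordinate belongs to
the lower half, whose left ends have even parity; so `E₂¹` is the set of edges forced for North
there. In the same way `E₂²` belongs to South at ordinate `b`. -/
lemma IsClosedPinecone.hEdge_mem_edgesE21 {x y : ℤ} : hEdge x y ∈ edgesE21 a b k P ↔
    y = b + 1 ∧ (x + y) % 2 = 0 ∧ a + 1 ≤ x ∧ x ≤ a + 2 * k - 2 ∧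
      ¬ Reach (oddVerticals (completion a b k P)) (a + 2 * k - 2) (b + 1) y x := by
  have hab := hP.1.1
  have habN : Even (a + 1 + (b + 1)) := by rw [Int.even_iff] at *; omega
  have hO : ∀ v ∈ oddVerticals (completion a b k P), Odd (v.1 + v.2) := fun v hv => hv.1
  have heast := hP.east_mem
  have h1 : hEdge x y ∈ edgesE21 a b k P ↔ (hEdge x y ∈ P.edgeSet ∧ y = b + 1 ∧ Even (x + y)) ∧
      hEdge x y ∉ (subN a b k P).edgeSet := by
    rw [edgesE21, Set.mem_sdiff, Set.mem_ofPred_eq]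
    refine and_congr_left fun _ => and_congr_right fun _ => ⟨?_, ?_⟩
    · rintro ⟨x', h, h'⟩
      obtain ⟨rfl, rfl⟩ := hEdge_inj.1 h'
      exact ⟨rfl, h⟩
    · rintro ⟨rfl, h⟩
      exact ⟨x, h, rfl⟩
  rw [h1, subN, hEdge_mem_core isFullOn_north habN, hP.hEdge_mem,
    show a + 1 + 2 * (k - 1) - 1 = a + 2 * k - 2 by ring]
  rw [Int.even_iff] at hab
  constructor
  · rintro ⟨⟨⟨h2, h3⟩, rfl, h4⟩, h5⟩
    have h6 := h3.le
    simp only [segStart] at h2 h5 h6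
    norm_num at h2 h5 h6
    refine ⟨rfl, Int.even_iff.1 h4, ?_, by omega, fun h => h5 ?_ (h.of_isLeftEnd hO ?_)⟩
    · rw [Int.even_iff] at h4; omega
    · rw [Int.even_iff] at h4; omega
    · rwa [IsLeftEnd, if_neg (lt_irrefl _)]
  · rintro ⟨rfl, h2, h3, h4, h5⟩
    refine ⟨⟨⟨?_, ?_⟩, rfl, Int.even_iff.2 h2⟩, fun h => h5 (h.2.mono (by omega))⟩
    · simp [segStart]; omega
    · exact reach_add_one.2 ⟨_, by omega, le_rfl, heast⟩

lemma IsClosedPinecone.hEdge_mem_edgesE22 {x y : ℤ} : hEdge x y ∈ edgesE22 a b k P ↔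
    y = b ∧ (x + y) % 2 = 1 ∧ a + 1 ≤ x ∧ x ≤ a + 2 * k - 2 ∧
      ¬ Reach (oddVerticals (completion a b k P)) (a + 2 * k - 2) (b - 1) y x := by
  have hab := hP.1.1
  have habS : Even (a + 1 + (b - 1)) := by rw [Int.even_iff] at *; omega
  have hO : ∀ v ∈ oddVerticals (completion a b k P), Odd (v.1 + v.2) := fun v hv => hv.1
  have heast := hP.east_mem
  have h1 : hEdge x y ∈ edgesE22 a b k P ↔ (hEdge x y ∈ P.edgeSet ∧ y = b ∧ Odd (x + y)) ∧
      hEdge x y ∉ (subS a b k P).edgeSet := by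
    rw [edgesE22, Set.mem_sdiff, Set.mem_ofPred_eq]
    refine and_congr_left fun _ => and_congr_right fun _ => ⟨?_, ?_⟩
    · rintro ⟨x', h, h'⟩
      obtain ⟨rfl, rfl⟩ := hEdge_inj.1 h'
      exact ⟨rfl, h⟩
    · rintro ⟨rfl, h⟩
      exact ⟨x, h, rfl⟩
  rw [h1, subS, hEdge_mem_core isFullOn_south habS, hP.hEdge_mem,
    show a + 1 + 2 * (k - 1) - 1 = a + 2 * k - 2 by ring]
  rw [Int.even_iff] at hab
  constructor
  · rintro ⟨⟨⟨h2, h3⟩, rfl, h4⟩, h5⟩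
    have h6 := h3.le
    simp only [segStart] at h2 h5 h6
    norm_num at h2 h5 h6
    refine ⟨rfl, Int.odd_iff.1 h4, ?_, by omega, fun h => h5 ?_ (h.of_isLeftEnd hO ?_)⟩
    · rw [Int.odd_iff] at h4; omega
    · rw [Int.odd_iff] at h4; omega
    · rwa [IsLeftEnd, if_pos (by omega)]
  · rintro ⟨rfl, h2, h3, h4, h5⟩
    refine ⟨⟨⟨?_, ?_⟩, rfl, Int.odd_iff.2 h2⟩, fun h => h5 (h.2.mono (by omega))⟩
    · simp [segStart]; omega
    · exact reach_self.2 ⟨_, by omega, le_rfl, heast⟩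

lemma IsClosedPinecone.hEdge_mem_edgesE2 {x y : ℤ} : hEdge x y ∈ edgesE2 a b k P ↔
    (y = b + 1 ∧ (x + y) % 2 = 0 ∧ a + 1 ≤ x ∧ x ≤ a + 2 * k - 2 ∧
      ¬ Reach (oddVerticals (completion a b k P)) (a + 2 * k - 2) (b + 1) y x) ∨
    (y = b ∧ (x + y) % 2 = 1 ∧ a + 1 ≤ x ∧ x ≤ a + 2 * k - 2 ∧
      ¬ Reach (oddVerticals (completion a b k P)) (a + 2 * k - 2) (b - 1) y x) := by
  have h0 : hEdge x y ∉ edgesE20 P := fun ⟨_, _, h, _⟩ => hEdge_ne_vEdge _ _ _ _ h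
  rw [edgesE2, Set.mem_union, Set.mem_union, hP.hEdge_mem_edgesE21, hP.hEdge_mem_edgesE22,
    or_iff_right h0]

end

section

variable {a b k : ℤ} {P : LatticeGraph} (hP : IsClosedPinecone a b k P)

include hP

-- Above the base, the centre and South have the same extent and the South core is contained in the
-- central one, so the edges forced for the centre and those of `H⁺` together are those forced for
-- South. North is compared with `P`: beyond ordinate `b + 1` they have the same forced edges, and
-- at `b + 1` nothing is forced in `P` while `E₂¹` supplies the edges forced for North.
open scoped Classical in
lemma IsClosedPinecone.count_north_south_upper {x y : ℤ} (hy : b < y) {O : Set (ℤ × ℤ)}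
    (hOdef : O = oddVerticals (completion a b k P)) :
    (if hEdge x y ∈ forcedEdges O a b k then 1 else 0) +
      ((if hEdge x y ∈ forcedEdges O (a + 2) b (k - 2) then 1 else 0) +
      ((if hEdge x y ∈ edgesE2 a b k P then 1 else 0) +
      (if b < y ∧ IsLeftEnd b x y ∧ (x, y) ∈ coreVerts O (a + 2) b (k - 2) ∧
        (x, y) ∉ coreVerts O (a + 1) (b - 1) (k - 1) then 1 else 0))) =
    (if hEdge x y ∈ forcedEdges O (a + 1) (b + 1) (k - 1) then 1 else 0) +
      (if hEdge x y ∈ forcedEdges O (a + 1) (b - 1) (k - 1) then 1 else 0) := by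
  have hab := hP.1.1
  have heast := hP.east_mem
  rw [Int.even_iff] at hab
  rw [hP.hEdge_mem_edgesE2, ← hOdef]
  rw [← hOdef] at heast
  have s1 : segStart (y - b) = y - b - 1 := by
    simp only [segStart]; rw [if_pos (by omega)]
  have s2 : segStart (y - (b - 1)) = y - b := by
    simp only [segStart]; rw [if_pos (by omega)]; ring
  have l1 : IsLeftEnd b x y ↔ (x + y) % 2 = 1 := by rw [IsLeftEnd, if_pos hy, Int.odd_iff]
  have l2 : IsLeftEnd (b - 1) x y ↔ (x + y) % 2 = 1 := by
    rw [IsLeftEnd, if_pos (by omega), Int.odd_iff]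
  simp only [hEdge_mem_forcedEdges, mem_diamondVerts, mem_coreVerts, s1, s2, l1, l2,
    show a + 2 + 2 * (k - 2) - 1 = a + 2 * k - 3 by ring,
    show a + 1 + 2 * (k - 1) - 1 = a + 2 * k - 2 by ring]
  have hSC : Reach O (a + 2 * k - 2) (b - 1) y x → Reach O (a + 2 * k - 3) b y x := fun h =>
    reach_of_south (by rwa [show a + 2 * k - 3 + 1 = a + 2 * k - 2 by ring]) hy
  have hC := fun h : Reach O (a + 2 * k - 3) b y x => h.le
  rw [s1] at hC
  obtain rfl | hy' : y = b + 1 ∨ b + 1 < y := by omega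
  -- The east edge reaches the whole base segment of `P`.
  · have hA : Reach O (a + 2 * k - 1) b (b + 1) x ↔ x ≤ a + 2 * k - 1 := by
      rw [reach_add_one]
      exact ⟨fun ⟨z, h1, h2, _⟩ => h1.trans h2, fun h => ⟨_, h, le_rfl, heast⟩⟩
    have s3 : segStart (b + 1 - (b + 1)) = 0 := by simp [segStart]
    have l3 : IsLeftEnd (b + 1) x (b + 1) ↔ (x + (b + 1)) % 2 = 0 := by
      rw [IsLeftEnd, if_neg (by omega), Int.even_iff]
    simp only [s3, l3, hA]
    generalize Reach O (a + 2 * k - 2) (b - 1) (b + 1) x = rS at *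
    generalize Reach O (a + 2 * k - 3) b (b + 1) x = rC at *
    generalize Reach O (a + 2 * k - 2) (b + 1) (b + 1) x = rN at *
    have hne : ¬ (b + 1 = b) := by omega
    simp only [hne, false_and, or_false, true_and]
    by_cases h3 : (x + (b + 1)) % 2 = 0
    · have h4 : ¬ ((x + (b + 1)) % 2 = 1) := by omega
      simp only [h3, true_and]
      by_cases hrN : rN
      · simp [hrN]
      · simp only [hrN, not_false_eq_true, and_true]
        split_ifs <;> omega
    · have h4 : (x + (b + 1)) % 2 = 1 := by omega
      simp only [h4, true_and, not_le]
      by_cases hrS : rS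
      · have hrC := hSC hrS
        have := hC hrC
        simp only [hrS, hrC, not_true_eq_false, and_false, and_true, if_false]
        split_ifs <;> omega
      · by_cases hrC : rC
        · have := hC hrC
          simp only [hrS, hrC, not_true_eq_false, not_false_eq_true, and_false, and_true, if_false]
          split_ifs <;> omega
        · simp only [hrS, hrC, not_false_eq_true, and_false, and_true, if_false]
          split_ifs <;> omega
  · have hNA : Reach O (a + 2 * k - 2) (b + 1) y x ↔ Reach O (a + 2 * k - 1) b y x := by
      rw [← reach_north_iff heast hy', show a + 2 * k - 1 - 1 = a + 2 * k - 2 by ring]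
    have s3 : segStart (y - (b + 1)) = y - b - 2 := by
      simp only [segStart]; rw [if_pos (by omega)]; ring
    have l3 : IsLeftEnd (b + 1) x y ↔ (x + y) % 2 = 1 := by
      rw [IsLeftEnd, if_pos (by omega), Int.odd_iff]
    have n1 : ¬ (y = b + 1) := by omega
    have n2 : ¬ (y = b) := by omega
    simp only [s3, l3, hNA, n1, n2, false_and, or_false, if_false]
    generalize Reach O (a + 2 * k - 2) (b - 1) y x = rS at *
    generalize Reach O (a + 2 * k - 3) b y x = rC at *
    generalize Reach O (a + 2 * k - 1) b y x = rA at *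
    -- The root of North is shifted by one in both directions, so its diamond has the same borders
    -- as that of `P` at these ordinates.
    have e1 : ((x + y) % 2 = 1 ∧ (a + (y - b - 1) ≤ x ∧ x ≤ a + 2 * k - 1 - (y - b - 1)) ∧ ¬rA) ↔
        ((x + y) % 2 = 1 ∧ (a + 1 + (y - b - 2) ≤ x ∧ x ≤ a + 2 * k - 2 - (y - b - 2)) ∧ ¬rA) := by
      refine and_congr_right fun _ => and_congr_left fun _ => ?_
      omega
    simp only [e1]
    congr 1
    by_cases h3 : (x + y) % 2 = 1
    · simp only [h3, true_and]
      by_cases hrS : rS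
      · have hrC := hSC hrS
        have := hC hrC
        simp only [hrS, hrC, not_true_eq_false, and_false, and_true, if_false]
        split_ifs <;> omega
      · by_cases hrC : rC
        · have := hC hrC
          simp only [hrS, hrC, not_true_eq_false, not_false_eq_true, and_false, and_true, if_false]
          split_ifs <;> omega
        · simp only [hrS, hrC, not_false_eq_true, and_false, and_true, if_false]
          split_ifs <;> omega
    · simp [h3]

-- Mirror image of the upper count: North is now compared with the centre, through `H⁻`, and South
-- with `P`, through `E₂²` at the base ordinate.
open scoped Classical in
lemma IsClosedPinecone.count_north_south_lower {x y : ℤ} (hy : y ≤ b) {O : Set (ℤ × ℤ)}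
    (hOdef : O = oddVerticals (completion a b k P)) :
    (if hEdge x y ∈ forcedEdges O a b k then 1 else 0) +
      ((if hEdge x y ∈ forcedEdges O (a + 2) b (k - 2) then 1 else 0) +
      ((if hEdge x y ∈ edgesE2 a b k P then 1 else 0) +
      (if y ≤ b ∧ IsLeftEnd b x y ∧ (x, y) ∈ coreVerts O (a + 2) b (k - 2) ∧
        (x, y) ∉ coreVerts O (a + 1) (b + 1) (k - 1) then 1 else 0))) =
    (if hEdge x y ∈ forcedEdges O (a + 1) (b + 1) (k - 1) then 1 else 0) +
      (if hEdge x y ∈ forcedEdges O (a + 1) (b - 1) (k - 1) then 1 else 0) := by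
  have hab := hP.1.1
  have heast := hP.east_mem
  rw [Int.even_iff] at hab
  rw [hP.hEdge_mem_edgesE2, ← hOdef]
  rw [← hOdef] at heast
  have s1 : segStart (y - b) = b - y := by
    simp only [segStart]; rw [if_neg (by omega)]; ring
  have s2 : segStart (y - (b + 1)) = b + 1 - y := by
    simp only [segStart]; rw [if_neg (by omega)]; ring
  have l1 : IsLeftEnd b x y ↔ (x + y) % 2 = 0 := by rw [IsLeftEnd, if_neg (by omega), Int.even_iff]
  have l2 : IsLeftEnd (b + 1) x y ↔ (x + y) % 2 = 0 := by
    rw [IsLeftEnd, if_neg (by omega), Int.even_iff]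
  simp only [hEdge_mem_forcedEdges, mem_diamondVerts, mem_coreVerts, s1, s2, l1, l2,
    show a + 2 + 2 * (k - 2) - 1 = a + 2 * k - 3 by ring,
    show a + 1 + 2 * (k - 1) - 1 = a + 2 * k - 2 by ring]
  have hNC : Reach O (a + 2 * k - 2) (b + 1) y x → Reach O (a + 2 * k - 3) b y x := fun h =>
    reach_of_north (by rwa [show a + 2 * k - 3 + 1 = a + 2 * k - 2 by ring]) hy
  have hC := fun h : Reach O (a + 2 * k - 3) b y x => h.le
  rw [s1] at hC
  have n1 : ¬ (y = b + 1) := by omega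
  simp only [n1, false_and, false_or]
  obtain rfl | hy' : y = b ∨ y < b := by omega
  · have hA : Reach O (a + 2 * k - 1) y y x ↔ x ≤ a + 2 * k - 1 := by
      rw [reach_self]
      exact ⟨fun ⟨z, h1, h2, _⟩ => h1.trans h2, fun h => ⟨_, h, le_rfl, heast⟩⟩
    have s3 : segStart (y - (y - 1)) = 0 := by simp [segStart]
    have l3 : IsLeftEnd (y - 1) x y ↔ (x + y) % 2 = 1 := by
      rw [IsLeftEnd, if_pos (by omega), Int.odd_iff]
    simp only [s3, l3, hA]
    generalize Reach O (a + 2 * k - 2) (y - 1) y x = rS at *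
    generalize Reach O (a + 2 * k - 3) y y x = rC at *
    generalize Reach O (a + 2 * k - 2) (y + 1) y x = rN at *
    simp only [true_and]
    by_cases h3 : (x + y) % 2 = 1
    · have h4 : ¬ ((x + y) % 2 = 0) := by omega
      simp only [h3, true_and]
      by_cases hrS : rS
      · simp [hrS]
      · simp only [hrS, not_false_eq_true, and_true]
        split_ifs <;> omega
    · have h4 : (x + y) % 2 = 0 := by omega
      simp only [h4, true_and, not_le]
      by_cases hrN : rN
      · have hrC := hNC hrN
        have := hC hrC
        simp only [hrN, hrC, not_true_eq_false, and_false, and_true, if_false]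
        split_ifs <;> omega
      · by_cases hrC : rC
        · have := hC hrC
          simp only [hrN, hrC, not_true_eq_false, not_false_eq_true, and_false, and_true, if_false]
          split_ifs <;> omega
        · simp only [hrN, hrC, not_false_eq_true, and_false, and_true, if_false]
          split_ifs <;> omega
  · have hSA : Reach O (a + 2 * k - 2) (b - 1) y x ↔ Reach O (a + 2 * k - 1) b y x := by
      rw [← reach_south_iff heast hy', show a + 2 * k - 1 - 1 = a + 2 * k - 2 by ring]
    have s3 : segStart (y - (b - 1)) = b - 1 - y := by
      simp only [segStart]; rw [if_neg (by omega)]; ring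
    have l3 : IsLeftEnd (b - 1) x y ↔ (x + y) % 2 = 0 := by
      rw [IsLeftEnd, if_neg (by omega), Int.even_iff]
    have n2 : ¬ (y = b) := by omega
    simp only [s3, l3, hSA, n2, false_and, if_false, hy, true_and]
    generalize Reach O (a + 2 * k - 2) (b + 1) y x = rN at *
    generalize Reach O (a + 2 * k - 3) b y x = rC at *
    generalize Reach O (a + 2 * k - 1) b y x = rA at *
    have e1 : ((x + y) % 2 = 0 ∧ (a + (b - y) ≤ x ∧ x ≤ a + 2 * k - 1 - (b - y)) ∧ ¬rA) ↔
        ((x + y) % 2 = 0 ∧ (a + 1 + (b - 1 - y) ≤ x ∧ x ≤ a + 2 * k - 2 - (b - 1 - y)) ∧ ¬rA) := by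
      refine and_congr_right fun _ => and_congr_left fun _ => ?_
      omega
    simp only [e1]
    rw [add_comm]
    congr 1
    by_cases h3 : (x + y) % 2 = 0
    · simp only [h3, true_and]
      by_cases hrN : rN
      · have hrC := hNC hrN
        have := hC hrC
        simp only [hrN, hrC, not_true_eq_false, and_false, and_true, if_false]
        split_ifs <;> omega
      · by_cases hrC : rC
        · have := hC hrC
          simp only [hrN, hrC, not_true_eq_false, not_false_eq_true, and_false, and_true, if_false]
          split_ifs <;> omega
        · simp only [hrN, hrC, not_false_eq_true, and_false, and_true, if_false]
          split_ifs <;> omega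
    · simp [h3]

/-- Comparison of the factors of `M(P^N) M(P^S)`. -/
lemma IsClosedPinecone.north_south_monomials {O : Set (ℤ × ℤ)}
    (hOdef : O = oddVerticals (completion a b k P)) {Km Kp : LatticeGraph}
    (hKm : ∀ x y, hEdge x y ∈ edgesAt Km b (Set.Iic 0) ↔ y ≤ b ∧ IsLeftEnd b x y ∧
      (x, y) ∈ coreVerts O (a + 2) b (k - 2) ∧ (x, y) ∉ coreVerts O (a + 1) (b + 1) (k - 1))
    (hKp : ∀ x y, hEdge x y ∈ edgesAt Kp b (Set.Ioi 0) ↔ b < y ∧ IsLeftEnd b x y ∧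
      (x, y) ∈ coreVerts O (a + 2) b (k - 2) ∧ (x, y) ∉ coreVerts O (a + 1) (b - 1) (k - 1)) :
    edgeProd (forcedEdges O a b k) * edgeProd (forcedEdges O (a + 2) b (k - 2)) *
      edgeProd (edgesE2 a b k P) * edgeProd (edgesAt Km b (Set.Iic 0)) *
      edgeProd (edgesAt Kp b (Set.Ioi 0)) =
    .X (vEdge a b) * .X (vEdge (a + 2 * k - 1) b) *
      edgeProd (forcedEdges O (a + 1) (b + 1) (k - 1)) *
      edgeProd (forcedEdges O (a + 1) (b - 1) (k - 1)) := by
  classical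
  have hk := hP.pos
  have hfinC := finite_pairEdges (b := b)
    ((finite_diamondVerts (a + 2) b (k - 2)).subset (coreVerts_subset O _ _ _))
  have hm : (edgesAt Km b (Set.Iic 0)).Finite := by
    refine hfinC.subset ?_
    rintro e he
    obtain ⟨x, m, -, rfl⟩ := he.2
    have := (hKm _ _).1 he
    exact hEdge_mem_pairEdges.2 ⟨this.2.1, this.2.2.1⟩
  have hp : (edgesAt Kp b (Set.Ioi 0)).Finite := by
    refine hfinC.subset ?_
    rintro e he
    obtain ⟨x, m, -, rfl⟩ := he.2
    have := (hKp _ _).1 he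
    exact hEdge_mem_pairEdges.2 ⟨this.2.1, this.2.2.1⟩
  have hE2 : (edgesE2 a b k P).Finite := by
    refine hP.finite_edgeSet.subset ?_
    rintro e ((⟨x, y, rfl, h, -⟩ | h) | h)
    exacts [h, h.1.1, h.1.1]
  have key := prod_map_edgeProd_congr
    (l := [forcedEdges O a b k, forcedEdges O (a + 2) b (k - 2), edgesE2 a b k P,
      edgesAt Km b (Set.Iic 0), edgesAt Kp b (Set.Ioi 0)])
    (l' := [{vEdge a b}, {vEdge (a + 2 * k - 1) b},
      forcedEdges O (a + 1) (b + 1) (k - 1), forcedEdges O (a + 1) (b - 1) (k - 1)])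
    (by simp [finite_forcedEdges, hE2, hm, hp]) (by simp [finite_forcedEdges]) ?_
  · simpa only [List.map_cons, List.map_nil, List.prod_cons, List.prod_nil, mul_one, mul_assoc,
      edgeProd_singleton] using key
  · intro e
    simp only [List.map_cons, List.map_nil, List.sum_cons, List.sum_nil, add_zero,
      Set.mem_singleton_iff]
    by_cases he : ∃ x y, e = hEdge x y
    · obtain ⟨x, y, rfl⟩ := he
      rw [hKm, hKp]
      simp only [hEdge_ne_vEdge, if_false, zero_add]
      rcases le_or_gt y b with hy | hy
      · rw [← hP.count_north_south_lower hy hOdef]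
        simp only [not_lt.2 hy, false_and, if_false, add_zero]
        congr!
      · rw [← hP.count_north_south_upper hy hOdef]
        simp only [not_le.2 hy, false_and, if_false, zero_add]
        congr!
    · have hf : ∀ O a b k, e ∉ forcedEdges O a b k :=
        fun O a b k ⟨x, y, _, _, h⟩ => he ⟨x, y, h⟩
      have hat : ∀ K R, e ∉ edgesAt K b R := fun K R ⟨_, x, m, _, h⟩ => he ⟨x, b + m, h⟩
      have h21 : e ∉ edgesE21 a b k P := fun ⟨⟨_, x, _, h⟩, _⟩ => he ⟨x, b + 1, h⟩
      have h22 : e ∉ edgesE22 a b k P := fun ⟨⟨_, x, _, h⟩, _⟩ => he ⟨x, b, h⟩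
      simp only [hf, hat, if_false, zero_add, add_zero, edgesE2, Set.mem_union, h21, h22, or_false]
      by_cases hv : ∃ x y, e = vEdge x y
      · obtain ⟨x, y, rfl⟩ := hv
        rw [hP.mem_edgesE20]
        simp only [vEdge_inj]
        split_ifs <;> omega
      · have h0 : e ∉ edgesE20 P := fun ⟨x, y, h, _⟩ => hv ⟨x, y, h⟩
        have h2 : ∀ x y, e ≠ vEdge x y := fun x y h => hv ⟨x, y, h⟩
        simp [h0, h2]

end

theorem IsClosedPinecone.condensation {a b k : ℤ} {P : LatticeGraph}
    (hP : IsClosedPinecone a b k P) :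
    ∃ Km Kp : LatticeGraph,
      (IsHorizontalMatchingOf (diffCN a b k P) Km ∧
        ∀ K, IsHorizontalMatchingOf (diffCN a b k P) K → K = Km) ∧
      (IsHorizontalMatchingOf (diffCS a b k P) Kp ∧
        ∀ K, IsHorizontalMatchingOf (diffCS a b k P) K → K = Kp) ∧
      matchingPoly P * matchingPoly (subC a b k P) =
        edgeProd (edgesE1 a b k P) *
            matchingPoly (subW a b k P) *
            matchingPoly (subE a b k P) +
          edgeProd (edgesE2 a b k P) *
            edgeProd (edgesAt Km b (Set.Iic 0)) *
            edgeProd (edgesAt Kp b (Set.Ioi 0)) *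
            matchingPoly (subN a b k P) *
            matchingPoly (subS a b k P) := by
  have hab := hP.1.1
  have hk := hP.pos
  have hab2 : Even (a + 2 + b) := by rw [Int.even_iff] at *; omega
  have habN : Even (a + 1 + (b + 1)) := by rw [Int.even_iff] at *; omega
  have habS : Even (a + 1 + (b - 1)) := by rw [Int.even_iff] at *; omega
  obtain ⟨O, hOdef⟩ : ∃ O, O = oddVerticals (completion a b k P) := ⟨_, rfl⟩
  have hO : ∀ v ∈ O, Odd (v.1 + v.2) := fun v hv => by rw [hOdef] at hv; exact hv.1
  obtain ⟨Km, hKm, hKmE⟩ := exists_unique_lowerMatching hO hab isFullOn_center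
    (G := completion a b k P) isFullOn_north
  obtain ⟨Kp, hKp, hKpE⟩ := exists_unique_upperMatching hO hab isFullOn_center
    (G := completion a b k P) isFullOn_south
  have hCN : diffCN a b k P = graphDiff
      (rowsPart ((completion a b k P).induce (coreVerts O (a + 2) b (k - 2))) (Set.Iic b))
      (rowsPart ((completion a b k P).induce (coreVerts O (a + 1) (b + 1) (k - 1)))
        (Set.Iio (b + 1))) := by
    rw [diffCN, subC, subN, core_inf_diamond isFullOn_center hab2,
      core_inf_diamond isFullOn_north habN, hOdef]
  have hCS : diffCS a b k P = graphDiff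
      (rowsPart ((completion a b k P).induce (coreVerts O (a + 2) b (k - 2))) (Set.Ici b))
      (rowsPart ((completion a b k P).induce (coreVerts O (a + 1) (b - 1) (k - 1)))
        (Set.Ioi (b - 1))) := by
    rw [diffCS, subC, subS, core_inf_diamond isFullOn_center hab2,
      core_inf_diamond isFullOn_south habS, hOdef]
  refine ⟨Km, Kp, by rwa [hCN], by rwa [hCS], ?_⟩
  have hw : ∀ e ∈ (completion a b k P).edgeSet,
      graphWeight (completion a b k P) e = MvPolynomial.X e := fun e he => if_pos he
  have hfull := isFullOn_completion a b k P
  -- The four extremal edges must have nonzero weight. Three of them are horizontal or even and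
  -- belong to the skeleton; the east one is odd and is present because `P` is closed.
  have htop : graphWeight (completion a b k P) (hEdge (a + k - 1) (b + k)) = .X (hEdge (a + k - 1) (b + k)) := by
    refine hw _ (hfull.horizontal _ _ ?_ ?_) <;> rw [mem_diamondVerts] <;> simp only [segStart] <;>
      split_ifs <;> omega
  have hbot : graphWeight (completion a b k P) (hEdge (a + k - 1) (b - k + 1)) = .X (hEdge (a + k - 1) (b - k + 1)) := by
    refine hw _ (hfull.horizontal _ _ ?_ ?_) <;> rw [mem_diamondVerts] <;> simp only [segStart] <;>
      split_ifs <;> omega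
  have hwest : graphWeight (completion a b k P) (vEdge a b) = .X (vEdge a b) := by
    refine hw _ (hfull.vertical _ _ ?_ ?_ hab) <;> rw [mem_diamondVerts] <;>
      simp only [segStart] <;> split_ifs <;> omega
  have heast : graphWeight (completion a b k P) (vEdge (a + 2 * k - 1) b) = .X (vEdge (a + 2 * k - 1) b) :=
    hw _ hP.east_mem.2
  have hcond := Pinecone.condensation a b k hk (graphWeight (completion a b k P))
  rw [htop, hbot, hwest, heast, diamondSum_graphWeight hfull hab,
    diamondSum_graphWeight isFullOn_center hab2, diamondSum_graphWeight isFullOn_west hab,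
    diamondSum_graphWeight isFullOn_east hab2, diamondSum_graphWeight isFullOn_north habN,
    diamondSum_graphWeight isFullOn_south habS, core_inf_diamond hfull hab,
    ← hP.eq_induce, ← hOdef] at hcond
  have hWE := hP.west_east_monomials
  rw [← hOdef] at hWE
  have hNS := hP.north_south_monomials hOdef hKmE hKpE
  -- This monomial multiplies `M(P) M(P^C)` in the condensation of the diamond. It is nonzero in an
  -- integral domain, so the identity can be proved after multiplication by it.
  have hne : edgeProd (forcedEdges O a b k) * edgeProd (forcedEdges O (a + 2) b (k - 2)) ≠ 0 :=
    mul_ne_zero (edgeProd_ne_zero (finite_forcedEdges _ _ _ _))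
      (edgeProd_ne_zero (finite_forcedEdges _ _ _ _))
  apply mul_left_cancel₀ hne
  simp only [subC, subW, subE, subN, subS]
  linear_combination hcond -
    matchingPoly (core a b (completion a b k P ⊓ diamond a b (k - 1))) *
      matchingPoly (core (a + 2) b (completion a b k P ⊓ diamond (a + 2) b (k - 1))) * hWE -
    matchingPoly (core (a + 1) (b + 1)
        (completion a b k P ⊓ diamond (a + 1) (b + 1) (k - 1))) *
      matchingPoly (core (a + 1) (b - 1)
        (completion a b k P ⊓ diamond (a + 1) (b - 1) (k - 1))) * hNS

end Pinecone

end

theorem mainTheorem5 (a b k : ℤ) (P : Pinecone.LatticeGraph)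
    (hP : Pinecone.IsClosedPinecone a b k P) :
    ∃ Km Kp : Pinecone.LatticeGraph,
      -- `Km` is the unique horizontal matching of `P^C_≤ ∖ P^N_<`
      (Pinecone.IsHorizontalMatchingOf (Pinecone.diffCN a b k P) Km ∧
        ∀ K, Pinecone.IsHorizontalMatchingOf (Pinecone.diffCN a b k P) K → K = Km) ∧
      -- `Kp` is the unique horizontal matching of `P^C_≥ ∖ P^S_>`
      (Pinecone.IsHorizontalMatchingOf (Pinecone.diffCS a b k P) Kp ∧
        ∀ K, Pinecone.IsHorizontalMatchingOf (Pinecone.diffCS a b k P) K → K = Kp) ∧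
      Pinecone.matchingPoly P * Pinecone.matchingPoly (Pinecone.subC a b k P) =
        Pinecone.edgeProd (Pinecone.edgesE1 a b k P) *
            Pinecone.matchingPoly (Pinecone.subW a b k P) *
            Pinecone.matchingPoly (Pinecone.subE a b k P) +
          Pinecone.edgeProd (Pinecone.edgesE2 a b k P) *
            -- `H⁻(P^C ∖ P^N)` and `H⁺(P^C ∖ P^S)`
            Pinecone.edgeProd (Pinecone.edgesAt Km b (Set.Iic 0)) *
            Pinecone.edgeProd (Pinecone.edgesAt Kp b (Set.Ioi 0)) *
            Pinecone.matchingPoly (Pinecone.subN a b k P) *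
            Pinecone.matchingPoly (Pinecone.subS a b k P) :=
  hP.condensation
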